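/- Let $|a|<M$, $\omega>0$ and $s,m,\Lambda\in\mathbb R$ (physically $2s\in\mathbb Z$). Put $r_\pm=M\pm\sqrt{M^2-a^2}$, $\Delta(r)=r^2-2Mr+a^2$, $K=(r^2+a^2)\omega-am$, and $$\xi=\frac{i(am-2Mr_+\omega)}{r_+-r_-},\qquad \eta=\frac{-i(am-2Mr_-\omega)}{r_+-r_-}.$$ The radial Teukolsky equation is $$\partial_r\Delta\,\partial_rR+\Big(\frac{K^2-2iK(r-M)s-(r-M)^2s^2}{\Delta}+4isr\omega-\Lambda\Big)R=0 ,$$ regarded in the complex $r$-plane. Let $R$ be an analytic solution of it in the half plane $\operatorname{Re} r>r_-$, cut along a ray from $r_+$ (to the left along the real axis in part (a), vertically upwards in part (b); powers and logarithms of $r-r_+$ are taken in this cut domain and are real-valued, respectively principal, for $r>r_+$). Assume that $R$ is ingoing at the horizon: near $r_+$, $R=(r-r_+)^{\xi-s/2}F_1(r)$ or, if $\xi=0$ and $s$ is a positive integer, $R=(r-r_+)^{-s/2}F_1(r)+(r-r_+)^{s/2}\ln(r-r_+)F_2(r)$, with $F_1,F_2$ analytic at $r_+$. This holds in particular if $R$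 has no incoming radiation, that is, if $R$ is ingoing at the horizon and in addition is a multiple of the outgoing solution $\sim e^{i\omega r}r^{2iM\omega-s-1}$ (recessive in the upper half plane) at infinity; the condition at infinity is not needed. For a contour $\mathcal C$ and real $x>r_+$ let $$\tilde g(x)=\int_{\mathcal C}e^{2i\omega\frac{(x-r_-)(r-r_-)}{r_+-r_-}}(r-r_-)^{\eta-s/2}(r-r_+)^{\xi-s/2}e^{-i\omega r}R(r)\,dr,$$ $$U(x)=(x^2+a^2)^{1/2}(x-r_-)^{-s}(x-r_+)^{-2iM\omega}e^{-i\omega x}\,\tilde g(x),$$ and let $d/dx_*=\frac{\Delta(x)}{x^2+a^2}\frac{d}{dx}$, and $$\tilde V=\frac{\Delta}{(x^2+a^2)^2}\tilde V_0-\frac{\Delta\,(a^2\Delta+2Mx(x^2-a^2))}{(x^2+a^2)^4},$$ $$\tilde V_0=-\Lambda+\Delta\omega^2\Big(\frac{x+r_-}{x-r_+}\Big)^2-4i\omega(x-r_-)\eta-\frac{x-r_+}{x-r_-}s^2 .$$ Then $\tilde V$ is real on $(r_+,\infty)$, and the following hold. (a) Let $s\le0$ and let $\mathcal C$ be the ray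 from $r_+$ to $r_++i\infty$. Then the integral converges absolutely for every $x>r_+$, $U$ is twice continuously differentiable and solves $\frac{d^2U}{dx_*^2}+\tilde VU=0$ on $(r_+,\infty)$, the limit $\lim_{r\to r_+}\Delta^{s/2}|R(r)|$ (for $r>r_+$ real) exists, and $$\lim_{x\to\infty}|U(x)|=C\lim_{r\to r_+}\Delta^{s/2}|R(r)|,\qquad C=\Big(\frac{r_+-r_-}{2\omega}\Big)^{1-s}(r_+-r_-)^{-s}\,e^{-\pi\operatorname{Im}\xi}\,|\Gamma(2\xi-s+1)| .$$ (b) Let $s$ be arbitrary, $0<\rho<r_+-r_-$, and let $\mathcal C$ be the rotated Hankel contour that runs vertically from $r_+-\rho+i\infty$ down to $r_+-\rho$, along the lower semicircle of radius $\rho$ about $r_+$ to $r_++\rho$, and vertically up to $r_++\rho+i\infty$. Then the same conclusions hold with $$C=\Big(\frac{r_+-r_-}{2\omega}\Big)^{1-s}(r_+-r_-)^{-s}\,e^{\pi\operatorname{Im}\xi}\,\frac{2\pi}{|\Gamma(s-2\xi)|}$$ (where $1/|\Gamma|=0$ at the poles of $\Gamma$). -/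

import Mathlib

open Set Filter Topology MeasureTheory

noncomputable section

/-- Parameters: mass `M` and rotation `a` of the black hole, spin weight `s`, azimuthal frequency
`m`, time frequency `ω`, separation constant `Λ`. -/
structure TeukolskyParams where
  M : ℝ
  a : ℝ
  s : ℝ
  m : ℝ
  ω : ℝ
  Λ : ℝ

namespace TeukolskyParams

variable (P : TeukolskyParams)

/-- Outer horizon radius `r₊`. -/
def rp : ℝ := P.M + √(P.M ^ 2 - P.a ^ 2)

/-- Inner horizon radius `r₋`. -/
def rm : ℝ := P.M - √(P.M ^ 2 - P.a ^ 2)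

/-- `ξ = i (a m - 2 M r₊ ω) / (r₊ - r₋)`. -/
def xi : ℂ :=
  Complex.I * ((P.a * P.m - 2 * P.M * P.rp * P.ω : ℝ) : ℂ) / ((P.rp - P.rm : ℝ) : ℂ)

/-- `η = -i (a m - 2 M r₋ ω) / (r₊ - r₋)`. -/
def eta : ℂ :=
  -Complex.I * ((P.a * P.m - 2 * P.M * P.rm * P.ω : ℝ) : ℂ) / ((P.rp - P.rm : ℝ) : ℂ)

/-- `Δ(r) = r² - 2 M r + a²` for complex `r`. -/
def Delta (r : ℂ) : ℂ := r ^ 2 - 2 * P.M * r + P.a ^ 2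

/-- `Δ(x) = x² - 2 M x + a²` for real `x`. -/
def DeltaReal (x : ℝ) : ℝ := x ^ 2 - 2 * P.M * x + P.a ^ 2

/-- `K(r) = (r² + a²) ω - a m`. -/
def K (r : ℂ) : ℂ := (r ^ 2 + P.a ^ 2) * P.ω - P.a * P.m

/-- The radial Teukolsky operator, with complex independent variable. -/
def radialOp (R : ℂ → ℂ) (r : ℂ) : ℂ :=
  deriv (fun z => P.Delta z * deriv R z) r
    + ((P.K r ^ 2 - 2 * Complex.I * P.K r * (r - P.M) * P.s - (r - P.M) ^ 2 * P.s ^ 2)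
          / P.Delta r
        + 4 * P.s * Complex.I * r * P.ω - P.Λ) * R r

/-- The half plane `Re r > r₋`, cut along the ray that starts at `r₊` in the direction `-c⁻¹`.
For `c = 1` the cut runs to the left along the real axis; for `c = i` it runs vertically upwards.
Both domains are simply connected, contain `(r₊, ∞)` and avoid the singular points `r₋`, `r₊`. -/
def cutDomain (c : ℂ) : Set ℂ :=
  {r | P.rm < r.re ∧ c * (r - P.rp) ∈ Complex.slitPlane}

end TeukolskyParams

/-- The branch of `log z` with the cut `c z ∈ (-∞, 0]`. For `c = 1` this is the principal branch
(`arg z ∈ (-π, π]`); for `c = i` it is the branch with `arg z ∈ (-3π/2, π/2]`. Both are real for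
`z > 0`. -/
def branchLog (c z : ℂ) : ℂ := Complex.log (c * z) - Complex.log c

/-- The power `z ^ β` with the branch `branchLog c` of the logarithm. -/
def branchPow (c z β : ℂ) : ℂ := Complex.exp (β * branchLog c z)

namespace TeukolskyParams

variable (P : TeukolskyParams)

/-- `R` is an analytic solution of the radial Teukolsky equation in the cut domain. -/
def IsRadialSolution (c : ℂ) (R : ℂ → ℂ) : Prop :=
  DifferentiableOn ℂ R (P.cutDomain c) ∧ ∀ r ∈ P.cutDomain c, P.radialOp R r = 0

/-- The resonant case at `r₊`: `ξ = 0` and `s` is a positive integer. -/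
def Resonant : Prop := P.xi = 0 ∧ ∃ n : ℕ, 0 < n ∧ P.s = n

/-- `R` is ingoing at the horizon: near `r₊` it is a Frobenius solution with exponent `ξ - s/2`,
that is, `R = (r - r₊) ^ (ξ - s/2) F₁(r)` with `F₁` analytic at `r₊`. In the resonant case the
Frobenius solutions with this exponent (which is then `-s/2`) also contain a logarithmic term
`(r - r₊) ^ (s/2) log (r - r₊) F₂(r)`. -/
def IngoingAtHorizon (c : ℂ) (R : ℂ → ℂ) : Prop :=
  ∃ F₁ F₂ : ℂ → ℂ, AnalyticAt ℂ F₁ P.rp ∧ AnalyticAt ℂ F₂ P.rp ∧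
    (¬ P.Resonant → ∀ r, F₂ r = 0) ∧
    ∀ᶠ r in 𝓝[P.cutDomain c] (P.rp : ℂ),
      R r = branchPow c (r - P.rp) (P.xi - P.s / 2) * F₁ r
        + branchPow c (r - P.rp) (P.s / 2) * branchLog c (r - P.rp) * F₂ r

/-- `R` is outgoing at infinity: `R ∼ const · e^{iωr} r^{2iMω} r^{-s-1}` as `r → ∞`, on the real
axis and in sectors of the upper half plane (in which this is the recessive normal solution). -/
def OutgoingAtInfinity (R : ℂ → ℂ) : Prop :=
  ∃ A : ℂ, ∀ β : ℝ, β < Real.pi / 2 →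
    Tendsto
      (fun r : ℂ => R r / (Complex.exp (Complex.I * P.ω * r)
        * r ^ (2 * Complex.I * P.M * P.ω - P.s - 1)))
      (Bornology.cobounded ℂ ⊓ 𝓟 {r : ℂ | 0 ≤ r.arg ∧ r.arg ≤ β}) (𝓝 A)

/-- The no incoming radiation condition: ingoing at the horizon and outgoing at infinity. The
theorem uses only the first field. -/
structure NoIncomingRadiation (c : ℂ) (R : ℂ → ℂ) : Prop where
  horizon : P.IngoingAtHorizon c R
  infinity : P.OutgoingAtInfinity R

/-- The integrand of the integral transform, as a function of `x` (real) and `r` (complex). -/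
def transformIntegrand (c : ℂ) (R : ℂ → ℂ) (x : ℝ) (r : ℂ) : ℂ :=
  Complex.exp (2 * Complex.I * P.ω * ((x - P.rm) * (r - P.rm) / (P.rp - P.rm)))
    * (r - P.rm) ^ (P.eta - P.s / 2)
    * branchPow c (r - P.rp) (P.xi - P.s / 2)
    * Complex.exp (-Complex.I * P.ω * r) * R r

/-- The contour integral of `f` along the vertical ray from `z` to `z + i∞`. -/
def verticalIntegral (f : ℂ → ℂ) (z : ℂ) : ℂ :=
  ∫ t in Ioi (0 : ℝ), Complex.I * f (z + t * Complex.I)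

/-- The contour integral of `f` along the vertical ray from `z` to `z + i∞` converges
absolutely. -/
def VerticalIntegrable (f : ℂ → ℂ) (z : ℂ) : Prop :=
  IntegrableOn (fun t : ℝ => f (z + t * Complex.I)) (Ioi (0 : ℝ))

/-- The contour integral of `f` along the lower semicircle from `r₊ - ρ` to `r₊ + ρ`. -/
def semicircleIntegral (f : ℂ → ℂ) (ρ : ℝ) : ℂ :=
  ∫ θ in (-Real.pi)..0, deriv (circleMap (P.rp : ℂ) ρ) θ * f (circleMap (P.rp : ℂ) ρ θ)

/-- The integral transform along the ray from `r₊` to `r₊ + i∞`. -/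
def eulerTransform (R : ℂ → ℂ) (x : ℝ) : ℂ :=
  verticalIntegral (P.transformIntegrand 1 R x) P.rp

/-- The integral transform along the rotated Hankel contour: down the vertical ray from
`r₊ - ρ + i∞` to `r₊ - ρ`, along the lower semicircle to `r₊ + ρ`, and up the vertical ray to
`r₊ + ρ + i∞`. -/
def hankelTransform (ρ : ℝ) (R : ℂ → ℂ) (x : ℝ) : ℂ :=
  -verticalIntegral (P.transformIntegrand Complex.I R x) (P.rp - ρ)
    + P.semicircleIntegral (P.transformIntegrand Complex.I R x) ρ
    + verticalIntegral (P.transformIntegrand Complex.I R x) (P.rp + ρ)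

/-- `U(x) = (x² + a²)^{1/2} (x - r₋)^{-s} (x - r₊)^{-2iMω} e^{-iωx} g(x)`. -/
def toU (g : ℝ → ℂ) (x : ℝ) : ℂ :=
  (√(x ^ 2 + P.a ^ 2) : ℂ) * (((x - P.rm : ℝ) : ℂ) ^ (-P.s : ℂ)
    * ((x - P.rp : ℝ) : ℂ) ^ (-2 * Complex.I * P.M * P.ω)
    * Complex.exp (-Complex.I * P.ω * x) * g x)

/-- The derivative `d/dx⋆ = (Δ / (x² + a²)) d/dx` with respect to the tortoise coordinate. -/
def tortoiseDeriv (U : ℝ → ℂ) (x : ℝ) : ℂ :=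
  ((P.DeltaReal x / (x ^ 2 + P.a ^ 2) : ℝ) : ℂ) * deriv U x

/-- The potential of the transformed equation in self-adjoint form. -/
def V0tilde (x : ℝ) : ℂ :=
  -P.Λ + P.DeltaReal x * P.ω ^ 2 * ((x + P.rm) / (x - P.rp)) ^ 2
    - 4 * Complex.I * P.ω * (x - P.rm) * P.eta - (x - P.rp) / (x - P.rm) * P.s ^ 2

/-- The rescaling term of the potential. -/
def Vresc (x : ℝ) : ℝ :=
  P.DeltaReal x / (x ^ 2 + P.a ^ 2) ^ 4
    * (P.a ^ 2 * P.DeltaReal x + 2 * P.M * x * (x ^ 2 - P.a ^ 2))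

/-- The potential of the transformed Schrödinger equation. -/
def Vtilde (x : ℝ) : ℂ :=
  ((P.DeltaReal x / (x ^ 2 + P.a ^ 2) ^ 2 : ℝ) : ℂ) * P.V0tilde x - P.Vresc x

/-- `U` is a (twice continuously differentiable) solution of `U'' + Ṽ U = 0` on `(r₊, ∞)`, where
the prime is `d/dx⋆`. -/
def SolvesTransformed (U : ℝ → ℂ) : Prop :=
  ContDiffOn ℝ 2 U (Ioi P.rp) ∧
    ∀ x > P.rp, P.tortoiseDeriv (P.tortoiseDeriv U) x + P.Vtilde x * U x = 0

/-- The constant for the ray from `r₊` to `r₊ + i∞`. -/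
def eulerConst : ℝ :=
  ((P.rp - P.rm) / (2 * P.ω)) ^ (1 - P.s) * (P.rp - P.rm) ^ (-P.s)
    * Real.exp (-Real.pi * P.xi.im) * ‖Complex.Gamma (2 * P.xi - P.s + 1)‖

/-- The constant for the rotated Hankel contour. (At a pole of `Γ` the value of
`Complex.Gamma` is `0`, so that the quotient is `0`, as is `1 / Γ`.) -/
def hankelConst : ℝ :=
  ((P.rp - P.rm) / (2 * P.ω)) ^ (1 - P.s) * (P.rp - P.rm) ^ (-P.s)
    * Real.exp (Real.pi * P.xi.im) * (2 * Real.pi / ‖Complex.Gamma (P.s - 2 * P.xi)‖)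

end TeukolskyParams

end

noncomputable section

/-! ### The branch of the power function -/

/-! The transform works because kernel, weight and equation fit together. Put ℓ = -iK - (r - M)s
(`weightLog`). The singular part of the radial potential is exactly -ℓ²/Δ, and the weight w
satisfies Δw' = ℓw. When the formally self-adjoint radial operator acts on e^{f(x)(r - r₋)} w(r),
with f(x) the frequency `freq`, the terms with 1/Δ therefore cancel, and the result is the same
function times a polynomial of degree two in r (`concomitant_hasDerivAt`). On the kernel, d/dx is
multiplication by a linear function of r, and the quadratic polynomial is the symbol of a
second-order operator in x (`symbol_eq`). Integration along a contour shows that the transform g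
solves this equation in x up to boundary values of the bilinear concomitant; the factors in U then
bring it to Schrödinger form (`solvesTransformed_toU`).

Convergence needs only the differential equation. On a vertical line r = z + it an energy estimate
bounds R and R' by e^{(ω+ε)t} (`IsRadialSolution.expType_line`), the weight contributes another
e^{ωt} up to subexponential factors, and the kernel decays like e^{-yt} with y = `P.rate x` > 2ω for
x > r₊. So the integrals and their x-derivatives converge, and the concomitant vanishes at i∞. At
the other end, for the ray the concomitant is (r - r₊)^{2ξ-s}, bounded if s ≤ 0, times a function
vanishing at r₊ (`tendsto_concomitant_rp`); for the Hankel contour the boundary values of the three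
pieces telescope.

Large x means large frequency y, so only the neighbourhood of r₊ contributes. There wR = (r - r₊)^β
G with β = 2ξ - s and G → G₀. On the ray, Watson's lemma gives i^{β+1} Γ(β+1) G₀ y^{-β-1} to leading
order (`tendsto_euler_kernel`). The Hankel contour is deformed into a wedge with apex r₊ and an
inner arc of radius 1/y, with exponentially small tails left over; rescaling by y leaves G₀ times
the model integral `wedgeConst β` (`tendsto_hankel_kernel`). This integral is entire in β. For Re β
> -1 the arc can be shrunk to the apex and the reflection formula gives a multiple of 1/Γ(-β);
analytic continuation extends this to all β, hence to all s (`wedgeConst_eq`). Since ξ and η are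
purely imaginary, all moduli are explicit. -/

theorem branchLog_hasDerivAt {c z : ℂ} (hz : c * z ∈ Complex.slitPlane) :
    HasDerivAt (branchLog c) z⁻¹ z := by
  have h := ((hasDerivAt_id z).const_mul c).clog hz
  have hcz := Complex.slitPlane_ne_zero hz
  have hc : c ≠ 0 := left_ne_zero_of_mul hcz
  have hz0 : z ≠ 0 := right_ne_zero_of_mul hcz
  refine (h.sub_const (Complex.log c)).congr_deriv ?_
  simp only [id]
  field_simp

theorem branchPow_hasDerivAt {c z : ℂ} (β : ℂ) (hz : c * z ∈ Complex.slitPlane) :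
    HasDerivAt (fun z => branchPow c z β) (branchPow c z β * (β / z)) z := by
  refine (((branchLog_hasDerivAt hz).const_mul β).cexp).congr_deriv ?_
  rw [branchPow, div_eq_mul_inv]

theorem branchPow_add (c z β γ : ℂ) :
    branchPow c z (β + γ) = branchPow c z β * branchPow c z γ := by
  rw [branchPow, branchPow, branchPow, add_mul, Complex.exp_add]

/-- `branchLog` is compatible with multiplication by positive reals. -/
theorem branchLog_ofReal_mul {c z : ℂ} (hc : c ≠ 0) (hz : z ≠ 0) {u : ℝ} (hu : 0 < u) :
    branchLog c (u * z) = Real.log u + branchLog c z := by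
  rw [branchLog, branchLog, mul_left_comm, Complex.log_ofReal_mul hu (mul_ne_zero hc hz)]
  ring

theorem branchPow_ofReal_mul {c z : ℂ} (hc : c ≠ 0) (hz : z ≠ 0) {u : ℝ} (hu : 0 < u) (β : ℂ) :
    branchPow c (u * z) β = (u : ℂ) ^ β * branchPow c z β := by
  rw [branchPow, branchPow, branchLog_ofReal_mul hc hz hu, mul_add, Complex.exp_add,
    Complex.cpow_def_of_ne_zero (by exact_mod_cast hu.ne'), Complex.ofReal_log hu.le, mul_comm β]

/-- `branchLog` is real for positive reals. -/
theorem branchLog_ofReal {c : ℂ} (hc : c ≠ 0) {u : ℝ} (hu : 0 < u) :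
    branchLog c u = Real.log u := by
  have := branchLog_ofReal_mul hc one_ne_zero hu
  rw [mul_one] at this
  rw [this, branchLog, mul_one, sub_self, add_zero]

theorem branchPow_ofReal {c : ℂ} (hc : c ≠ 0) {u : ℝ} (hu : 0 < u) (β : ℂ) :
    branchPow c u β = (u : ℂ) ^ β := by
  rw [branchPow, branchLog_ofReal hc hu, Complex.cpow_def_of_ne_zero (by exact_mod_cast hu.ne'),
    Complex.ofReal_log hu.le, mul_comm β]

theorem branchLog_re {c : ℂ} (hc : ‖c‖ = 1) (z : ℂ) : (branchLog c z).re = Real.log ‖z‖ := by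
  simp [branchLog, Complex.log_re, hc]

theorem abs_branchLog_im_le (c z : ℂ) : |(branchLog c z).im| ≤ 2 * Real.pi := by
  rw [branchLog, Complex.sub_im, Complex.log_im, Complex.log_im]
  have h1 := Complex.abs_arg_le_pi (c * z)
  have h2 := Complex.abs_arg_le_pi c
  have h3 := abs_sub (c * z).arg c.arg
  linarith

theorem norm_branchPow {c z : ℂ} (hc : ‖c‖ = 1) (hz : z ≠ 0) (β : ℂ) :
    ‖branchPow c z β‖ = ‖z‖ ^ β.re * Real.exp (-(β.im * (branchLog c z).im)) := by
  rw [branchPow, Complex.norm_exp, Complex.mul_re, branchLog_re hc,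
    Real.rpow_def_of_pos (norm_pos_iff.2 hz), ← Real.exp_add]
  ring_nf

/-- The imaginary part of the logarithm is bounded uniformly, so an imaginary exponent changes the
size of a power only by a constant factor. -/
theorem norm_branchPow_le {c z : ℂ} (hc : ‖c‖ = 1) (hz : z ≠ 0) (β : ℂ) :
    ‖branchPow c z β‖ ≤ ‖z‖ ^ β.re * Real.exp (|β.im| * (2 * Real.pi)) := by
  rw [norm_branchPow hc hz]
  gcongr
  refine (neg_le_abs _).trans ?_
  rw [abs_mul]
  gcongr
  exact abs_branchLog_im_le c z

namespace TeukolskyParams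

variable {P : TeukolskyParams}

/-! ### Horizon radii -/

theorem rm_lt_rp (hM : |P.a| < P.M) : P.rm < P.rp := by
  have : 0 < P.M ^ 2 - P.a ^ 2 := by
    have := sq_lt_sq' (by linarith [abs_nonneg P.a, neg_abs_le |P.a|]) hM
    rw [sq_abs] at this
    linarith
  have := Real.sqrt_pos.2 this
  rw [rp, rm]
  linarith

theorem rp_sub_rm_pos (hM : |P.a| < P.M) : 0 < P.rp - P.rm := sub_pos.2 (rm_lt_rp hM)

theorem M_eq : P.M = (P.rp + P.rm) / 2 := by
  rw [rp, rm]
  ring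

theorem a_sq_eq (hM : |P.a| < P.M) : P.a ^ 2 = P.rp * P.rm := by
  have : 0 ≤ P.M ^ 2 - P.a ^ 2 := by
    have := sq_lt_sq' (by linarith [abs_nonneg P.a, neg_abs_le |P.a|]) hM
    rw [sq_abs] at this
    linarith
  have := Real.sq_sqrt this
  rw [rp, rm]
  linear_combination this

theorem M_eq_complex : (P.M : ℂ) = (P.rp + P.rm) / 2 := by
  rw [M_eq]
  push_cast
  ring

theorem a_sq_eq_complex (hM : |P.a| < P.M) : (P.a : ℂ) ^ 2 = P.rp * P.rm := by
  exact_mod_cast a_sq_eq hM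

theorem rp_pos (hM : |P.a| < P.M) : 0 < P.rp := by
  have := Real.sqrt_nonneg (P.M ^ 2 - P.a ^ 2)
  rw [rp]
  linarith [abs_nonneg P.a]

theorem Delta_eq (hM : |P.a| < P.M) (r : ℂ) : P.Delta r = (r - P.rm) * (r - P.rp) := by
  rw [Delta, a_sq_eq_complex hM, M_eq_complex]
  ring

theorem DeltaReal_eq (hM : |P.a| < P.M) (x : ℝ) :
    P.DeltaReal x = (x - P.rm) * (x - P.rp) := by
  rw [DeltaReal, a_sq_eq hM, M_eq]
  ring

theorem rp_sub_rm_ne (hM : |P.a| < P.M) : (P.rp : ℂ) - P.rm ≠ 0 := by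
  exact_mod_cast (rp_sub_rm_pos hM).ne'

theorem Delta_hasDerivAt (r : ℂ) : HasDerivAt P.Delta (2 * r - 2 * P.M) r := by
  have := (((hasDerivAt_id r).pow 2).sub ((hasDerivAt_id r).const_mul (2 * (P.M : ℂ)))).add_const
    ((P.a : ℂ) ^ 2)
  refine this.congr_deriv ?_
  simp

theorem K_hasDerivAt (r : ℂ) : HasDerivAt P.K (2 * r * P.ω) r := by
  have := ((((hasDerivAt_id r).pow 2).add_const ((P.a : ℂ) ^ 2)).mul_const (P.ω : ℂ)).sub_const
    ((P.a : ℂ) * P.m)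
  refine this.congr_deriv ?_
  simp

theorem xi_eq :
    P.xi = -Complex.I * ((P.rp * (P.rp + P.rm)) * P.ω - P.a * P.m) / (P.rp - P.rm) := by
  rw [xi]
  push_cast
  rw [M_eq_complex]
  ring

theorem eta_eq :
    P.eta = Complex.I * ((P.rm * (P.rp + P.rm)) * P.ω - P.a * P.m) / (P.rp - P.rm) := by
  rw [eta]
  push_cast
  rw [M_eq_complex]
  ring

theorem xi_re : P.xi.re = 0 := by
  rw [xi, mul_div_assoc, ← Complex.ofReal_div, Complex.I_mul_re, Complex.ofReal_im, neg_zero]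

/-! ### The cut domain -/

theorem isOpen_cutDomain (c : ℂ) : IsOpen (P.cutDomain c) :=
  (isOpen_lt continuous_const Complex.continuous_re).inter
    (Complex.isOpen_slitPlane.preimage (by fun_prop))

theorem sub_rm_mem_slitPlane {c r : ℂ} (hr : r ∈ P.cutDomain c) :
    r - P.rm ∈ Complex.slitPlane := by
  left
  simpa using hr.1

theorem sub_rm_ne {c r : ℂ} (hr : r ∈ P.cutDomain c) : r - P.rm ≠ 0 :=
  Complex.slitPlane_ne_zero (sub_rm_mem_slitPlane hr)

theorem sub_rp_ne {c r : ℂ} (hr : r ∈ P.cutDomain c) : r - P.rp ≠ 0 :=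
  right_ne_zero_of_mul (Complex.slitPlane_ne_zero hr.2)

theorem Delta_ne_zero (hM : |P.a| < P.M) {c r : ℂ} (hr : r ∈ P.cutDomain c) : P.Delta r ≠ 0 := by
  rw [Delta_eq hM]
  exact mul_ne_zero (sub_rm_ne hr) (sub_rp_ne hr)

/-! ### The weight of the integral transform -/

/-- The weight that multiplies `R` in the integral transform. -/
def weight (P : TeukolskyParams) (c r : ℂ) : ℂ :=
  (r - P.rm) ^ (P.eta - P.s / 2) * branchPow c (r - P.rp) (P.xi - P.s / 2)
    * Complex.exp (-Complex.I * P.ω * r)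

/-- `Δ` times the logarithmic derivative of the weight. -/
def weightLog (P : TeukolskyParams) (r : ℂ) : ℂ := -Complex.I * P.K r - (r - P.M) * P.s

theorem weightLog_hasDerivAt (r : ℂ) :
    HasDerivAt P.weightLog (-Complex.I * (2 * r * P.ω) - P.s) r := by
  have := ((K_hasDerivAt (P := P) r).const_mul (-Complex.I)).sub
    (((hasDerivAt_id r).sub_const (P.M : ℂ)).mul_const (P.s : ℂ))
  refine this.congr_deriv ?_
  simp

/-- Division by Δ turns this into the partial fraction expansion of ℓ/Δ: the residues at r₊ and r₋
are the exponents ξ - s/2 and η - s/2, and the constant term is -iω. This is where the definitions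
of ξ and η come from. -/
theorem weightLog_eq (hM : |P.a| < P.M) (r : ℂ) :
    P.weightLog r = (P.eta - P.s / 2) * (r - P.rp) + (P.xi - P.s / 2) * (r - P.rm)
      - Complex.I * P.ω * ((r - P.rm) * (r - P.rp)) := by
  have hL := rp_sub_rm_ne hM
  rw [weightLog, K, xi_eq, eta_eq, a_sq_eq_complex hM, M_eq_complex]
  field_simp
  ring

theorem weight_hasDerivAt (hM : |P.a| < P.M) {c r : ℂ} (hr : r ∈ P.cutDomain c) :
    HasDerivAt (P.weight c) (P.weight c r * (P.weightLog r / P.Delta r)) r := by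
  have h1 : HasDerivAt (fun r : ℂ => (r - P.rm) ^ (P.eta - P.s / 2))
      ((r - P.rm) ^ (P.eta - P.s / 2) * ((P.eta - P.s / 2) / (r - P.rm))) r := by
    refine (((hasDerivAt_id r).sub_const (P.rm : ℂ)).cpow_const
      (sub_rm_mem_slitPlane hr)).congr_deriv ?_
    simp only [id]
    rw [Complex.cpow_sub _ _ (sub_rm_ne hr), Complex.cpow_one]
    ring
  have h2 : HasDerivAt (fun r : ℂ => branchPow c (r - P.rp) (P.xi - P.s / 2))
      (branchPow c (r - P.rp) (P.xi - P.s / 2) * ((P.xi - P.s / 2) / (r - P.rp))) r := by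
    exact (branchPow_hasDerivAt (P.xi - P.s / 2) hr.2).comp_sub_const r (P.rp : ℂ)
  have h3 : HasDerivAt (fun r : ℂ => Complex.exp (-Complex.I * P.ω * r))
      (Complex.exp (-Complex.I * P.ω * r) * (-Complex.I * P.ω)) r := by
    simpa using ((hasDerivAt_id r).const_mul (-Complex.I * P.ω)).cexp
  refine ((h1.mul h2).mul h3).congr_deriv ?_
  simp only [Pi.mul_apply]
  rw [weightLog_eq hM, Delta_eq hM, weight]
  have := sub_rm_ne hr
  have := sub_rp_ne hr
  field_simp
  ring

/-! ### The radial equation -/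

/-- The numerator K² - 2iK(r - M)s - (r - M)²s² is the perfect square -ℓ². Solved for R'', the
equation then involves the same ℓ as the logarithmic derivative of the weight. -/
theorem IsRadialSolution.deriv_deriv (hM : |P.a| < P.M) {c : ℂ} {R : ℂ → ℂ}
    (hR : P.IsRadialSolution c R) {r : ℂ} (hr : r ∈ P.cutDomain c) :
    HasDerivAt R (deriv R r) r ∧
    HasDerivAt (deriv R) (-((2 * r - 2 * P.M) * deriv R r
      + (-(P.weightLog r) ^ 2 / P.Delta r + 4 * P.s * Complex.I * r * P.ω - P.Λ) * R r)
        / P.Delta r) r := by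
  have ho := (isOpen_cutDomain (P := P) c).mem_nhds hr
  have h1 := (hR.1.differentiableAt ho).hasDerivAt
  have h2 := ((hR.1.deriv (isOpen_cutDomain c)).differentiableAt ho).hasDerivAt
  refine ⟨h1, h2.congr_deriv ?_⟩
  have h3 := hR.2 r hr
  rw [radialOp, ((Delta_hasDerivAt r).fun_mul h2).deriv] at h3
  have hΔ := Delta_ne_zero hM hr
  have h4 : (P.K r ^ 2 - 2 * Complex.I * P.K r * (r - P.M) * P.s - (r - P.M) ^ 2 * P.s ^ 2)
      = -(P.weightLog r) ^ 2 := by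
    rw [weightLog]
    linear_combination (P.K r ^ 2) * Complex.I_sq
  rw [h4] at h3
  field_simp at h3 ⊢
  linear_combination h3

/-- The frequency of the kernel of the integral transform. -/
def freq (P : TeukolskyParams) (x : ℂ) : ℂ :=
  2 * Complex.I * P.ω * (x - P.rm) / (P.rp - P.rm)

theorem transformIntegrand_eq (c : ℂ) (R : ℂ → ℂ) (x : ℝ) (r : ℂ) :
    P.transformIntegrand c R x r =
      Complex.exp (P.freq x * (r - P.rm)) * (P.weight c r * R r) := by
  rw [transformIntegrand, weight, freq]
  have : 2 * Complex.I * P.ω * ((x - P.rm) * (r - P.rm) / (P.rp - P.rm))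
      = 2 * Complex.I * P.ω * (x - P.rm) / (P.rp - P.rm) * (r - P.rm) := by ring
  rw [this]
  ring

/-- The bilinear concomitant of the kernel and the solution. -/
def concomitant (P : TeukolskyParams) (c : ℂ) (R : ℂ → ℂ) (x : ℝ) (r : ℂ) : ℂ :=
  Complex.exp (P.freq x * (r - P.rm)) * (P.weight c r
    * (P.Delta r * deriv R r - (P.weightLog r + P.Delta r * P.freq x) * R r))

/-- The symbol of the adjoint operator on the kernel. -/
def symbol (P : TeukolskyParams) (x : ℝ) (r : ℂ) : ℂ :=
  P.freq x ^ 2 * P.Delta r + P.freq x * (2 * r - 2 * P.M + 2 * P.weightLog r)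
    + (-Complex.I * (2 * r * P.ω) - P.s) + (4 * P.s * Complex.I * r * P.ω - P.Λ)

/-- This is Lagrange's identity: with v = kernel · weight, the concomitant is vΔR' - Δv'R.
Differentiation leaves -R times the radial operator applied to v, because R is annihilated. The term
ℓ²/Δ produced by the weight cancels the -ℓ²/Δ of the potential, so the symbol has no poles. -/
theorem concomitant_hasDerivAt (hM : |P.a| < P.M) {c : ℂ} {R : ℂ → ℂ}
    (hR : P.IsRadialSolution c R) (x : ℝ) {r : ℂ} (hr : r ∈ P.cutDomain c) :
    HasDerivAt (P.concomitant c R x) (-(P.symbol x r * P.transformIntegrand c R x r)) r := by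
  obtain ⟨h1, h2⟩ := hR.deriv_deriv hM hr
  have hk : HasDerivAt (fun r : ℂ => Complex.exp (P.freq x * (r - P.rm)))
      (Complex.exp (P.freq x * (r - P.rm)) * P.freq x) r := by
    simpa using (((hasDerivAt_id r).sub_const (P.rm : ℂ)).const_mul (P.freq x)).cexp
  have hΔ := Delta_hasDerivAt (P := P) r
  have := hk.mul ((weight_hasDerivAt hM hr).mul ((hΔ.mul h2).sub
    (((weightLog_hasDerivAt (P := P) r).add (hΔ.mul_const (P.freq x))).mul h1)))
  refine this.congr_deriv ?_
  have hΔ0 := Delta_ne_zero hM hr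
  simp only [Pi.mul_apply, Pi.add_apply, Pi.sub_apply]
  rw [transformIntegrand_eq, symbol]
  field_simp
  ring

end TeukolskyParams

/-! ### The differential equation in x -/

namespace TeukolskyParams

variable {P : TeukolskyParams}

/-- `Δ` times the logarithmic derivative of `(x - r₋)^{-s} (x - r₊)^{-2iMω} e^{-iωx}`. -/
def prefactorLog (P : TeukolskyParams) (x : ℂ) : ℂ :=
  -P.s * (x - P.rp) - 2 * Complex.I * P.M * P.ω * (x - P.rm)
    - Complex.I * P.ω * ((x - P.rm) * (x - P.rp))

/-- The derivative of `prefactorLog`. -/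
def prefactorLog' (P : TeukolskyParams) (x : ℂ) : ℂ :=
  -P.s - 2 * Complex.I * P.M * P.ω - Complex.I * P.ω * ((x - P.rm) + (x - P.rp))

/-- The coefficient of `g'` in the equation satisfied by the integral transform `g`. -/
def transformCoeff₁ (P : TeukolskyParams) (x : ℝ) : ℂ :=
  2 * P.prefactorLog x + (2 * x - 2 * P.M)

/-- The coefficient of `g` in the equation satisfied by the integral transform `g`. -/
def transformCoeff₀ (P : TeukolskyParams) (x : ℝ) : ℂ :=
  P.prefactorLog' x + P.prefactorLog x ^ 2 / P.DeltaReal x + P.V0tilde x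

/-- The factor by which differentiation with respect to `x` multiplies the kernel. -/
def kernelLog (P : TeukolskyParams) (r : ℂ) : ℂ :=
  2 * Complex.I * P.ω / (P.rp - P.rm) * (r - P.rm)

theorem freq_mul (x r : ℂ) : P.freq x * (r - P.rm) = (x - P.rm) * P.kernelLog r := by
  rw [freq, kernelLog]
  ring

/-- Each factor `kernelLog` stands for one x-derivative of the kernel. Comparing coefficients of the
powers of r is what singles out the prefactor and the potential `V0tilde`; everything reduces to a
polynomial identity once M, a² and η are expressed through r₊ and r₋. -/
theorem symbol_eq (hM : |P.a| < P.M) {x : ℝ} (hx : P.rp < x) (r : ℂ) :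
    P.symbol x r = P.DeltaReal x * P.kernelLog r ^ 2 + P.transformCoeff₁ x * P.kernelLog r
      + P.transformCoeff₀ x := by
  have h1 : (x : ℂ) - P.rp ≠ 0 := by exact_mod_cast (sub_pos.2 hx).ne'
  have h2 : (x : ℂ) - P.rm ≠ 0 := by exact_mod_cast (sub_pos.2 ((rm_lt_rp hM).trans hx)).ne'
  have h3 := rp_sub_rm_ne hM
  rw [symbol, transformCoeff₁, transformCoeff₀, prefactorLog, prefactorLog', V0tilde, freq,
    kernelLog, Delta_eq hM, DeltaReal_eq hM, weightLog, K, a_sq_eq_complex hM, M_eq_complex,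
    eta_eq]
  push_cast
  field_simp
  ring_nf
  simp only [Complex.I_sq]
  ring

/-- The only complex term is 4iω(x - r₋)η, and iη is real because η is purely imaginary. -/
theorem Vtilde_im (hM : |P.a| < P.M) {x : ℝ} : (P.Vtilde x).im = 0 := by
  have : P.V0tilde x = ((-P.Λ + P.DeltaReal x * P.ω ^ 2 * ((x + P.rm) / (x - P.rp)) ^ 2
    + 4 * P.ω * (x - P.rm) * ((P.rm * (P.rp + P.rm)) * P.ω - P.a * P.m) / (P.rp - P.rm)
    - (x - P.rp) / (x - P.rm) * P.s ^ 2 : ℝ) : ℂ) := by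
    rw [V0tilde, eta_eq]
    push_cast
    have h3 := rp_sub_rm_ne hM
    field_simp
    linear_combination (-4 * (P.ω : ℂ) * (x - P.rm) * ((P.rm * (P.rp + P.rm)) * P.ω - P.a * P.m))
      * Complex.I_sq
  rw [Vtilde, this, ← Complex.ofReal_mul, ← Complex.ofReal_sub, Complex.ofReal_im]

end TeukolskyParams

/-! ### Passage to the Schrödinger form -/

namespace TeukolskyParams

variable {P : TeukolskyParams}

/-- The exponential prefactor in the definition of `U`, without the square root. -/
def prefactor (P : TeukolskyParams) (x : ℝ) : ℂ :=
  ((x - P.rm : ℝ) : ℂ) ^ (-P.s : ℂ) * ((x - P.rp : ℝ) : ℂ) ^ (-2 * Complex.I * P.M * P.ω)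
    * Complex.exp (-Complex.I * P.ω * x)

theorem ofReal_sub_cpow_hasDerivAt {x b : ℝ} (hx : b < x) (γ : ℂ) :
    HasDerivAt (fun x : ℝ => ((x - b : ℝ) : ℂ) ^ γ) (((x - b : ℝ) : ℂ) ^ γ * (γ / (x - b))) x := by
  have hb : (0 : ℝ) < x - b := sub_pos.2 hx
  have hb' : (x : ℂ) - b ≠ 0 := by exact_mod_cast hb.ne'
  have h := (((hasDerivAt_id (x : ℂ)).sub_const (b : ℂ)).cpow_const (c := γ)
    (Or.inl (by simpa using hb))).comp_ofReal
  push_cast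
  refine h.congr_deriv ?_
  simp only [id]
  rw [Complex.cpow_sub _ _ hb', Complex.cpow_one]
  ring

theorem prefactor_hasDerivAt (hM : |P.a| < P.M) {x : ℝ} (hx : P.rp < x) :
    HasDerivAt P.prefactor (P.prefactor x * (P.prefactorLog x / P.DeltaReal x)) x := by
  have hx' := (rm_lt_rp hM).trans hx
  have h1 : (x : ℂ) - P.rp ≠ 0 := by exact_mod_cast (sub_pos.2 hx).ne'
  have h2 : (x : ℂ) - P.rm ≠ 0 := by exact_mod_cast (sub_pos.2 hx').ne'
  have h3 : HasDerivAt (fun x : ℝ => Complex.exp (-Complex.I * P.ω * x))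
      (Complex.exp (-Complex.I * P.ω * x) * (-Complex.I * P.ω)) x := by
    simpa using ((hasDerivAt_id x).ofReal_comp.const_mul (-Complex.I * P.ω)).cexp
  refine (((ofReal_sub_cpow_hasDerivAt hx' _).mul (ofReal_sub_cpow_hasDerivAt hx _)).mul
    h3).congr_deriv ?_
  simp only [Pi.mul_apply]
  rw [prefactor, prefactorLog, DeltaReal_eq hM]
  push_cast
  field_simp
  ring

theorem prefactorLog_hasDerivAt (x : ℝ) :
    HasDerivAt (fun x : ℝ => P.prefactorLog x) (P.prefactorLog' x) x := by
  have h := (hasDerivAt_id (x : ℂ))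
  have h1 := h.sub_const (P.rp : ℂ)
  have h2 := h.sub_const (P.rm : ℂ)
  have := ((h1.const_mul (-P.s : ℂ)).sub (h2.const_mul (2 * Complex.I * P.M * P.ω))).sub
    ((h2.mul h1).const_mul (Complex.I * P.ω))
  refine HasDerivAt.comp_ofReal (e := P.prefactorLog) (this.congr_deriv ?_)
  simp only [id, prefactorLog']
  ring

/-- Algebraic core of the change of unknown U = N·E·g, freed from analysis: N is the square root of
x² + a², d is Δ, and pl is d times the logarithmic derivative of E. The relation `h1` encodes 2Mx =
N² - d, and `h2` is the equation for g. -/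
theorem rescaled_wave_identity {N d d' x E pl pl' V₀ g g₁ g₂ : ℂ} (hN : N ≠ 0) (hd : d ≠ 0)
    (h1 : x * d' = 2 * x ^ 2 - N ^ 2 + d)
    (h2 : d * g₂ + (2 * pl + d') * g₁ + (pl' + pl ^ 2 / d + V₀) * g = 0) :
    d / N ^ 2 * (E * (pl / d) * ((x * d / N ^ 3 + pl / N) * g + d / N * g₁)
      + E * (((d + x * d') / N ^ 3 - 3 * x ^ 2 * d / N ^ 5 + pl' / N - pl * x / N ^ 3) * g
        + (x * d / N ^ 3 + pl / N) * g₁ + ((d' / N - d * x / N ^ 3) * g₁ + d / N * g₂)))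
      + (d / N ^ 4 * V₀ - d / N ^ 8 * ((N ^ 2 - x ^ 2) * d + (N ^ 2 - d) * (2 * x ^ 2 - N ^ 2)))
        * (N * (E * g)) = 0 := by
  have h3 : d * (d * g₂ + (2 * pl + d') * g₁ + (pl' + V₀) * g) + pl ^ 2 * g = 0 := by
    field_simp at h2
    linear_combination h2
  field_simp
  linear_combination E * N ^ 4 * h3 + E * d * N ^ 2 * g * h1

/-- Passing from the equation for the integral transform to the Schrödinger equation. -/
theorem solvesTransformed_toU (hM : |P.a| < P.M) {g g₁ g₂ : ℝ → ℂ}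
    (hg : ∀ x > P.rp, HasDerivAt g (g₁ x) x) (hg₁ : ∀ x > P.rp, HasDerivAt g₁ (g₂ x) x)
    (hg₂ : ContinuousOn g₂ (Ioi P.rp))
    (hode : ∀ x > P.rp, P.DeltaReal x * g₂ x + P.transformCoeff₁ x * g₁ x
      + P.transformCoeff₀ x * g x = 0) :
    P.SolvesTransformed (P.toU g) := by
  have hU : P.toU g = fun x => ((√(x ^ 2 + P.a ^ 2) : ℝ) : ℂ) * (P.prefactor x * g x) := by
    ext x
    rw [toU, prefactor]
  have hpos : ∀ x > P.rp, 0 < x ^ 2 + P.a ^ 2 := fun x hx => by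
    have := (rp_pos hM).trans hx
    positivity
  have hNne : ∀ x > P.rp, ((√(x ^ 2 + P.a ^ 2) : ℝ) : ℂ) ≠ 0 := fun x hx => by
    exact_mod_cast (Real.sqrt_pos.2 (hpos x hx)).ne'
  have hNsq : ∀ x > P.rp, ((√(x ^ 2 + P.a ^ 2) : ℝ) : ℂ) ^ 2 = x ^ 2 + P.a ^ 2 := fun x hx => by
    exact_mod_cast Real.sq_sqrt (hpos x hx).le
  have hN : ∀ x > P.rp, HasDerivAt (fun x : ℝ => ((√(x ^ 2 + P.a ^ 2) : ℝ) : ℂ))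
      (x / (√(x ^ 2 + P.a ^ 2) : ℝ)) x := fun x hx => by
    have := ((((hasDerivAt_id x).pow 2).add_const (P.a ^ 2)).sqrt (hpos x hx).ne').ofReal_comp
    refine this.congr_deriv ?_
    simp only [id, Pi.pow_apply]
    push_cast
    field_simp
  have hdne : ∀ x > P.rp, (P.DeltaReal x : ℂ) ≠ 0 := fun x hx => by
    rw [DeltaReal_eq hM]
    exact_mod_cast (mul_pos (sub_pos.2 ((rm_lt_rp hM).trans hx)) (sub_pos.2 hx)).ne'
  have hd : ∀ x : ℝ, HasDerivAt (fun x : ℝ => (P.DeltaReal x : ℂ)) (2 * x - 2 * P.M) x :=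
    fun x => by
      have := HasDerivAt.comp_ofReal (Delta_hasDerivAt (P := P) x)
      refine this.congr_of_eventuallyEq (Eventually.of_forall fun y => ?_)
      simp only [DeltaReal, Delta]
      push_cast
      rfl
  have hU1 : ∀ x > P.rp, HasDerivAt (P.toU g)
      (x / (√(x ^ 2 + P.a ^ 2) : ℝ) * (P.prefactor x * g x) + (√(x ^ 2 + P.a ^ 2) : ℝ)
        * (P.prefactor x * (P.prefactorLog x / P.DeltaReal x) * g x + P.prefactor x * g₁ x)) x :=
    fun x hx => by
      rw [hU]
      exact (hN x hx).mul ((prefactor_hasDerivAt hM hx).mul (hg x hx))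
  have hcont : ∀ {f f' : ℝ → ℂ}, (∀ x > P.rp, HasDerivAt f (f' x) x) →
      ContinuousOn f (Ioi P.rp) :=
    fun h x hx => (h x hx).continuousAt.continuousWithinAt
  refine ⟨?_, fun x hx => ?_⟩
  · have hC1 : ∀ {f f' : ℝ → ℂ} {n : ℕ}, (∀ x > P.rp, HasDerivAt f (f' x) x) →
        ContDiffOn ℝ n f' (Ioi P.rp) → ContDiffOn ℝ (n + 1) f (Ioi P.rp) := fun {f f' n} h h' => by
      rw [contDiffOn_succ_iff_deriv_of_isOpen isOpen_Ioi]
      refine ⟨fun x hx => (h x hx).differentiableAt.differentiableWithinAt, by simp, ?_⟩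
      exact h'.congr fun x hx => (h x hx).deriv
    have hg2 : ContDiffOn ℝ 2 g (Ioi P.rp) := by
      have h0 : ContDiffOn ℝ (0 : ℕ) g₂ (Ioi P.rp) := contDiffOn_zero.2 hg₂
      have h1 := hC1 hg₁ h0
      exact_mod_cast hC1 (n := 1) hg (by exact_mod_cast h1)
    rw [hU]
    -- The derivative of the prefactor is the prefactor times a smooth function, so its regularity
    -- climbs from C⁰ to C¹ to C².
    have hE : ContDiffOn ℝ 2 P.prefactor (Ioi P.rp) := by
      have hq : ∀ n : ℕ, ContDiffOn ℝ n (fun x : ℝ => P.prefactorLog x / P.DeltaReal x)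
          (Ioi P.rp) := fun n => by
        simp only [div_eq_mul_inv]
        refine ContDiffOn.mul ?_ (ContDiffOn.inv ?_ hdne)
        · simp only [prefactorLog]
          have : ContDiff ℝ n (fun x : ℝ => (x : ℂ)) := Complex.ofRealCLM.contDiff
          exact ContDiff.contDiffOn (by fun_prop)
        · simp only [DeltaReal]
          have h : ContDiff ℝ n (fun x : ℝ => x ^ 2 - 2 * P.M * x + P.a ^ 2) := by fun_prop
          have h' : ContDiff ℝ n (fun x : ℝ => (x : ℂ)) := Complex.ofRealCLM.contDiff
          exact (h'.comp h).contDiffOn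
      have h0 : ContDiffOn ℝ (0 : ℕ) P.prefactor (Ioi P.rp) :=
        contDiffOn_zero.2 (hcont fun x hx => prefactor_hasDerivAt hM hx)
      have h1 := hC1 (fun x hx => prefactor_hasDerivAt hM hx) (h0.mul (hq 0))
      have h1' : ContDiffOn ℝ (1 : ℕ) P.prefactor (Ioi P.rp) := by exact_mod_cast h1
      exact_mod_cast hC1 (fun x hx => prefactor_hasDerivAt hM hx) (h1'.mul (hq 1))
    refine ContDiffOn.mul ?_ (hE.mul hg2)
    intro x hx
    have : ContDiffAt ℝ 2 (fun x : ℝ => √(x ^ 2 + P.a ^ 2)) x :=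
      ContDiffAt.sqrt (by fun_prop) (hpos x hx).ne'
    exact (Complex.ofRealCLM.contDiff.contDiffAt.comp x this).contDiffWithinAt
  -- The factor Δ/(x² + a²) of the tortoise derivative cancels the 1/Δ coming from the prefactor;
  -- the resulting expression holds on a neighbourhood and can be differentiated once more.
  · have hT : ∀ y > P.rp, P.tortoiseDeriv (P.toU g) y = P.prefactor y
        * ((y * P.DeltaReal y / (√(y ^ 2 + P.a ^ 2) : ℝ) ^ 3
            + P.prefactorLog y / (√(y ^ 2 + P.a ^ 2) : ℝ)) * g y
          + P.DeltaReal y / (√(y ^ 2 + P.a ^ 2) : ℝ) * g₁ y) := fun y hy => by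
      rw [tortoiseDeriv, (hU1 y hy).deriv, Complex.ofReal_div]
      push_cast
      rw [← hNsq y hy]
      have := hNne y hy
      have := hdne y hy
      field_simp
      ring
    have hN0 := hNne x hx
    have hd0 := hdne x hx
    have hder := (prefactor_hasDerivAt hM hx).mul
      ((((((Complex.ofRealCLM.hasDerivAt (x := x)).mul (hd x)).div ((hN x hx).pow 3)
        (pow_ne_zero 3 hN0)).add ((prefactorLog_hasDerivAt (P := P) x).div (hN x hx) hN0)).mul
        (hg x hx)).add (((hd x).div (hN x hx) hN0).mul (hg₁ x hx)))
    have hT' := hder.congr_of_eventuallyEq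
      ((eventually_gt_nhds hx).mono fun y hy => hT y hy)
    rw [tortoiseDeriv, hT'.deriv]
    have h2 := hode x hx
    rw [transformCoeff₁, transformCoeff₀] at h2
    have h1 : (x : ℂ) * (2 * x - 2 * P.M) = 2 * (x : ℂ) ^ 2
        - ((√(x ^ 2 + P.a ^ 2) : ℝ) : ℂ) ^ 2 + P.DeltaReal x := by
      rw [hNsq x hx, DeltaReal]
      push_cast
      ring
    rw [← rescaled_wave_identity (E := P.prefactor x) hN0 hd0 h1 h2]
    have ha : (P.a : ℂ) ^ 2 = ((√(x ^ 2 + P.a ^ 2) : ℝ) : ℂ) ^ 2 - x ^ 2 := by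
      rw [hNsq x hx]
      ring
    have hMx : 2 * (P.M : ℂ) * x = ((√(x ^ 2 + P.a ^ 2) : ℝ) : ℂ) ^ 2 - P.DeltaReal x := by
      rw [hNsq x hx, DeltaReal]
      push_cast
      ring
    have hV : P.Vtilde x = P.DeltaReal x / ((√(x ^ 2 + P.a ^ 2) : ℝ) : ℂ) ^ 4 * P.V0tilde x
        - P.DeltaReal x / ((√(x ^ 2 + P.a ^ 2) : ℝ) : ℂ) ^ 8
          * ((((√(x ^ 2 + P.a ^ 2) : ℝ) : ℂ) ^ 2 - x ^ 2) * P.DeltaReal x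
            + (((√(x ^ 2 + P.a ^ 2) : ℝ) : ℂ) ^ 2 - P.DeltaReal x)
              * (2 * x ^ 2 - ((√(x ^ 2 + P.a ^ 2) : ℝ) : ℂ) ^ 2)) := by
      rw [Vtilde, Vresc, ← hMx]
      push_cast
      rw [← hNsq x hx, ha]
      ring
    rw [hV, hU]
    congr 1
    simp only [Pi.mul_apply, Pi.add_apply, Pi.div_apply, Pi.pow_apply, Complex.ofRealCLM_apply]
    push_cast
    rw [← hNsq x hx]
    field_simp
    ring

end TeukolskyParams

/-! ### Exponential type -/

/-- `f` grows at most like `exp (c t)`, up to subexponential factors. -/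
def ExpType (f : ℝ → ℂ) (c : ℝ) : Prop :=
  ∀ ε > 0, f =O[atTop] fun t : ℝ => Real.exp ((c + ε) * t)

theorem ExpType.mul {f g : ℝ → ℂ} {c d : ℝ} (hf : ExpType f c) (hg : ExpType g d) :
    ExpType (fun t => f t * g t) (c + d) := fun ε hε => by
  refine ((hf (ε / 2) (half_pos hε)).mul (hg (ε / 2) (half_pos hε))).congr_right fun t => ?_
  rw [← Real.exp_add]
  ring_nf

theorem ExpType.add {f g : ℝ → ℂ} {c : ℝ} (hf : ExpType f c) (hg : ExpType g c) :
    ExpType (fun t => f t + g t) c := fun ε hε => (hf ε hε).add (hg ε hε)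

theorem ExpType.sub {f g : ℝ → ℂ} {c : ℝ} (hf : ExpType f c) (hg : ExpType g c) :
    ExpType (fun t => f t - g t) c := fun ε hε => (hf ε hε).sub (hg ε hε)

theorem ExpType.of_le {f : ℝ → ℂ} {c C a : ℝ}
    (h : ∀ᶠ t in atTop, ‖f t‖ ≤ C * Real.exp (c * t + a)) :
    ExpType f c := fun ε hε => by
  refine Asymptotics.IsBigO.of_bound (|C| * Real.exp a) ?_
  filter_upwards [h, eventually_ge_atTop 0] with t ht ht0
  rw [Real.norm_of_nonneg (Real.exp_pos _).le, mul_assoc, ← Real.exp_add]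
  refine ht.trans ?_
  gcongr ?_ * Real.exp ?_
  · exact le_abs_self C
  · nlinarith

theorem ExpType.const (b : ℂ) : ExpType (fun _ => b) 0 :=
  ExpType.of_le (C := ‖b‖) (a := 0) (Eventually.of_forall fun t => by simp)

theorem ExpType.ofReal : ExpType (fun t => (t : ℂ)) 0 := fun ε hε => by
  refine Asymptotics.IsBigO.of_bound ε⁻¹ ?_
  filter_upwards [eventually_ge_atTop 0] with t ht
  rw [Complex.norm_of_nonneg ht, Real.norm_of_nonneg (Real.exp_pos _).le, zero_add,
    inv_mul_eq_div, le_div_iff₀' hε]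
  linarith [Real.add_one_le_exp (ε * t)]

theorem ExpType.line (z : ℂ) : ExpType (fun t => z + t * Complex.I) 0 := by
  simpa using (ExpType.const z).add (by simpa using ExpType.ofReal.mul (ExpType.const Complex.I))

theorem ExpType.pow {f : ℝ → ℂ} (hf : ExpType f 0) (n : ℕ) : ExpType (fun t => f t ^ n) 0 := by
  induction n with
  | zero => simpa using ExpType.const 1
  | succ n ih => simpa [pow_succ] using ih.mul hf

theorem tendsto_norm_line (z : ℂ) : Tendsto (fun t : ℝ => ‖z + t * Complex.I‖) atTop atTop := by
  refine tendsto_atTop_mono (fun t => ?_) (tendsto_atTop_add_const_right _ (-‖z‖) tendsto_id)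
  have h := norm_sub_le (z + t * Complex.I) z
  rw [add_sub_cancel_left, norm_mul, Complex.norm_I, mul_one, Complex.norm_real] at h
  have := le_abs_self t
  rw [id, ← Real.norm_eq_abs] at *
  linarith

theorem norm_line_le (z : ℂ) {t : ℝ} (ht : 0 ≤ t) : ‖z + t * Complex.I‖ ≤ ‖z‖ + t := by
  refine (norm_add_le _ _).trans ?_
  rw [norm_mul, Complex.norm_I, mul_one, Complex.norm_of_nonneg ht]

/-- Along a vertical line the modulus of the argument grows linearly, so a power is at most
polynomial and costs only an arbitrarily small exponential. -/
theorem ExpType.branchPow {c : ℂ} (hc : ‖c‖ = 1) (z β : ℂ) :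
    ExpType (fun t => branchPow c (z + t * Complex.I) β) 0 := fun ε hε => by
  have h1 : (fun t : ℝ => ‖z + t * Complex.I‖ ^ β.re)
      =O[atTop] fun t : ℝ => Real.exp (ε * ‖z + t * Complex.I‖) :=
    (isLittleO_rpow_exp_pos_mul_atTop β.re hε).isBigO.comp_tendsto (tendsto_norm_line z)
  have h2 : (fun t : ℝ => Real.exp (ε * ‖z + t * Complex.I‖))
      =O[atTop] fun t : ℝ => Real.exp ((0 + ε) * t) := by
    refine Asymptotics.IsBigO.of_bound (Real.exp (ε * ‖z‖)) ?_
    filter_upwards [eventually_ge_atTop 0] with t ht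
    rw [Real.norm_of_nonneg (Real.exp_pos _).le, Real.norm_of_nonneg (Real.exp_pos _).le,
      ← Real.exp_add]
    refine Real.exp_le_exp.2 ?_
    nlinarith [norm_line_le z ht]
  refine Asymptotics.IsBigO.trans ?_ (h1.trans h2)
  refine Asymptotics.IsBigO.of_bound (Real.exp (|β.im| * (2 * Real.pi))) ?_
  filter_upwards [(tendsto_norm_line z).eventually_gt_atTop 0] with t ht
  rw [Real.norm_of_nonneg (by positivity), mul_comm (Real.exp _)]
  exact norm_branchPow_le hc (norm_pos_iff.1 ht) β

theorem ExpType.cexp_line (a b z : ℂ) :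
    ExpType (fun t => Complex.exp (a * (z + t * Complex.I) + b)) (-a.im) := by
  refine ExpType.of_le (C := 1) (a := (a * z + b).re) (Eventually.of_forall fun t => ?_)
  rw [Complex.norm_exp, one_mul]
  refine (congrArg Real.exp ?_).le
  simp
  ring

theorem ExpType.exp_norm {φ : ℝ → ℂ} {z a b : ℂ} (hφ : ∀ t : ℝ, φ t = a * (z + t * Complex.I) + b)
    {ε : ℝ} (hε : 0 ≤ ε) : ExpType (fun t => ((Real.exp (ε * ‖φ t‖) : ℝ) : ℂ)) (ε * ‖a‖) := by
  refine ExpType.of_le (C := 1) (a := ε * (‖a‖ * ‖z‖ + ‖b‖)) ?_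
  filter_upwards [eventually_ge_atTop 0] with t ht
  rw [Complex.norm_of_nonneg (Real.exp_pos _).le, one_mul]
  refine Real.exp_le_exp.2 ?_
  have h1 : ‖φ t‖ ≤ ‖a‖ * (‖z‖ + t) + ‖b‖ := by
    rw [hφ]
    refine (norm_add_le _ _).trans ?_
    rw [norm_mul]
    gcongr
    exact norm_line_le z ht
  nlinarith

theorem ExpType.tendsto_zero {f : ℝ → ℂ} {c : ℝ} (hf : ExpType f c) (hc : c < 0) :
    Tendsto f atTop (𝓝 0) := by
  refine (hf (-c / 2) (by linarith)).trans_tendsto ?_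
  refine Real.tendsto_exp_atBot.comp ?_
  exact tendsto_id.const_mul_atTop_of_neg (by linarith)

/-- The function need not be continuous at 0: boundedness near 0 handles the lower end and
exponential decay the upper one. This matters for the ray that starts at the singular point r₊. -/
theorem ExpType.integrableOn_Ioi {f : ℝ → ℂ} {c : ℝ} (hf : ExpType f c) (hc : c < 0)
    (hcont : ContinuousOn f (Ioi 0)) (h0 : f =O[𝓝[>] 0] fun _ => (1 : ℝ)) :
    IntegrableOn f (Ioi 0) := by
  obtain ⟨C, hC⟩ := h0.bound
  obtain ⟨δ, hδ, hδ'⟩ := mem_nhdsGT_iff_exists_Ioo_subset.1 hC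
  have hδ : (0 : ℝ) < δ := hδ
  have h1 : IntegrableOn f (Ioo 0 δ) := by
    refine IntegrableOn.of_bound (C := C) (by simp)
      ((hcont.mono Ioo_subset_Ioi_self).aestronglyMeasurable measurableSet_Ioo) ?_
    filter_upwards [ae_restrict_mem measurableSet_Ioo] with t ht
    simpa using hδ' ht
  have h2 : IntegrableOn f (Ioi (δ / 2)) := by
    have hsub : Ici (δ / 2) ⊆ Ioi 0 := fun t ht => lt_of_lt_of_le (half_pos hδ) ht
    have hmeas := ((hcont.mono hsub).mono Ioi_subset_Ici_self).aestronglyMeasurable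
      (μ := volume) measurableSet_Ioi
    refine (integrable_norm_iff hmeas).1 (integrable_of_isBigO_exp_neg (b := -c / 2) (by linarith)
      (hcont.mono hsub).norm ?_)
    refine (hf (-c / 2) (by linarith)).norm_left.congr_right fun t => ?_
    ring_nf
  refine (h1.union h2).mono_set fun t (ht : 0 < t) => ?_
  rcases lt_or_ge t δ with h | h
  · exact Or.inl ⟨ht, h⟩
  · exact Or.inr (lt_of_lt_of_le (half_lt_self hδ) h)

/-! ### Differentiation under the integral sign -/

/-- One exponential moment dominates the derivative on a whole disc: for |Y - X| < ε/2 both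
|e^{(Y-X)φ}| and a constant times |φ| are controlled by e^{ε|φ|/2}, with product e^{ε|φ|}. It serves
three kinds of parameter: the variable x, the exponent β of a power (with φ = log v or iθ), and the
rate of a Laplace integral. -/
theorem hasDerivAt_integral_cexp_mul {α : Type*} [MeasurableSpace α] {μ : Measure α}
    {φ w : α → ℂ} (hφ : AEStronglyMeasurable φ μ) (hw : AEStronglyMeasurable w μ) {X : ℂ} {ε : ℝ}
    (hε : 0 < ε)
    (hint : Integrable (fun a => Real.exp (ε * ‖φ a‖) * ‖Complex.exp (X * φ a) * w a‖) μ) :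
    HasDerivAt (fun X => ∫ a, Complex.exp (X * φ a) * w a ∂μ)
      (∫ a, φ a * (Complex.exp (X * φ a) * w a) ∂μ) X := by
  have hexp : ∀ X : ℂ, AEStronglyMeasurable (fun a => Complex.exp (X * φ a)) μ := fun X =>
    Complex.continuous_exp.comp_aestronglyMeasurable (hφ.const_mul X)
  refine (hasDerivAt_integral_of_dominated_loc_of_deriv_le
    (F' := fun X a => φ a * (Complex.exp (X * φ a) * w a))
    (bound := fun a => 2 / ε * (Real.exp (ε * ‖φ a‖) * ‖Complex.exp (X * φ a) * w a‖))
    (Metric.ball_mem_nhds X (half_pos hε))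
    (Eventually.of_forall fun X => (hexp X).mul hw) ?_ (hφ.mul ((hexp X).mul hw))
    (Eventually.of_forall fun a Y hY => ?_) (hint.const_mul _)
    (Eventually.of_forall fun a Y _ => ?_)).2
  · refine hint.mono ((hexp X).mul hw) (Eventually.of_forall fun a => ?_)
    rw [Real.norm_of_nonneg (by positivity)]
    exact le_mul_of_one_le_left (norm_nonneg _) (Real.one_le_exp (by positivity))
  · have h1 : Complex.exp (Y * φ a) = Complex.exp ((Y - X) * φ a) * Complex.exp (X * φ a) := by
      rw [← Complex.exp_add]
      ring_nf
    have h2 : ‖Complex.exp ((Y - X) * φ a)‖ ≤ Real.exp (ε / 2 * ‖φ a‖) := by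
      refine (Complex.norm_exp_le_exp_norm _).trans (Real.exp_le_exp.2 ?_)
      rw [norm_mul]
      gcongr
      exact (mem_ball_iff_norm.1 hY).le
    have h3 : ‖φ a‖ ≤ 2 / ε * Real.exp (ε / 2 * ‖φ a‖) := by
      rw [div_mul_eq_mul_div, le_div_iff₀ hε]
      linarith [Real.add_one_le_exp (ε / 2 * ‖φ a‖)]
    have h4 : Real.exp (ε * ‖φ a‖) = Real.exp (ε / 2 * ‖φ a‖) * Real.exp (ε / 2 * ‖φ a‖) := by
      rw [← Real.exp_add]
      ring_nf
    rw [h1, norm_mul, mul_assoc, norm_mul, h4]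
    calc ‖φ a‖ * (‖Complex.exp ((Y - X) * φ a)‖ * ‖Complex.exp (X * φ a) * w a‖)
        ≤ (2 / ε * Real.exp (ε / 2 * ‖φ a‖)) * (Real.exp (ε / 2 * ‖φ a‖)
          * ‖Complex.exp (X * φ a) * w a‖) := by gcongr
      _ = _ := by ring
  · have := (((hasDerivAt_id Y).mul_const (φ a)).cexp).mul_const (w a)
    refine this.congr_deriv ?_
    simp only [id]
    ring

/-! ### Growth of solutions of asymptotically constant equations -/

/-- The energy ω²|u|² + |v|² of the limiting system satisfies E' ≤ 4ω²|u||v| ≤ 2ωE. The convergence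
p → 0 and q → ω² perturbs the rate by an arbitrarily small amount, whatever the speed of
convergence. -/
theorem expType_of_asymptotically_constant {u v p q : ℝ → ℂ} {ω : ℝ} (hω : 0 < ω)
    (hu : ∀ t > 0, HasDerivAt u (Complex.I * v t) t)
    (hv : ∀ t > 0, HasDerivAt v (Complex.I * -(p t * v t + q t * u t)) t)
    (hp : Tendsto p atTop (𝓝 0)) (hq : Tendsto q atTop (𝓝 (ω ^ 2 : ℂ))) :
    ExpType u ω ∧ ExpType v ω := by
  suffices H : ∀ ε > 0, ∃ C : ℝ, ∀ᶠ t in atTop,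
      ω ^ 2 * ‖u t‖ ^ 2 + ‖v t‖ ^ 2 ≤ (C * Real.exp ((ω + ε) * t)) ^ 2 by
    constructor
    · intro ε hε
      obtain ⟨C, hC⟩ := H ε hε
      refine Asymptotics.IsBigO.of_bound (ω⁻¹ * |C|) (hC.mono fun t ht => ?_)
      rw [Real.norm_of_nonneg (Real.exp_pos _).le, mul_assoc, ← div_eq_inv_mul, le_div_iff₀ hω]
      have : (‖u t‖ * ω) ^ 2 ≤ (C * Real.exp ((ω + ε) * t)) ^ 2 := by
        nlinarith [sq_nonneg ‖v t‖]
      have := sq_le_sq.1 this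
      rwa [abs_of_nonneg (by positivity), abs_mul, abs_of_pos (Real.exp_pos _)] at this
    · intro ε hε
      obtain ⟨C, hC⟩ := H ε hε
      refine Asymptotics.IsBigO.of_bound |C| (hC.mono fun t ht => ?_)
      rw [Real.norm_of_nonneg (Real.exp_pos _).le]
      have : ‖v t‖ ^ 2 ≤ (C * Real.exp ((ω + ε) * t)) ^ 2 := by
        nlinarith [sq_nonneg (ω * ‖u t‖)]
      have := sq_le_sq.1 this
      rwa [abs_of_nonneg (by positivity), abs_mul, abs_of_pos (Real.exp_pos _)] at this
  intro ε hε
  -- Errors of size δ in p and q add at most 2δ(1 + 1/(2ω))E to E', which is to stay below 2εE.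
  obtain ⟨δ, hδ, hδε⟩ : ∃ δ > 0, δ * (1 + 1 / (2 * ω)) ≤ ε := by
    refine ⟨ε / (1 + 1 / (2 * ω)), by positivity, ?_⟩
    rw [div_mul_cancel₀]
    positivity
  have hp' : ∀ᶠ t in atTop, ‖p t‖ < δ := by
    simpa using hp.norm.eventually (gt_mem_nhds (by simpa using hδ))
  have hq' : ∀ᶠ t in atTop, ‖q t - ω ^ 2‖ < δ := by
    have := (hq.sub_const (ω ^ 2 : ℂ)).norm
    rw [sub_self, norm_zero] at this
    exact this.eventually (gt_mem_nhds hδ)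
  obtain ⟨T, hT⟩ := eventually_atTop.1 (hp'.and (hq'.and (eventually_gt_atTop 0)))
  set E : ℝ → ℝ := fun t => ω ^ 2 * ‖u t‖ ^ 2 + ‖v t‖ ^ 2 with hE
  set E' : ℝ → ℝ := fun t => ω ^ 2 * (2 * inner ℝ (u t) (Complex.I * v t))
    + 2 * inner ℝ (v t) (Complex.I * -(p t * v t + q t * u t))
  have hEd : ∀ t > 0, HasDerivAt E (E' t) t := fun t ht =>
    ((hu t ht).norm_sq.const_mul _).add (hv t ht).norm_sq
  have hE'le : ∀ t ≥ T, E' t ≤ 2 * (ω + ε) * E t := fun t ht => by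
    obtain ⟨h1, h2, h3⟩ := hT t ht
    have e1 : inner ℝ (u t) (Complex.I * v t) ≤ ‖u t‖ * ‖v t‖ := by
      refine (real_inner_le_norm _ _).trans ?_
      simp
    have e2 : inner ℝ (v t) (Complex.I * -(p t * v t + q t * u t))
        ≤ ‖v t‖ * (δ * ‖v t‖ + (ω ^ 2 + δ) * ‖u t‖) := by
      refine (real_inner_le_norm _ _).trans ?_
      rw [norm_mul, Complex.norm_I, one_mul, norm_neg]
      gcongr
      refine (norm_add_le _ _).trans ?_
      rw [norm_mul, norm_mul]
      have : ‖q t‖ ≤ ω ^ 2 + δ := by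
        have := norm_sub_norm_le (q t) (ω ^ 2 : ℂ)
        have h4 : ‖(ω ^ 2 : ℂ)‖ = ω ^ 2 := by simp
        linarith
      gcongr
    have e3 : 2 * ω * (‖u t‖ * ‖v t‖) ≤ E t := by
      simp only [hE]
      nlinarith [sq_nonneg (ω * ‖u t‖ - ‖v t‖)]
    have e4 : ‖v t‖ ^ 2 ≤ E t := by
      simp only [hE]
      nlinarith [sq_nonneg (ω * ‖u t‖)]
    have e5 : ‖u t‖ * ‖v t‖ ≤ 1 / (2 * ω) * E t := by
      rw [one_div_mul_eq_div, le_div_iff₀ (by positivity)]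
      linarith
    have e6 : 0 ≤ E t := by positivity
    have e7 : E' t ≤ 2 * ω * (2 * ω * (‖u t‖ * ‖v t‖))
        + 2 * δ * (‖v t‖ ^ 2 + ‖u t‖ * ‖v t‖) := by
      have := mul_le_mul_of_nonneg_left e1 (sq_nonneg ω)
      simp only [E']
      linarith
    have e8 : ‖v t‖ ^ 2 + ‖u t‖ * ‖v t‖ ≤ (1 + 1 / (2 * ω)) * E t := by linarith
    have e9 := mul_le_mul_of_nonneg_left e8 hδ.le
    have e10 := mul_le_mul_of_nonneg_right hδε e6
    have e11 := mul_le_mul_of_nonneg_left e3 (by positivity : 0 ≤ 2 * ω)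
    linarith
  have hT0 : 0 < T := (hT T le_rfl).2.2
  have hF : ∀ t ≥ T, HasDerivAt (fun t => E t * Real.exp (-(2 * (ω + ε)) * t))
      (E' t * Real.exp (-(2 * (ω + ε)) * t) + E t * (Real.exp (-(2 * (ω + ε)) * t)
        * (-(2 * (ω + ε))))) t := fun t ht => by
    refine (hEd t (hT0.trans_le ht)).mul ?_
    simpa using ((hasDerivAt_id t).const_mul (-(2 * (ω + ε)))).exp
  -- Grönwall's inequality in monotone form: the energy divided by e^{2(ω+ε)t} does not increase
  -- beyond T.
  have hanti : AntitoneOn (fun t => E t * Real.exp (-(2 * (ω + ε)) * t)) (Ici T) := by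
    refine antitoneOn_of_deriv_nonpos (convex_Ici T)
      (fun t ht => (hF t ht).continuousAt.continuousWithinAt)
      (fun t ht => (hF t (interior_subset ht)).differentiableAt.differentiableWithinAt)
      fun t ht => ?_
    rw [(hF t (interior_subset ht)).deriv]
    have := hE'le t (interior_subset ht)
    have := mul_le_mul_of_nonneg_right this (Real.exp_pos (-(2 * (ω + ε)) * t)).le
    linarith
  refine ⟨√(E T * Real.exp (-(2 * (ω + ε)) * T)), ?_⟩
  filter_upwards [eventually_ge_atTop T] with t ht
  have h1 := hanti self_mem_Ici ht ht
  rw [mul_pow, Real.sq_sqrt (by positivity), ← Real.exp_nat_mul]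
  calc E t = E t * Real.exp (-(2 * (ω + ε)) * t) * Real.exp ((2 : ℕ) * ((ω + ε) * t)) := by
        rw [mul_assoc, ← Real.exp_add]
        have : -(2 * (ω + ε)) * t + (2 : ℕ) * ((ω + ε) * t) = 0 := by
          push_cast
          ring
        rw [this, Real.exp_zero, mul_one]
    _ ≤ _ := by gcongr

theorem ExpType.mul_left {f g : ℝ → ℂ} {c : ℝ} (hf : ExpType f 0) (hg : ExpType g c) :
    ExpType (fun t => f t * g t) c := by simpa using hf.mul hg

theorem tendsto_cobounded_line (z : ℂ) :
    Tendsto (fun t : ℝ => z + t * Complex.I) atTop (Bornology.cobounded ℂ) :=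
  tendsto_norm_atTop_iff_cobounded.1 (tendsto_norm_line z)

theorem line_hasDerivAt (z : ℂ) (t : ℝ) :
    HasDerivAt (fun t : ℝ => z + t * Complex.I) Complex.I t := by
  simpa using ((hasDerivAt_id t).ofReal_comp.mul_const Complex.I).const_add z

theorem HasDerivAt.comp_line {f : ℂ → ℂ} {f' z : ℂ} {t : ℝ}
    (hf : HasDerivAt f f' (z + t * Complex.I)) :
    HasDerivAt (fun t : ℝ => f (z + t * Complex.I)) (Complex.I * f') t := by
  rw [mul_comm]
  exact hf.comp_of_eq t (line_hasDerivAt z t) rfl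

/-! ### Growth along vertical lines and derivatives of the transform -/

namespace TeukolskyParams

variable {P : TeukolskyParams}

/-- As |r| → ∞ the equation tends to R'' + ω²R = 0, because ℓ/Δ → -iω. On a vertical line both
limiting solutions e^{±iωr} are bounded by a multiple of e^{ωt}, which is why no condition at
infinity enters. -/
theorem IsRadialSolution.expType_line (hM : |P.a| < P.M) (hω : 0 < P.ω) {c : ℂ} {R : ℂ → ℂ}
    (hR : P.IsRadialSolution c R) {z : ℂ}
    (hz : ∀ t : ℝ, 0 < t → z + t * Complex.I ∈ P.cutDomain c) :
    ExpType (fun t => R (z + t * Complex.I)) P.ω ∧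
    ExpType (fun t => deriv R (z + t * Complex.I)) P.ω := by
  set p : ℂ → ℂ := fun r => (2 * r - 2 * P.M) / P.Delta r with hp
  set q : ℂ → ℂ := fun r =>
    (-(P.weightLog r) ^ 2 / P.Delta r + 4 * P.s * Complex.I * r * P.ω - P.Λ) / P.Delta r with hq
  have hinv := tendsto_inv₀_cobounded (α := ℂ)
  have hne : ∀ᶠ r : ℂ in Bornology.cobounded ℂ, r ≠ 0 := by
    filter_upwards [Metric.cobounded_le_cocompact
      (isCompact_singleton (x := (0 : ℂ))).compl_mem_cocompact] with r hr
    exact hr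
  -- All limits are taken in the variable 1/r, after division of numerator and denominator by the
  -- leading power r².
  have hD : Tendsto (fun r : ℂ => 1 - 2 * P.M * r⁻¹ + P.a ^ 2 * r⁻¹ ^ 2)
      (Bornology.cobounded ℂ) (𝓝 1) := by
    simpa using ((hinv.const_mul (2 * (P.M : ℂ))).const_sub 1).add
      ((hinv.pow 2).const_mul ((P.a : ℂ) ^ 2))
  have hD0 := hD.eventually_ne one_ne_zero
  have hDelta : ∀ᶠ r : ℂ in Bornology.cobounded ℂ,
      P.Delta r = r ^ 2 * (1 - 2 * P.M * r⁻¹ + P.a ^ 2 * r⁻¹ ^ 2) := by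
    filter_upwards [hne] with r hr
    rw [Delta]
    field_simp
  have hp0 : Tendsto p (Bornology.cobounded ℂ) (𝓝 0) := by
    have : Tendsto (fun r : ℂ => r⁻¹ * (2 - 2 * P.M * r⁻¹)
        / (1 - 2 * P.M * r⁻¹ + P.a ^ 2 * r⁻¹ ^ 2)) (Bornology.cobounded ℂ) (𝓝 0) := by
      simpa [Pi.div_def] using
        (hinv.mul ((hinv.const_mul (2 * (P.M : ℂ))).const_sub 2)).div hD one_ne_zero
    refine this.congr' ?_
    filter_upwards [hne, hDelta, hD0] with r hr h1 h2
    simp only [hp]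
    rw [h1]
    field_simp
  have hl : Tendsto (fun r => P.weightLog r / P.Delta r) (Bornology.cobounded ℂ)
      (𝓝 (-Complex.I * P.ω)) := by
    have : Tendsto (fun r : ℂ => (-Complex.I * ((1 + P.a ^ 2 * r⁻¹ ^ 2) * P.ω
        - P.a * P.m * r⁻¹ ^ 2) - (r⁻¹ - P.M * r⁻¹ ^ 2) * P.s)
        / (1 - 2 * P.M * r⁻¹ + P.a ^ 2 * r⁻¹ ^ 2)) (Bornology.cobounded ℂ)
        (𝓝 (-Complex.I * P.ω)) := by
      have h2 := hinv.pow 2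
      simpa [Pi.div_def] using ((((((h2.const_mul ((P.a : ℂ) ^ 2)).const_add 1).mul_const (P.ω : ℂ)).sub
        (h2.const_mul ((P.a : ℂ) * P.m))).const_mul (-Complex.I)).sub
          ((hinv.sub (h2.const_mul (P.M : ℂ))).mul_const (P.s : ℂ))).div hD one_ne_zero
    refine this.congr' ?_
    filter_upwards [hne, hDelta, hD0] with r hr h1 h2
    rw [h1, weightLog, K]
    field_simp
  have hq0 : Tendsto q (Bornology.cobounded ℂ) (𝓝 ((P.ω : ℂ) ^ 2)) := by
    have h3 : Tendsto (fun r : ℂ => (4 * P.s * Complex.I * r * P.ω - P.Λ) / P.Delta r)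
        (Bornology.cobounded ℂ) (𝓝 0) := by
      have : Tendsto (fun r : ℂ => (4 * P.s * Complex.I * P.ω * r⁻¹ - P.Λ * r⁻¹ ^ 2)
          / (1 - 2 * P.M * r⁻¹ + P.a ^ 2 * r⁻¹ ^ 2)) (Bornology.cobounded ℂ) (𝓝 0) := by
        simpa [Pi.div_def] using ((hinv.const_mul (4 * P.s * Complex.I * P.ω)).sub
          ((hinv.pow 2).const_mul (P.Λ : ℂ))).div hD one_ne_zero
      refine this.congr' ?_
      filter_upwards [hne, hDelta, hD0] with r hr h1 h2
      rw [h1]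
      field_simp
    have h4 := ((hl.pow 2).neg).add h3
    have h5 : -(-Complex.I * (P.ω : ℂ)) ^ 2 + 0 = (P.ω : ℂ) ^ 2 := by
      rw [mul_pow, neg_sq, Complex.I_sq]
      ring
    rw [h5] at h4
    refine h4.congr fun r => ?_
    simp only [hq]
    ring
  refine expType_of_asymptotically_constant hω (p := fun t => p (z + t * Complex.I))
    (q := fun t => q (z + t * Complex.I)) (fun t ht => ?_) (fun t ht => ?_)
    (hp0.comp (tendsto_cobounded_line z)) (hq0.comp (tendsto_cobounded_line z))
  · exact (hR.deriv_deriv hM (hz t ht)).1.comp_line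
  · refine (hR.deriv_deriv hM (hz t ht)).2.comp_line.congr_deriv ?_
    simp only [hp, hq]
    ring

/-- Only e^{-iωr} contributes to the rate; the two complex powers are subexponential. -/
theorem expType_weight {c : ℂ} (hc : ‖c‖ = 1) (z : ℂ)
    (hz : ∀ t : ℝ, 0 < t → z + t * Complex.I ∈ P.cutDomain c) :
    ExpType (fun t => P.weight c (z + t * Complex.I)) P.ω := by
  have h1 := ExpType.branchPow (c := 1) (by simp) (z - P.rm) (P.eta - P.s / 2)
  have h2 := ExpType.branchPow hc (z - P.rp) (P.xi - P.s / 2)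
  have h3 := ExpType.cexp_line (-Complex.I * P.ω) 0 z
  have h := (h1.mul_left h2).mul_left h3
  have him : -(-Complex.I * (P.ω : ℂ)).im = P.ω := by simp
  rw [him] at h
  refine fun ε hε => (h ε hε).congr' ?_ EventuallyEq.rfl
  filter_upwards [eventually_gt_atTop 0] with t ht
  rw [weight]
  have e1 : z + t * Complex.I - P.rm = z - P.rm + t * Complex.I := by ring
  have e2 : z + t * Complex.I - P.rp = z - P.rp + t * Complex.I := by ring
  have hne := sub_rm_ne (hz t ht)
  rw [e1] at hne
  rw [e1, e2, add_zero, Complex.cpow_def_of_ne_zero hne, branchPow, branchLog, one_mul,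
    Complex.log_one, sub_zero, mul_comm (Complex.log _)]

theorem expType_Delta (z : ℂ) : ExpType (fun t => P.Delta (z + t * Complex.I)) 0 := by
  have hl := ExpType.line z
  exact ((hl.pow 2).sub ((ExpType.const (2 * (P.M : ℂ))).mul_left hl)).add (ExpType.const _)

theorem expType_weightLog (z : ℂ) : ExpType (fun t => P.weightLog (z + t * Complex.I)) 0 := by
  have hl := ExpType.line z
  exact ((ExpType.const (-Complex.I)).mul_left ((((hl.pow 2).add (ExpType.const _)).mul_left
    (ExpType.const _)).sub (ExpType.const _))).sub ((hl.sub (ExpType.const _)).mul_left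
      (ExpType.const _))

/-- The exponential decay rate of the kernel. -/
def rate (P : TeukolskyParams) (x : ℝ) : ℝ := 2 * P.ω * (x - P.rm) / (P.rp - P.rm)

theorem freq_eq (x : ℝ) : P.freq x = Complex.I * P.rate x := by
  rw [freq, rate]
  push_cast
  ring

/-- At x = r₊ the decay rate of the kernel would be exactly 2ω, the combined growth rate of weight
and solution. This is the source of the restriction x > r₊. -/
theorem two_ω_lt_rate (hM : |P.a| < P.M) (hω : 0 < P.ω) {x : ℝ} (hx : P.rp < x) :
    2 * P.ω < P.rate x := by
  rw [rate, lt_div_iff₀ (rp_sub_rm_pos hM)]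
  gcongr

theorem expType_kernel (x : ℝ) (z : ℂ) :
    ExpType (fun t => Complex.exp (P.freq x * (z + t * Complex.I - P.rm))) (-P.rate x) := by
  have h := ExpType.cexp_line (P.freq x) (-(P.freq x * P.rm)) z
  have : (P.freq x).im = P.rate x := by simp [freq_eq]
  rw [this] at h
  refine fun ε hε => (h ε hε).congr_left fun t => ?_
  ring_nf

/-- Each x-derivative inserts a factor φ. Keeping the power φ^j in the weight makes the statement
iterable for second derivatives and for continuity of the last one. -/
theorem hasDerivAt_moment {α : Type*} [MeasurableSpace α] {μ : Measure α} {φ w : α → ℂ}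
    (hφ : AEStronglyMeasurable φ μ) (hw : AEStronglyMeasurable w μ)
    (hint : ∀ x > P.rp, ∀ j : ℕ, ∃ ε > 0, Integrable (fun a => Real.exp (ε * ‖φ a‖)
      * ‖Complex.exp ((x - P.rm) * φ a) * (φ a ^ j * w a)‖) μ) (j : ℕ) {x : ℝ} (hx : P.rp < x) :
    HasDerivAt (fun x : ℝ => ∫ a, Complex.exp ((x - P.rm) * φ a) * (φ a ^ j * w a) ∂μ)
      (∫ a, Complex.exp ((x - P.rm) * φ a) * (φ a ^ (j + 1) * w a) ∂μ) x := by
  obtain ⟨ε, hε, h⟩ := hint x hx j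
  have := (hasDerivAt_integral_cexp_mul hφ ((hφ.pow j).mul hw) hε h).comp_sub_const _ (P.rm : ℂ)
  refine (HasDerivAt.comp_ofReal this).congr_deriv (integral_congr_ae (Eventually.of_forall
    fun a => ?_))
  simp only [Pi.mul_apply, Pi.pow_apply]
  ring

/-- A family of integrals with the kernel of the integral transform, together with the defect in
the differential equation. -/
theorem exists_derivatives_of_moment {α : Type*} [MeasurableSpace α] {μ : Measure α} {φ w : α → ℂ}
    (hφ : AEStronglyMeasurable φ μ) (hw : AEStronglyMeasurable w μ)
    (hint : ∀ x > P.rp, ∀ j : ℕ, ∃ ε > 0, Integrable (fun a => Real.exp (ε * ‖φ a‖)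
      * ‖Complex.exp ((x - P.rm) * φ a) * (φ a ^ j * w a)‖) μ) :
    ∃ g₁ g₂ : ℝ → ℂ,
      (∀ x > P.rp, HasDerivAt (fun x : ℝ => ∫ a, Complex.exp ((x - P.rm) * φ a) * w a ∂μ) (g₁ x) x)
      ∧ (∀ x > P.rp, HasDerivAt g₁ (g₂ x) x) ∧ ContinuousOn g₂ (Ioi P.rp) ∧
      ∀ x > P.rp, P.DeltaReal x * g₂ x + P.transformCoeff₁ x * g₁ x
        + P.transformCoeff₀ x * (∫ a, Complex.exp ((x - P.rm) * φ a) * w a ∂μ) =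
        ∫ a, (P.DeltaReal x * φ a ^ 2 + P.transformCoeff₁ x * φ a + P.transformCoeff₀ x)
          * (Complex.exp ((x - P.rm) * φ a) * w a) ∂μ := by
  have hI : ∀ x > P.rp, ∀ j : ℕ,
      Integrable (fun a => Complex.exp ((x - P.rm) * φ a) * (φ a ^ j * w a)) μ := fun x hx j => by
    obtain ⟨ε, hε, h⟩ := hint x hx j
    refine h.mono ((Complex.continuous_exp.comp_aestronglyMeasurable (hφ.const_mul _)).mul
      ((hφ.pow j).mul hw)) (Eventually.of_forall fun a => ?_)
    rw [Real.norm_of_nonneg (by positivity)]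
    exact le_mul_of_one_le_left (norm_nonneg _) (Real.one_le_exp (by positivity))
  refine ⟨_, _, fun x hx => ?_, fun x hx => hasDerivAt_moment hφ hw hint 1 hx, fun x hx =>
    (hasDerivAt_moment hφ hw hint 2 hx).continuousAt.continuousWithinAt, fun x hx => ?_⟩
  · simpa using hasDerivAt_moment hφ hw hint 0 hx
  · have h0 := hI x hx 0
    have h1 := hI x hx 1
    have h2 := hI x hx 2
    simp only [pow_zero, one_mul] at h0
    have h12 : Integrable (fun a => P.DeltaReal x * (Complex.exp ((x - P.rm) * φ a)
        * (φ a ^ 2 * w a)) + P.transformCoeff₁ x * (Complex.exp ((x - P.rm) * φ a)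
        * (φ a ^ 1 * w a))) μ := (h2.const_mul _).add (h1.const_mul _)
    rw [← integral_const_mul, ← integral_const_mul, ← integral_const_mul,
      ← integral_add (h2.const_mul _) (h1.const_mul _),
      ← integral_add h12 (h0.const_mul _)]
    refine integral_congr_ae (Eventually.of_forall fun a => ?_)
    ring

end TeukolskyParams

/-! ### Contributions of the pieces of a contour -/

namespace TeukolskyParams

variable {P : TeukolskyParams}

/-- A function `g` with two derivatives on `(r₊, ∞)` that satisfies the equation of the integral
transform up to the defect `D`. -/
def SolvesUpTo (P : TeukolskyParams) (g D : ℝ → ℂ) : Prop :=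
  ∃ g₁ g₂ : ℝ → ℂ, (∀ x > P.rp, HasDerivAt g (g₁ x) x) ∧ (∀ x > P.rp, HasDerivAt g₁ (g₂ x) x) ∧
    ContinuousOn g₂ (Ioi P.rp) ∧
    ∀ x > P.rp, P.DeltaReal x * g₂ x + P.transformCoeff₁ x * g₁ x + P.transformCoeff₀ x * g x = D x

theorem SolvesUpTo.add {g h D E : ℝ → ℂ} (hg : P.SolvesUpTo g D) (hh : P.SolvesUpTo h E) :
    P.SolvesUpTo (fun x => g x + h x) (fun x => D x + E x) := by
  obtain ⟨g₁, g₂, a1, a2, a3, a4⟩ := hg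
  obtain ⟨h₁, h₂, b1, b2, b3, b4⟩ := hh
  refine ⟨fun x => g₁ x + h₁ x, fun x => g₂ x + h₂ x, fun x hx => (a1 x hx).add (b1 x hx),
    fun x hx => (a2 x hx).add (b2 x hx), a3.add b3, fun x hx => ?_⟩
  simp only [← a4 x hx, ← b4 x hx]
  ring

theorem SolvesUpTo.neg {g D : ℝ → ℂ} (hg : P.SolvesUpTo g D) :
    P.SolvesUpTo (fun x => -g x) (fun x => -D x) := by
  obtain ⟨g₁, g₂, a1, a2, a3, a4⟩ := hg
  refine ⟨fun x => -g₁ x, fun x => -g₂ x, fun x hx => (a1 x hx).neg, fun x hx => (a2 x hx).neg,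
    a3.neg, fun x hx => ?_⟩
  simp only [← a4 x hx]
  ring

theorem SolvesUpTo.solvesTransformed (hM : |P.a| < P.M) {g D : ℝ → ℂ} (hg : P.SolvesUpTo g D)
    (hD : ∀ x > P.rp, D x = 0) : P.SolvesTransformed (P.toU g) := by
  obtain ⟨g₁, g₂, a1, a2, a3, a4⟩ := hg
  exact solvesTransformed_toU hM a1 a2 a3 fun x hx => (a4 x hx).trans (hD x hx)

theorem continuous_kernelLog : Continuous P.kernelLog := by
  unfold kernelLog
  fun_prop

theorem IsRadialSolution.continuousOn_weight_mul (hM : |P.a| < P.M) {c : ℂ} {R : ℂ → ℂ}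
    (hR : P.IsRadialSolution c R) :
    ContinuousOn (fun r => P.weight c r * R r) (P.cutDomain c) := fun _ hr =>
  ((weight_hasDerivAt hM hr).continuousAt.mul
    (hR.deriv_deriv hM hr).1.continuousAt).continuousWithinAt

/-- The contribution of a vertical ray to the integral transform. -/
theorem IsRadialSolution.vertical_transform (hM : |P.a| < P.M) (hω : 0 < P.ω) {c : ℂ}
    (hc : ‖c‖ = 1) {R : ℂ → ℂ} (hR : P.IsRadialSolution c R) {z : ℂ}
    (hz : ∀ t : ℝ, 0 < t → z + t * Complex.I ∈ P.cutDomain c)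
    (h0 : (fun t : ℝ => P.weight c (z + t * Complex.I) * R (z + t * Complex.I))
      =O[𝓝[>] 0] fun _ => (1 : ℝ)) {D : ℝ → ℂ}
    (hD : ∀ x > P.rp, Tendsto (fun t : ℝ => P.concomitant c R x (z + t * Complex.I)) (𝓝[>] 0)
      (𝓝 (D x))) :
    (∀ x > P.rp, VerticalIntegrable (P.transformIntegrand c R x) z) ∧
    P.SolvesUpTo (fun x => verticalIntegral (P.transformIntegrand c R x) z) D := by
  set φ : ℝ → ℂ := fun t => P.kernelLog (z + t * Complex.I) with hφ
  set W : ℝ → ℂ := fun t => P.weight c (z + t * Complex.I) * R (z + t * Complex.I) with hW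
  have hline : Continuous fun t : ℝ => z + t * Complex.I := by fun_prop
  have hφc : Continuous φ := continuous_kernelLog.comp hline
  have hWc : ContinuousOn W (Ioi 0) :=
    (hR.continuousOn_weight_mul hM).comp hline.continuousOn fun t ht => hz t ht
  have hφl : ∀ t : ℝ, φ t = 2 * Complex.I * P.ω / (P.rp - P.rm) * (z + t * Complex.I)
      + -(2 * Complex.I * P.ω / (P.rp - P.rm) * P.rm) := fun t => by
    simp only [hφ, kernelLog]
    ring
  have hk : ∀ (x : ℝ) (t : ℝ), Complex.exp ((x - P.rm) * φ t)
      = Complex.exp (P.freq x * (z + t * Complex.I - P.rm)) := fun x t => by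
    rw [freq_mul]
  obtain ⟨hR1, hR2⟩ := hR.expType_line hM hω hz
  have hwt := expType_weight hc z hz
  have hWt : ExpType W (P.ω + P.ω) := hwt.mul hR1
  have hφt : ExpType φ 0 := by
    have := ((ExpType.const (2 * Complex.I * P.ω / (P.rp - P.rm))).mul_left (ExpType.line z)).add
      (ExpType.const (-(2 * Complex.I * P.ω / (P.rp - P.rm) * P.rm)))
    exact fun ε hε => (this ε hε).congr_left fun t => (hφl t).symm
  have hint : ∀ x > P.rp, ∀ j : ℕ, ∃ ε > 0, IntegrableOn (fun t => Real.exp (ε * ‖φ t‖)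
      * ‖Complex.exp ((x - P.rm) * φ t) * (φ t ^ j * (Complex.I * W t))‖) (Ioi 0) := by
    intro x hx j
    have hrate := two_ω_lt_rate hM hω hx
    set A := ‖2 * Complex.I * (P.ω : ℂ) / (P.rp - P.rm)‖
    have hA : 0 ≤ A := norm_nonneg _
    -- The moment factor e^{ε|φ|} grows at rate εA, which has to fit into the gap between the decay
    -- rate of the kernel and 2ω. The denominator A + 1 avoids a separate case A = 0.
    obtain ⟨ε, hε, hεA⟩ : ∃ ε > 0, ε * A < P.rate x - 2 * P.ω := by
      refine ⟨(P.rate x - 2 * P.ω) / (A + 1), div_pos (by linarith) (by linarith), ?_⟩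
      rw [div_mul_eq_mul_div, div_lt_iff₀ (by linarith)]
      nlinarith
    refine ⟨ε, hε, ?_⟩
    have h1 := (ExpType.exp_norm hφl hε.le).mul
      ((expType_kernel (P := P) x z).mul ((hφt.pow j).mul ((ExpType.const Complex.I).mul_left hWt)))
    have hcont : ContinuousOn (fun t : ℝ => ((Real.exp (ε * ‖φ t‖) : ℝ) : ℂ) *
        (Complex.exp (P.freq x * (z + t * Complex.I - P.rm)) * (φ t ^ j * (Complex.I * W t))))
        (Ioi 0) := by
      fun_prop
    have hb : (fun t : ℝ => ((Real.exp (ε * ‖φ t‖) : ℝ) : ℂ) *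
        (Complex.exp (P.freq x * (z + t * Complex.I - P.rm)) * (φ t ^ j * (Complex.I * W t))))
        =O[𝓝[>] 0] fun _ => (1 : ℝ) := by
      have hF : Continuous fun t : ℝ => ((Real.exp (ε * ‖φ t‖) : ℝ) : ℂ) *
        Complex.exp (P.freq x * (z + t * Complex.I - P.rm)) * φ t ^ j * Complex.I := by fun_prop
      have := ((hF.tendsto 0).mono_left nhdsWithin_le_nhds).isBigO_one ℝ |>.mul h0
      refine (this.congr_left fun t => ?_).congr_right fun t => by simp
      ring
    have h2 := (h1.integrableOn_Ioi (by linarith) hcont hb).norm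
    refine h2.congr (Eventually.of_forall fun t => ?_)
    simp only [norm_mul, Complex.norm_real, Real.norm_of_nonneg (Real.exp_pos _).le, hk]
  have hti : ∀ x t : ℝ, Complex.I * P.transformIntegrand c R x (z + t * Complex.I)
      = Complex.exp ((x - P.rm) * φ t) * (Complex.I * W t) := fun x t => by
    rw [transformIntegrand_eq, hk]
    ring
  have hwmeas : AEStronglyMeasurable (fun t => Complex.I * W t) (volume.restrict (Ioi 0)) :=
    (hWc.aestronglyMeasurable measurableSet_Ioi).const_mul _
  have hkc : ∀ x : ℝ, ContinuousOn (fun t => Complex.exp ((x - P.rm) * φ t) * (Complex.I * W t))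
      (Ioi 0) := fun x => by fun_prop
  have hII : ∀ x > P.rp, IntegrableOn (fun t => Complex.exp ((x - P.rm) * φ t) * (Complex.I * W t))
      (Ioi 0) := fun x hx => by
    obtain ⟨ε, hε, h⟩ := hint x hx 0
    refine Integrable.mono h ((hkc x).aestronglyMeasurable measurableSet_Ioi)
      (Eventually.of_forall fun t => ?_)
    rw [Real.norm_of_nonneg (by positivity), pow_zero, one_mul]
    exact le_mul_of_one_le_left (norm_nonneg _) (Real.one_le_exp (by positivity))
  refine ⟨fun x hx => ?_, ?_⟩
  · have := (hII x hx).const_mul (-Complex.I)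
    refine this.congr (Eventually.of_forall fun t => ?_)
    simp only [← hti]
    rw [← mul_assoc, neg_mul, Complex.I_mul_I, neg_neg, one_mul]
  · obtain ⟨g₁, g₂, a1, a2, a3, a4⟩ :=
      exists_derivatives_of_moment hφc.aestronglyMeasurable hwmeas hint
    have hv : ∀ x : ℝ, verticalIntegral (P.transformIntegrand c R x) z
        = ∫ t in Ioi (0 : ℝ), Complex.exp ((x - P.rm) * φ t) * (Complex.I * W t) := fun x => by
      rw [verticalIntegral]
      simp only [hti]
    refine ⟨g₁, g₂, ?_, a2, a3, fun x hx => ?_⟩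
    · simpa only [hv] using a1
    · simp only [hv]
      rw [a4 x hx]
      have hlim : Tendsto (fun t : ℝ => P.concomitant c R x (z + t * Complex.I)) atTop (𝓝 0) := by
        have hΔ := expType_Delta (P := P) z
        have h1 := (expType_kernel (P := P) x z).mul (hwt.mul ((hΔ.mul_left hR2).sub
          (((expType_weightLog (P := P) z).add (hΔ.mul_left (ExpType.const (P.freq x)))).mul_left
            hR1)))
        exact h1.tendsto_zero (by linarith [two_ω_lt_rate hM hω hx])
      -- The concomitant may be singular at the starting point. Redefining it there by its limit
      -- D(x) makes it right-continuous at 0, as the fundamental theorem on the half-line requires.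
      have hder : ∀ t ∈ Ioi (0 : ℝ), HasDerivAt
          (Function.update (fun t : ℝ => P.concomitant c R x (z + t * Complex.I)) 0 (D x))
          (-((P.DeltaReal x * φ t ^ 2 + P.transformCoeff₁ x * φ t + P.transformCoeff₀ x)
            * (Complex.exp ((x - P.rm) * φ t) * (Complex.I * W t)))) t := fun t ht => by
        refine ((concomitant_hasDerivAt hM hR x (hz t ht)).comp_line.congr_deriv
          ?_).congr_of_eventuallyEq ?_
        · rw [symbol_eq hM hx, ← hti]
          ring
        · filter_upwards [isOpen_Ioi.mem_nhds ht] with y hy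
          exact Function.update_of_ne (ne_of_gt hy) _ _
      have hint2 : IntegrableOn (fun t => -((P.DeltaReal x * φ t ^ 2 + P.transformCoeff₁ x * φ t
          + P.transformCoeff₀ x) * (Complex.exp ((x - P.rm) * φ t) * (Complex.I * W t))))
          (Ioi 0) := by
        have hj : ∀ j : ℕ, IntegrableOn (fun t => Complex.exp ((x - P.rm) * φ t)
            * (φ t ^ j * (Complex.I * W t))) (Ioi 0) := fun j => by
          obtain ⟨ε, hε, h⟩ := hint x hx j
          have hcj : ContinuousOn (fun t => Complex.exp ((x - P.rm) * φ t)
            * (φ t ^ j * (Complex.I * W t))) (Ioi 0) := by fun_prop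
          refine Integrable.mono h (hcj.aestronglyMeasurable measurableSet_Ioi)
            (Eventually.of_forall fun t => ?_)
          rw [Real.norm_of_nonneg (by positivity)]
          exact le_mul_of_one_le_left (norm_nonneg _) (Real.one_le_exp (by positivity))
        refine ((((hj 2).const_mul (P.DeltaReal x : ℂ)).add ((hj 1).const_mul
          (P.transformCoeff₁ x))).add ((hj 0).const_mul (P.transformCoeff₀ x))).neg.congr
            (Eventually.of_forall fun t => ?_)
        simp only [Pi.neg_apply, Pi.add_apply]
        ring
      have hFTC := integral_Ioi_of_hasDerivAt_of_tendsto (a := (0 : ℝ)) (m := (0 : ℂ))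
        (continuousWithinAt_update_same.2 (by
          have := hD x hx
          rwa [← Ici_sdiff_left] at this)) hder hint2 (by
          refine hlim.congr' ?_
          filter_upwards [eventually_gt_atTop 0] with t ht
          rw [Function.update_of_ne (ne_of_gt ht)])
      rw [integral_neg, Function.update_self, zero_sub, neg_inj] at hFTC
      exact hFTC

/-- The contribution of a compact arc to the integral transform. -/
theorem IsRadialSolution.arc_transform (hM : |P.a| < P.M) {c : ℂ} {R : ℂ → ℂ}
    (hR : P.IsRadialSolution c R) {γ γ' : ℝ → ℂ} {a b : ℝ} (hab : a ≤ b)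
    (hγ : ∀ t, HasDerivAt γ (γ' t) t) (hγ' : Continuous γ')
    (hmem : ∀ t ∈ Icc a b, γ t ∈ P.cutDomain c) :
    P.SolvesUpTo (fun x => ∫ t in a..b, γ' t * P.transformIntegrand c R x (γ t))
      (fun x => P.concomitant c R x (γ a) - P.concomitant c R x (γ b)) := by
  set φ : ℝ → ℂ := fun t => P.kernelLog (γ t) with hφ
  have hγc : Continuous γ := continuous_iff_continuousAt.2 fun t => (hγ t).continuousAt
  have hφc : Continuous φ := continuous_kernelLog.comp hγc
  set W : ℝ → ℂ := fun t => P.weight c (γ t) * R (γ t) with hW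
  have hWc : ContinuousOn W (Icc a b) :=
    (hR.continuousOn_weight_mul hM).comp hγc.continuousOn hmem
  have hti : ∀ x t : ℝ, γ' t * P.transformIntegrand c R x (γ t)
      = Complex.exp ((x - P.rm) * φ t) * (γ' t * W t) := fun x t => by
    rw [transformIntegrand_eq, freq_mul]
    ring
  have hint : ∀ x > P.rp, ∀ j : ℕ, ∃ ε > 0, IntegrableOn (fun t => Real.exp (ε * ‖φ t‖)
      * ‖Complex.exp ((x - P.rm) * φ t) * (φ t ^ j * (γ' t * W t))‖) (Ioc a b) := by
    intro x hx j
    refine ⟨1, one_pos, ?_⟩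
    have : ContinuousOn (fun t => Real.exp (1 * ‖φ t‖)
      * ‖Complex.exp ((x - P.rm) * φ t) * (φ t ^ j * (γ' t * W t))‖) (Icc a b) := by fun_prop
    exact this.integrableOn_Icc.mono_set Ioc_subset_Icc_self
  have hwmeas : AEStronglyMeasurable (fun t => γ' t * W t) (volume.restrict (Ioc a b)) := by
    have : ContinuousOn (fun t => γ' t * W t) (Icc a b) := by fun_prop
    exact (this.mono Ioc_subset_Icc_self).aestronglyMeasurable measurableSet_Ioc
  obtain ⟨g₁, g₂, a1, a2, a3, a4⟩ :=
    exists_derivatives_of_moment hφc.aestronglyMeasurable hwmeas hint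
  have hv : ∀ x : ℝ, ∫ t in a..b, γ' t * P.transformIntegrand c R x (γ t)
      = ∫ t in Ioc a b, Complex.exp ((x - P.rm) * φ t) * (γ' t * W t) := fun x => by
    rw [intervalIntegral.integral_of_le hab]
    simp only [hti]
  refine ⟨g₁, g₂, ?_, a2, a3, fun x hx => ?_⟩
  · simpa only [hv] using a1
  · simp only [hv]
    rw [a4 x hx, ← intervalIntegral.integral_of_le hab]
    have hder : ∀ t ∈ uIcc a b, HasDerivAt (fun t => P.concomitant c R x (γ t))
        (-((P.DeltaReal x * φ t ^ 2 + P.transformCoeff₁ x * φ t + P.transformCoeff₀ x)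
            * (Complex.exp ((x - P.rm) * φ t) * (γ' t * W t)))) t := fun t ht => by
      rw [uIcc_of_le hab] at ht
      refine ((concomitant_hasDerivAt hM hR x (hmem t ht)).comp t (hγ t)).congr_deriv ?_
      rw [symbol_eq hM hx, ← hti]
      ring
    have hci : IntervalIntegrable (fun t => -((P.DeltaReal x * φ t ^ 2 + P.transformCoeff₁ x * φ t
        + P.transformCoeff₀ x) * (Complex.exp ((x - P.rm) * φ t) * (γ' t * W t)))) volume a b := by
      refine ContinuousOn.intervalIntegrable ?_
      rw [uIcc_of_le hab]
      fun_prop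
    have := intervalIntegral.integral_eq_sub_of_hasDerivAt hder hci
    rw [intervalIntegral.integral_neg] at this
    linear_combination -this

end TeukolskyParams

/-! ### Behaviour at the horizon and boundary terms -/

theorem tendsto_branchPow_mul_branchLog {c : ℂ} (hc : ‖c‖ = 1) {β : ℂ} (hβ : 0 < β.re) :
    Tendsto (fun z => branchPow c z β * branchLog c z) (𝓝[≠] 0) (𝓝 0) := by
  have hn : Tendsto (fun z : ℂ => ‖z‖) (𝓝[≠] 0) (𝓝[>] 0) := tendsto_norm_nhdsNE_zero
  have h1 : Tendsto (fun y : ℝ => y ^ β.re * Real.log y) (𝓝[>] 0) (𝓝 0) := by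
    simpa only [mul_comm] using tendsto_log_mul_rpow_nhdsGT_zero hβ
  have h2 : Tendsto (fun y : ℝ => y ^ β.re) (𝓝[>] 0) (𝓝 0) := by
    have := (Real.continuous_rpow_const hβ.le).tendsto 0
    rw [Real.zero_rpow hβ.ne'] at this
    exact this.mono_left nhdsWithin_le_nhds
  have h3 : Tendsto (fun y : ℝ => (|y ^ β.re * Real.log y| + y ^ β.re * (2 * Real.pi))
      * Real.exp (|β.im| * (2 * Real.pi))) (𝓝[>] 0) (𝓝 0) := by
    simpa using (h1.abs.add (h2.mul_const (2 * Real.pi))).mul_const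
      (Real.exp (|β.im| * (2 * Real.pi)))
  refine squeeze_zero_norm' ?_ (h3.comp hn)
  filter_upwards [self_mem_nhdsWithin] with z hz
  have hz0 : 0 < ‖z‖ := norm_pos_iff.2 hz
  have h4 : ‖branchLog c z‖ ≤ |Real.log ‖z‖| + 2 * Real.pi := by
    refine (Complex.norm_le_abs_re_add_abs_im _).trans ?_
    rw [branchLog_re hc]
    gcongr
    exact abs_branchLog_im_le c z
  rw [norm_mul, Function.comp, abs_mul, abs_of_nonneg (Real.rpow_nonneg hz0.le _)]
  calc _ ≤ (‖z‖ ^ β.re * Real.exp (|β.im| * (2 * Real.pi))) * (|Real.log ‖z‖| + 2 * Real.pi) := by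
        gcongr
        exact norm_branchPow_le hc hz β
    _ = _ := by ring

namespace TeukolskyParams

variable {P : TeukolskyParams}

theorem tendsto_sub_rp (c : ℂ) :
    Tendsto (fun r : ℂ => r - P.rp) (𝓝[P.cutDomain c] (P.rp : ℂ)) (𝓝[≠] 0) := by
  refine tendsto_nhdsWithin_iff.2 ⟨?_, eventually_mem_nhdsWithin.mono fun r hr => sub_rp_ne hr⟩
  have : Tendsto (fun r : ℂ => r - P.rp) (𝓝 (P.rp : ℂ)) (𝓝 (P.rp - P.rp)) :=
    (continuous_id.sub continuous_const).tendsto _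
  rw [sub_self] at this
  exact this.mono_left nhdsWithin_le_nhds

/-- The leading behaviour at the horizon of an ingoing solution. -/
theorem IngoingAtHorizon.exists_tendsto {c : ℂ} (hc : ‖c‖ = 1) {R : ℂ → ℂ}
    (hR : P.IngoingAtHorizon c R) :
    ∃ (f : ℂ) (H : ℂ → ℂ), Tendsto H (𝓝[P.cutDomain c] (P.rp : ℂ)) (𝓝 f) ∧
      ∀ᶠ r in 𝓝[P.cutDomain c] (P.rp : ℂ),
        R r = branchPow c (r - P.rp) (P.xi - P.s / 2) * H r := by
  obtain ⟨F₁, F₂, h1, h2, h3, h4⟩ := hR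
  -- Dividing out (r - r₊)^{ξ-s/2} leaves the logarithm multiplied by (r - r₊)^{s-ξ}. In the
  -- resonant case Re(s - ξ) = s > 0, so this term tends to 0; otherwise F₂ vanishes. The leading
  -- coefficient is F₁(r₊) in both cases.
  refine ⟨F₁ P.rp, fun r => F₁ r + branchPow c (r - P.rp) (P.s - P.xi)
    * branchLog c (r - P.rp) * F₂ r, ?_, ?_⟩
  · have hF1 := h1.continuousAt.tendsto.mono_left (nhdsWithin_le_nhds (s := P.cutDomain c))
    have hF2 := h2.continuousAt.tendsto.mono_left (nhdsWithin_le_nhds (s := P.cutDomain c))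
    by_cases hres : P.Resonant
    · obtain ⟨hxi, n, hn, hs⟩ := hres
      have hre : 0 < (P.s - P.xi).re := by
        rw [hxi, sub_zero, Complex.ofReal_re, hs]
        exact_mod_cast hn
      have := ((tendsto_branchPow_mul_branchLog hc hre).comp (tendsto_sub_rp (P := P) c)).mul hF2
      simpa using hF1.add this
    · simpa [h3 hres] using hF1
  · filter_upwards [h4] with r hr
    rw [hr]
    have : (P.s / 2 : ℂ) = (P.xi - P.s / 2) + (P.s - P.xi) := by ring
    nth_rw 2 [this]
    rw [branchPow_add]
    ring

/-- The part of the weight that is regular at the horizon. -/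
def regularWeight (P : TeukolskyParams) (r : ℂ) : ℂ :=
  (r - P.rm) ^ (P.eta - P.s / 2) * Complex.exp (-Complex.I * P.ω * r)

theorem continuousAt_regularWeight (hM : |P.a| < P.M) :
    ContinuousAt P.regularWeight P.rp := by
  have : (P.rp : ℂ) - P.rm ∈ Complex.slitPlane := by
    left
    simpa using rm_lt_rp hM
  refine ContinuousAt.mul (ContinuousAt.cpow (by fun_prop) (by fun_prop) this) (by fun_prop)

/-- The singular factor of the weight and that of an ingoing solution coincide, so their exponents
add up to β = 2ξ - s. -/
theorem weight_mul_eq (c r : ℂ) (h : ℂ) :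
    P.weight c r * (branchPow c (r - P.rp) (P.xi - P.s / 2) * h)
      = branchPow c (r - P.rp) (2 * P.xi - P.s) * (P.regularWeight r * h) := by
  have : 2 * P.xi - P.s = (P.xi - P.s / 2) + (P.xi - P.s / 2) := by ring
  rw [this, branchPow_add, weight, regularWeight]
  ring

theorem eta_re : P.eta.re = 0 := by
  rw [eta, mul_div_assoc, ← Complex.ofReal_div, neg_mul, Complex.neg_re, Complex.I_mul_re,
    Complex.ofReal_im, neg_zero, neg_zero]

theorem norm_regularWeight (hM : |P.a| < P.M) :
    ‖P.regularWeight P.rp‖ = (P.rp - P.rm) ^ (-P.s / 2) := by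
  rw [regularWeight, norm_mul, ← Complex.ofReal_sub,
    Complex.norm_cpow_eq_rpow_re_of_pos (rp_sub_rm_pos hM), Complex.norm_exp]
  have : (P.eta - P.s / 2).re = -P.s / 2 := by
    simp [eta_re, neg_div]
  rw [this]
  simp

theorem ofReal_mem_cutDomain (hM : |P.a| < P.M) {c : ℂ} (hc : c ∈ Complex.slitPlane) {r : ℝ}
    (hr : P.rp < r) : (r : ℂ) ∈ P.cutDomain c := by
  refine ⟨by simpa using (rm_lt_rp hM).trans hr, ?_⟩
  have h := sub_pos.2 hr
  rw [← Complex.ofReal_sub, mul_comm]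
  rcases hc with hc | hc
  · left
    simpa using mul_pos h hc
  · right
    simpa using ⟨h.ne', hc⟩

/-- For real r > r₊ the modulus of (r - r₊)^{ξ-s/2} is (r - r₊)^{-s/2}, since ξ is imaginary; the
factor Δ^{s/2} removes it and leaves (r₊ - r₋)^{s/2}. -/
theorem tendsto_horizon_norm (hM : |P.a| < P.M) {c : ℂ}
    (hc' : c ∈ Complex.slitPlane) {R H : ℂ → ℂ} {f : ℂ}
    (hH : Tendsto H (𝓝[P.cutDomain c] (P.rp : ℂ)) (𝓝 f))
    (hR : ∀ᶠ r in 𝓝[P.cutDomain c] (P.rp : ℂ),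
        R r = branchPow c (r - P.rp) (P.xi - P.s / 2) * H r) :
    Tendsto (fun r : ℝ => P.DeltaReal r ^ (P.s / 2) * ‖R r‖) (𝓝[>] P.rp)
      (𝓝 ((P.rp - P.rm) ^ (P.s / 2) * ‖f‖)) := by
  have hc0 : c ≠ 0 := Complex.slitPlane_ne_zero hc'
  have hofReal : Tendsto (fun r : ℝ => (r : ℂ)) (𝓝[>] P.rp) (𝓝[P.cutDomain c] (P.rp : ℂ)) :=
    tendsto_nhdsWithin_iff.2 ⟨(Complex.continuous_ofReal.tendsto _).mono_left nhdsWithin_le_nhds,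
      eventually_mem_nhdsWithin.mono fun r hr => ofReal_mem_cutDomain hM hc' hr⟩
  have h1 : Tendsto (fun r : ℝ => (r - P.rm) ^ (P.s / 2)) (𝓝[>] P.rp)
      (𝓝 ((P.rp - P.rm) ^ (P.s / 2))) := by
    have : ContinuousAt (fun r : ℝ => (r - P.rm) ^ (P.s / 2)) P.rp :=
      ContinuousAt.rpow_const (by fun_prop) (Or.inl (rp_sub_rm_pos hM).ne')
    exact this.tendsto.mono_left nhdsWithin_le_nhds
  refine (h1.mul (hH.comp hofReal).norm).congr' ?_
  filter_upwards [self_mem_nhdsWithin, hofReal.eventually hR] with r hr hRr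
  have hr0 : 0 < r - P.rp := sub_pos.2 hr
  rw [hRr, Function.comp, norm_mul, ← Complex.ofReal_sub, branchPow_ofReal hc0 hr0,
    Complex.norm_cpow_eq_rpow_re_of_pos hr0, DeltaReal_eq hM,
    Real.mul_rpow (sub_pos.2 ((rm_lt_rp hM).trans hr)).le hr0.le]
  have hre : (P.xi - P.s / 2).re = -(P.s / 2) := by simp [xi_re]
  rw [hre, Real.rpow_neg hr0.le]
  have := (Real.rpow_pos_of_pos hr0 (P.s / 2)).ne'
  field_simp

theorem tendsto_vertical_rp (hM : |P.a| < P.M) :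
    Tendsto (fun t : ℝ => (P.rp : ℂ) + t * Complex.I) (𝓝[>] 0)
      (𝓝[P.cutDomain 1] (P.rp : ℂ)) := by
  refine tendsto_nhdsWithin_iff.2 ⟨?_, ?_⟩
  · have : Continuous fun t : ℝ => (P.rp : ℂ) + t * Complex.I := by fun_prop
    simpa using (this.tendsto 0).mono_left nhdsWithin_le_nhds
  · filter_upwards [self_mem_nhdsWithin] with t ht
    refine ⟨by simpa using rm_lt_rp hM, Or.inr ?_⟩
    have : t ≠ 0 := ne_of_gt ht
    simpa using this

theorem vertical_rp_mem (hM : |P.a| < P.M) {t : ℝ} (ht : 0 < t) :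
    (P.rp : ℂ) + t * Complex.I ∈ P.cutDomain 1 := by
  refine ⟨by simpa using rm_lt_rp hM, Or.inr ?_⟩
  simpa using ht.ne'

theorem isBigO_branchPow {c : ℂ} (hc : ‖c‖ = 1) {β : ℂ} (hβ : 0 ≤ β.re) :
    (fun r => branchPow c (r - P.rp) β) =O[𝓝[P.cutDomain c] (P.rp : ℂ)] fun _ => (1 : ℝ) := by
  refine Asymptotics.IsBigO.of_bound (Real.exp (|β.im| * (2 * Real.pi))) ?_
  have h : ∀ᶠ z : ℂ in 𝓝[≠] 0, ‖z‖ < 1 :=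
    (continuous_norm.tendsto' (0 : ℂ) 0 norm_zero).mono_left nhdsWithin_le_nhds
      |>.eventually (gt_mem_nhds one_pos)
  filter_upwards [(tendsto_sub_rp (P := P) c).eventually h, self_mem_nhdsWithin] with r hr hr'
  rw [norm_one, mul_one]
  refine (norm_branchPow_le hc (sub_rp_ne hr') β).trans ?_
  exact mul_le_of_le_one_left (Real.exp_pos _).le (Real.rpow_le_one (norm_nonneg _) hr.le hβ)

/-- The boundary term at the horizon vanishes if `s ≤ 0`. -/
theorem tendsto_concomitant_rp (hM : |P.a| < P.M) (hs : P.s ≤ 0) {c : ℂ} (hc : ‖c‖ = 1) {R : ℂ → ℂ}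
    (hR : P.IngoingAtHorizon c R) (x : ℝ) :
    Tendsto (P.concomitant c R x) (𝓝[P.cutDomain c] (P.rp : ℂ)) (𝓝 0) := by
  obtain ⟨F₁, F₂, h1, h2, h3, h4⟩ := hR
  have hres : ¬ P.Resonant := by
    rintro ⟨-, n, hn, h⟩
    have : (0 : ℝ) < n := by exact_mod_cast hn
    linarith
  set α := P.xi - P.s / 2 with hα
  have h5 : ∀ᶠ r in 𝓝[P.cutDomain c] (P.rp : ℂ), P.concomitant c R x r
      = branchPow c (r - P.rp) (2 * P.xi - P.s) * (Complex.exp (P.freq x * (r - P.rm))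
        * P.regularWeight r * (((r - P.rm) * α - P.weightLog r - P.Delta r * P.freq x) * F₁ r
          + P.Delta r * deriv F₁ r)) := by
    -- Computing R' requires the Frobenius form on a neighbourhood of r, not only at r itself.
    have h6 := eventually_eventually_nhdsWithin.2 h4
    have h7 : ∀ᶠ r in 𝓝[P.cutDomain c] (P.rp : ℂ), AnalyticAt ℂ F₁ r :=
      h1.eventually_analyticAt.filter_mono nhdsWithin_le_nhds
    filter_upwards [h4, h6, h7, self_mem_nhdsWithin] with r e1 e2 e3 hr
    rw [(isOpen_cutDomain c).nhdsWithin_eq hr] at e2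
    have hd : HasDerivAt (fun r => branchPow c (r - P.rp) α * F₁ r)
        (branchPow c (r - P.rp) α * (α / (r - P.rp)) * F₁ r
          + branchPow c (r - P.rp) α * deriv F₁ r) r :=
      ((branchPow_hasDerivAt α hr.2).comp_sub_const r (P.rp : ℂ)).mul
        e3.differentiableAt.hasDerivAt
    have hd' : HasDerivAt R _ r := hd.congr_of_eventuallyEq (e2.mono fun y hy => by
      rw [hy, h3 hres, mul_zero, add_zero])
    have : 2 * P.xi - P.s = α + α := by rw [hα]; ring
    have hne := sub_rp_ne hr
    rw [concomitant, hd'.deriv, e1, h3 hres, mul_zero, add_zero, weight, regularWeight, this,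
      branchPow_add, ← hα]
    have hΔ : P.Delta r * (branchPow c (r - P.rp) α * (α / (r - P.rp)) * F₁ r)
        = branchPow c (r - P.rp) α * ((r - P.rm) * α * F₁ r) := by
      rw [Delta_eq hM]
      field_simp
    rw [mul_add, hΔ]
    ring
  refine Tendsto.congr' (EventuallyEq.symm h5) ?_
  have hre : 0 ≤ (2 * P.xi - P.s).re := by simpa [xi_re] using hs
  refine isBoundedUnder_le_mul_tendsto_zero
    ((Asymptotics.isBigO_one_iff ℝ).1 (isBigO_branchPow hc hre)) ?_
  have hcont : ContinuousAt (fun r => Complex.exp (P.freq x * (r - P.rm)) * P.regularWeight r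
      * (((r - P.rm) * α - P.weightLog r - P.Delta r * P.freq x) * F₁ r
        + P.Delta r * deriv F₁ r)) (P.rp : ℂ) := by
    have c1 := continuousAt_regularWeight hM
    have c2 := (weightLog_hasDerivAt (P := P) P.rp).continuousAt
    have c3 := (Delta_hasDerivAt (P := P) P.rp).continuousAt
    have c4 := h1.continuousAt
    have c5 := h1.deriv.continuousAt
    fun_prop
  -- ΔR' behaves like (r₊ - r₋)αR at the horizon, and ℓ(r₊) = (r₊ - r₋)α. So the leading terms of
  -- the concomitant cancel, and a bounded power times a function vanishing at r₊ remains.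
  have hzero : ((P.rp : ℂ) - P.rm) * α - P.weightLog P.rp - P.Delta P.rp * P.freq x = 0 := by
    rw [weightLog_eq hM, Delta_eq hM, hα]
    ring
  have := hcont.tendsto.mono_left (nhdsWithin_le_nhds (s := P.cutDomain c))
  rwa [hzero, Delta_eq hM, sub_self, mul_zero, zero_mul, zero_mul, add_zero, mul_zero] at this

/-- The integral along the vertical ray from `r₊` converges and solves the transformed
equation. -/
theorem euler_solves (hM : |P.a| < P.M) (hω : 0 < P.ω) (hs : P.s ≤ 0) {R : ℂ → ℂ}
    (hR : P.IsRadialSolution 1 R) (hR' : P.IngoingAtHorizon 1 R) :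
    (∀ x > P.rp, VerticalIntegrable (P.transformIntegrand 1 R x) P.rp) ∧
      P.SolvesTransformed (P.toU (P.eulerTransform R)) := by
  have hlim := tendsto_vertical_rp hM
  obtain ⟨f, H, hH, hRH⟩ := hR'.exists_tendsto norm_one
  have h0 : (fun t : ℝ => P.weight 1 (P.rp + t * Complex.I) * R (P.rp + t * Complex.I))
      =O[𝓝[>] 0] fun _ => (1 : ℝ) := by
    have hre : 0 ≤ (2 * P.xi - P.s).re := by simpa [xi_re] using hs
    have h1 := (isBigO_branchPow (P := P) norm_one hre).mul
      ((((continuousAt_regularWeight hM).tendsto.mono_left nhdsWithin_le_nhds).mul hH).isBigO_one ℝ)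
    have h2 : (fun r => P.weight 1 r * R r) =O[𝓝[P.cutDomain 1] (P.rp : ℂ)] fun _ => (1 : ℝ) := by
      refine (h1.congr' (hRH.mono fun r hr => ?_) (by simp))
      simp only [hr, weight_mul_eq]
    exact h2.comp_tendsto hlim
  obtain ⟨h1, h2⟩ := hR.vertical_transform hM hω norm_one (fun t ht => vertical_rp_mem hM ht) h0
    (D := fun _ => 0) fun x _ => (tendsto_concomitant_rp hM hs norm_one hR' x).comp hlim
  exact ⟨h1, h2.solvesTransformed hM fun _ _ => rfl⟩

theorem vertical_rp_add_mem {δ : ℝ} (hδ : P.rm < P.rp + δ) (hδ0 : δ ≠ 0) (t : ℝ) :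
    (P.rp + δ : ℂ) + t * Complex.I ∈ P.cutDomain Complex.I := by
  refine ⟨by simpa using hδ, Or.inr ?_⟩
  simpa using hδ0

/-- The only point of the lower semicircle on the vertical line through r₊ is the lowest one, which
lies opposite to the upward cut; ρ < r₊ - r₋ keeps the arc to the right of r₋. -/
theorem circleMap_mem_cutDomain {ρ : ℝ} (hρ : 0 < ρ) (hρ' : ρ < P.rp - P.rm) {θ : ℝ}
    (hθ : θ ∈ Icc (-Real.pi) 0) : circleMap (P.rp : ℂ) ρ θ ∈ P.cutDomain Complex.I := by
  have h1 : (circleMap (P.rp : ℂ) ρ θ).re = P.rp + ρ * Real.cos θ := by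
    simp [circleMap, Complex.exp_ofReal_mul_I_re]
  have h2 : Complex.I * (circleMap (P.rp : ℂ) ρ θ - P.rp)
      = ((-(ρ * Real.sin θ) : ℝ) : ℂ) + ((ρ * Real.cos θ : ℝ) : ℂ) * Complex.I := by
    rw [circleMap, add_sub_cancel_left, Complex.exp_mul_I, ← Complex.ofReal_cos,
      ← Complex.ofReal_sin]
    push_cast
    linear_combination (ρ * Complex.sin θ : ℂ) * Complex.I_sq
  refine ⟨?_, ?_⟩
  · rw [h1]
    nlinarith [Real.neg_one_le_cos θ]
  · rw [h2, Complex.mem_slitPlane_iff]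
    simp only [Complex.add_re, Complex.ofReal_re, Complex.mul_re, Complex.I_re, mul_zero,
      Complex.ofReal_im, Complex.I_im, mul_one, sub_self, add_zero, Complex.add_im, Complex.mul_im,
      zero_add]
    rcases eq_or_ne (Real.cos θ) 0 with h | h
    · left
      have h3 : Real.sin θ ≤ 0 := Real.sin_nonpos_of_nonpos_of_neg_pi_le hθ.2 hθ.1
      have h4 : Real.sin θ ≠ 0 := fun h4 => by
        have := Real.sin_sq_add_cos_sq θ
        rw [h, h4] at this
        norm_num at this
      have h5 := lt_of_le_of_ne h3 h4
      nlinarith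
    · right
      exact mul_ne_zero hρ.ne' h

/-- The integral along the rotated Hankel contour converges and solves the transformed
equation. -/
theorem hankel_solves (hM : |P.a| < P.M) (hω : 0 < P.ω) {R : ℂ → ℂ}
    (hR : P.IsRadialSolution Complex.I R) {ρ : ℝ} (hρ : 0 < ρ) (hρ' : ρ < P.rp - P.rm) :
    (∀ x > P.rp, VerticalIntegrable (P.transformIntegrand Complex.I R x) (P.rp - ρ) ∧
      VerticalIntegrable (P.transformIntegrand Complex.I R x) (P.rp + ρ)) ∧
      P.SolvesTransformed (P.toU (P.hankelTransform ρ R)) := by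
  have key : ∀ δ : ℝ, P.rm < P.rp + δ → δ ≠ 0 →
      (∀ x > P.rp, VerticalIntegrable (P.transformIntegrand Complex.I R x) (P.rp + δ)) ∧
      P.SolvesUpTo (fun x => verticalIntegral (P.transformIntegrand Complex.I R x) (P.rp + δ))
        (fun x => P.concomitant Complex.I R x (P.rp + δ)) := fun δ h1 h2 => by
    have hmem := vertical_rp_add_mem h1 h2
    have hline : Continuous fun t : ℝ => (P.rp + δ : ℂ) + t * Complex.I := by fun_prop
    have hlim : Tendsto (fun t : ℝ => (P.rp + δ : ℂ) + t * Complex.I) (𝓝[>] 0)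
        (𝓝 (P.rp + δ : ℂ)) := by
      simpa using (hline.tendsto 0).mono_left nhdsWithin_le_nhds
    have hz : (P.rp + δ : ℂ) ∈ P.cutDomain Complex.I := by simpa using hmem 0
    refine hR.vertical_transform hM hω Complex.norm_I (fun t _ => hmem t) ?_ fun x _ =>
      (concomitant_hasDerivAt hM hR x hz).continuousAt.tendsto.comp hlim
    have := (hR.continuousOn_weight_mul hM).continuousAt
      ((isOpen_cutDomain Complex.I).mem_nhds hz)
    exact (this.tendsto.comp hlim).isBigO_one ℝ
  have k1 := key (-ρ) (by linarith) (by linarith)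
  have k2 := key ρ (by linarith [rm_lt_rp hM]) hρ.ne'
  have k3 := hR.arc_transform hM (γ := circleMap (P.rp : ℂ) ρ)
    (γ' := deriv (circleMap (P.rp : ℂ) ρ))
    (a := -Real.pi) (b := 0) (by linarith [Real.pi_pos])
    (fun t => (differentiable_circleMap _ _ t).hasDerivAt)
    (by
      have : deriv (circleMap (P.rp : ℂ) ρ) = fun θ => circleMap 0 ρ θ * Complex.I :=
        funext fun θ => deriv_circleMap _ _ _
      rw [this]
      fun_prop) fun θ hθ => circleMap_mem_cutDomain hρ hρ' hθ
  have e1 : (P.rp : ℂ) + ((-ρ : ℝ) : ℂ) = P.rp - ρ := by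
    push_cast
    ring
  rw [e1] at k1
  refine ⟨fun x hx => ⟨k1.1 x hx, k2.1 x hx⟩, ?_⟩
  -- The defects are -B(r₊ - ρ), then B(r₊ - ρ) - B(r₊ + ρ), then B(r₊ + ρ), with B the concomitant,
  -- and they sum to 0.
  refine ((k1.2.neg.add k3).add k2.2).solvesTransformed hM fun x hx => ?_
  have e2 : circleMap (P.rp : ℂ) ρ (-Real.pi) = P.rp - ρ := by
    rw [circleMap]
    push_cast
    rw [neg_mul, Complex.exp_neg, Complex.exp_pi_mul_I]
    ring
  have e3 : circleMap (P.rp : ℂ) ρ 0 = P.rp + ρ := by simp [circleMap]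
  rw [e2, e3]
  ring

end TeukolskyParams

/-! ### Primitives on star-shaped domains -/

/-- The primitive is the integral along the segment from the centre. Its derivative under the
integral sign is the integral of d/dt [t f(p + t(z - p))], which telescopes to f(z). This supplies
contour independence on the cut domains. -/
theorem StarConvex.exists_primitive {U : Set ℂ} {p : ℂ} (hU : IsOpen U) (hs : StarConvex ℝ p U)
    {f : ℂ → ℂ} (hf : DifferentiableOn ℂ f U) : ∃ F : ℂ → ℂ, ∀ z ∈ U, HasDerivAt F (f z) z := by
  refine ⟨fun z => ∫ t in (0 : ℝ)..1, (z - p) * f (p + t * (z - p)), fun z hz => ?_⟩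
  have hseg : ∀ w ∈ U, ∀ t ∈ Icc (0 : ℝ) 1, p + t * (w - p) ∈ U := fun w hw t ht => by
    have := hs.add_smul_sub_mem hw ht.1 ht.2
    simpa using this
  obtain ⟨δ, hδ, hball⟩ := Metric.nhds_basis_closedBall.mem_iff.1 (hU.mem_nhds hz)
  have hd : ∀ w ∈ U, HasDerivAt f (deriv f w) w := fun w hw =>
    (hf.differentiableAt (hU.mem_nhds hw)).hasDerivAt
  have hdc : ContinuousOn (deriv f) U := (hf.deriv hU).continuousOn
  have hfc : ContinuousOn f U := hf.continuousOn
  set Φ : ℂ × ℝ → ℂ := fun q => f (p + q.2 * (q.1 - p))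
    + (q.1 - p) * (deriv f (p + q.2 * (q.1 - p)) * q.2) with hΦ
  have hmaps : MapsTo (fun q : ℂ × ℝ => p + q.2 * (q.1 - p)) (Metric.closedBall z δ ×ˢ Icc 0 1) U :=
    fun q hq => hseg _ (hball hq.1) _ hq.2
  have hγ : Continuous fun q : ℂ × ℝ => p + q.2 * (q.1 - p) := by fun_prop
  have hΦc : ContinuousOn Φ (Metric.closedBall z δ ×ˢ Icc 0 1) := by
    have h1 := hfc.comp hγ.continuousOn hmaps
    have h2 := hdc.comp hγ.continuousOn hmaps
    have h3 : Continuous fun q : ℂ × ℝ => (q.1 - p) := by fun_prop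
    have h4 : Continuous fun q : ℂ × ℝ => (q.2 : ℂ) := by fun_prop
    exact h1.add (h3.continuousOn.mul (h2.mul h4.continuousOn))
  obtain ⟨C, hC⟩ := ((isCompact_closedBall z δ).prod isCompact_Icc).exists_bound_of_continuousOn hΦc
  have hsec : ∀ w ∈ Metric.closedBall z δ, ContinuousOn (fun t : ℝ => (w - p) * f (p + t * (w - p)))
      (Icc 0 1) := fun w hw => by
    have hγ' : Continuous fun t : ℝ => p + t * (w - p) := by fun_prop
    exact continuousOn_const.mul (hfc.comp hγ'.continuousOn fun t ht => hseg _ (hball hw) t ht)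
  have hz' : z ∈ Metric.closedBall z δ := Metric.mem_closedBall_self hδ.le
  have hsec' : ContinuousOn (fun t : ℝ => Φ (z, t)) (Icc 0 1) :=
    hΦc.comp (by fun_prop) fun t ht => ⟨hz', ht⟩
  have huI : uIoc (0 : ℝ) 1 = Ioc 0 1 := uIoc_of_le zero_le_one
  have key := intervalIntegral.hasDerivAt_integral_of_dominated_loc_of_deriv_le
    (μ := volume) (a := 0) (b := 1) (F := fun w t => (w - p) * f (p + t * (w - p)))
    (F' := fun w t => Φ (w, t)) (x₀ := z) (bound := fun _ => C) (Metric.ball_mem_nhds z hδ)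
    (by
      filter_upwards [Metric.closedBall_mem_nhds z hδ] with w hw
      rw [huI]
      exact ((hsec w hw).mono Ioc_subset_Icc_self).aestronglyMeasurable measurableSet_Ioc)
    (by
      refine ContinuousOn.intervalIntegrable ?_
      rw [uIcc_of_le zero_le_one]
      exact hsec z hz')
    (by
      rw [huI]
      exact (hsec'.mono Ioc_subset_Icc_self).aestronglyMeasurable measurableSet_Ioc)
    (Eventually.of_forall fun t ht w hw => by
      rw [huI] at ht
      exact hC (w, t) ⟨Metric.ball_subset_closedBall hw, Ioc_subset_Icc_self ht⟩)
    intervalIntegrable_const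
    (Eventually.of_forall fun t ht w hw => by
      rw [huI] at ht
      have h1 := hd _ (hseg w (hball (Metric.ball_subset_closedBall hw)) t
        (Ioc_subset_Icc_self ht))
      have h2 : HasDerivAt (fun w : ℂ => p + t * (w - p)) t w := by
        simpa using (((hasDerivAt_id w).sub_const p).const_mul (t : ℂ)).const_add p
      have h3 := ((hasDerivAt_id w).sub_const p).mul (h1.comp w h2)
      refine h3.congr_deriv ?_
      simp [hΦ])
  refine key.2.congr_deriv ?_
  have hFTC := intervalIntegral.integral_eq_sub_of_hasDerivAt (a := 0) (b := 1)
    (f := fun t : ℝ => (t : ℂ) * f (p + t * (z - p))) (f' := fun t => Φ (z, t))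
    (fun t ht => by
      rw [uIcc_of_le zero_le_one] at ht
      have h1 := hd _ (hseg z hz t ht)
      have h2 : HasDerivAt (fun t : ℝ => p + t * (z - p)) (z - p) t := by
        simpa using ((hasDerivAt_id t).ofReal_comp.mul_const (z - p)).const_add p
      have h3 := (hasDerivAt_id t).ofReal_comp.mul (h1.comp t h2)
      refine h3.congr_deriv ?_
      simp [hΦ]
      ring)
    (by
      refine ContinuousOn.intervalIntegrable ?_
      rw [uIcc_of_le zero_le_one]
      exact hsec')
  rw [hFTC]
  simp

/-! ### Watson's lemma -/

theorem integrableOn_rpow_mul_exp_neg_mul {s b σ : ℝ} (hb : 0 < b) (hσ : 0 ≤ σ)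
    (hσs : 0 < σ ∨ -1 < s) : IntegrableOn (fun v : ℝ => v ^ s * Real.exp (-b * v)) (Ioi σ) := by
  rcases hσs with hσ0 | hs
  · refine integrable_of_isBigO_exp_neg (b := b / 2) (half_pos hb) ?_ ?_
    · intro v hv
      have : v ≠ 0 := (hσ0.trans_le hv).ne'
      exact (ContinuousAt.mul (Real.continuousAt_rpow_const v s (Or.inl this))
        (by fun_prop)).continuousWithinAt
    · have h1 := (isLittleO_rpow_exp_pos_mul_atTop s (half_pos hb)).isBigO.mul
        (Asymptotics.isBigO_refl (fun v : ℝ => Real.exp (-b * v)) atTop)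
      refine h1.congr_right fun v => ?_
      rw [← Real.exp_add]
      ring_nf
  · have := integrableOn_rpow_mul_exp_neg_mul_rpow hs one_pos hb
    simp only [Real.rpow_one] at this
    exact this.mono_set (Ioi_subset_Ioi hσ)

theorem integrableOn_cexp_mul_cpow {β μ : ℂ} (hμ : 0 < μ.re) {σ : ℝ} (hσ : 0 ≤ σ)
    (hσβ : 0 < σ ∨ -1 < β.re) :
    IntegrableOn (fun v : ℝ => Complex.exp (-μ * v) * (v : ℂ) ^ β) (Ioi σ) := by
  refine Integrable.mono' (integrableOn_rpow_mul_exp_neg_mul hμ hσ hσβ) ?_ ?_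
  · refine ContinuousOn.aestronglyMeasurable (fun v hv => ?_) measurableSet_Ioi
    have hv0 : 0 < v := hσ.trans_lt hv
    refine ContinuousAt.continuousWithinAt (ContinuousAt.mul (by fun_prop) ?_)
    exact ContinuousAt.cpow (by fun_prop) continuousAt_const (Or.inl (by simpa using hv0))
  · filter_upwards [ae_restrict_mem measurableSet_Ioi] with v hv
    have hv0 : 0 < v := hσ.trans_lt hv
    rw [norm_mul, Complex.norm_exp, Complex.norm_cpow_eq_rpow_re_of_pos hv0, mul_comm]
    simp

/-- The substitution v = yu moves the scale 1/y to 1, and dominated convergence replaces h(v/y) by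
its limit at 0. Starting the integral at σ/y with σ > 0 removes any condition on Re β, which the
Hankel contour needs for s ≥ 1. -/
theorem watson_lemma {β μ : ℂ} (hμ : 0 < μ.re) {σ : ℝ} (hσ : 0 ≤ σ) (hσβ : 0 < σ ∨ -1 < β.re)
    {h : ℝ → ℂ} (hmeas : AEStronglyMeasurable h volume) {C Y : ℝ}
    (hbound : ∀ u > 0, ‖h u‖ ≤ C * Real.exp (Y * u)) {h₀ : ℂ} (hlim : Tendsto h (𝓝[>] 0) (𝓝 h₀)) :
    Tendsto (fun y : ℝ => (y : ℂ) ^ (β + 1) *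
      ∫ u in Ioi (σ / y), Complex.exp (-μ * (y * u)) * ((u : ℂ) ^ β * h u)) atTop
      (𝓝 (h₀ * ∫ v in Ioi σ, Complex.exp (-μ * v) * (v : ℂ) ^ β)) := by
  have hscale : ∀ᶠ y : ℝ in atTop, ∫ v in Ioi σ, Complex.exp (-μ * v) * (v : ℂ) ^ β * h (y⁻¹ * v)
      = (y : ℂ) ^ (β + 1) *
        ∫ u in Ioi (σ / y), Complex.exp (-μ * (y * u)) * ((u : ℂ) ^ β * h u) := by
    filter_upwards [eventually_gt_atTop 0] with y hy
    have hy0 : (y : ℂ) ≠ 0 := by exact_mod_cast hy.ne'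
    have := integral_comp_mul_left_Ioi
      (fun u : ℝ => Complex.exp (-μ * (y * u)) * ((u : ℂ) ^ β * h u)) σ (inv_pos.2 hy)
    rw [inv_inv, ← div_eq_inv_mul, Complex.real_smul] at this
    have h1 : (y : ℂ) ^ (β + 1) = (y : ℂ) ^ β * y := by
      rw [Complex.cpow_add _ _ hy0, Complex.cpow_one]
    rw [h1, mul_assoc, ← this, ← integral_const_mul]
    refine setIntegral_congr_fun measurableSet_Ioi fun v hv => ?_
    have hv0 : 0 < v := hσ.trans_lt hv
    have h2 : (y : ℂ) * ((y⁻¹ * v : ℝ) : ℂ) = v := by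
      push_cast
      field_simp
    have h3 : (y : ℂ) ^ β * ((y⁻¹ * v : ℝ) : ℂ) ^ β = (v : ℂ) ^ β := by
      rw [← Complex.mul_cpow_ofReal_nonneg hy.le (by positivity), h2]
    simp only [h2]
    rw [← h3]
    ring
  refine Tendsto.congr' hscale ?_
  rw [← integral_const_mul]
  -- After rescaling, the growth of h has rate Y/y; for large y it uses up at most half of the decay
  -- rate Re μ.
  have hY : ∀ᶠ y : ℝ in atTop, 0 < y ∧ Y / y ≤ μ.re / 2 := by
    filter_upwards [eventually_gt_atTop 0, eventually_ge_atTop (2 * Y / μ.re)] with y hy hy'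
    refine ⟨hy, ?_⟩
    rw [div_le_iff₀ hμ] at hy'
    rw [div_le_iff₀ hy]
    linarith
  refine tendsto_integral_filter_of_dominated_convergence
    (fun v => C * (v ^ β.re * Real.exp (-(μ.re / 2) * v))) ?_ ?_
    ((integrableOn_rpow_mul_exp_neg_mul (half_pos hμ) hσ hσβ).const_mul C) ?_
  · filter_upwards [eventually_gt_atTop 0] with y hy
    have hq : Measure.QuasiMeasurePreserving (fun v : ℝ => y⁻¹ * v) volume volume := by
      refine ⟨by fun_prop, ?_⟩
      rw [Real.map_volume_mul_left (inv_ne_zero hy.ne')]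
      exact Measure.smul_absolutelyContinuous
    exact (integrableOn_cexp_mul_cpow hμ hσ hσβ).aestronglyMeasurable.mul
      (hmeas.comp_quasiMeasurePreserving hq).restrict
  · filter_upwards [hY] with y hy
    filter_upwards [ae_restrict_mem measurableSet_Ioi] with v hv
    have hv0 : 0 < v := hσ.trans_lt hv
    have h1 := hbound (y⁻¹ * v) (mul_pos (inv_pos.2 hy.1) hv0)
    have hC : 0 ≤ C := by
      by_contra hC
      have := mul_neg_of_neg_of_pos (not_le.1 hC) (Real.exp_pos (Y * (y⁻¹ * v)))
      linarith [norm_nonneg (h (y⁻¹ * v))]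
    rw [norm_mul, norm_mul, Complex.norm_exp, Complex.norm_cpow_eq_rpow_re_of_pos hv0]
    have h2 : (-μ * (v : ℂ)).re = -(μ.re) * v := by simp
    have h3 : Y * (y⁻¹ * v) ≤ μ.re / 2 * v := by
      rw [← mul_assoc, ← div_eq_mul_inv]
      exact mul_le_mul_of_nonneg_right hy.2 hv0.le
    rw [h2]
    calc Real.exp (-μ.re * v) * v ^ β.re * ‖h (y⁻¹ * v)‖
        ≤ Real.exp (-μ.re * v) * v ^ β.re * (C * Real.exp (μ.re / 2 * v)) := by
          gcongr
          exact h1.trans (by gcongr)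
      _ = C * (v ^ β.re * (Real.exp (-μ.re * v) * Real.exp (μ.re / 2 * v))) := by ring
      _ = _ := by
          rw [← Real.exp_add]
          ring_nf
  · filter_upwards [ae_restrict_mem measurableSet_Ioi] with v hv
    have hv0 : 0 < v := hσ.trans_lt hv
    have h1 : Tendsto (fun y : ℝ => y⁻¹ * v) atTop (𝓝[>] 0) := by
      refine tendsto_nhdsWithin_iff.2 ⟨by simpa using tendsto_inv_atTop_zero.mul_const v, ?_⟩
      filter_upwards [eventually_gt_atTop 0] with y hy
      exact mul_pos (inv_pos.2 hy) hv0
    rw [mul_comm h₀]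
    exact (hlim.comp h1).const_mul _

theorem exists_bound_Ioc {h : ℝ → ℂ} {l : ℝ} (hcont : ContinuousOn h (Ioc 0 l)) {h₀ : ℂ}
    (hlim : Tendsto h (𝓝[>] 0) (𝓝 h₀)) : ∃ C, ∀ u ∈ Ioc 0 l, ‖h u‖ ≤ C := by
  have h1 : ∀ᶠ u in 𝓝[>] (0 : ℝ), ‖h u‖ < ‖h₀‖ + 1 :=
    hlim.norm.eventually (gt_mem_nhds (lt_add_one _))
  obtain ⟨δ, hδ, hδ'⟩ := mem_nhdsGT_iff_exists_Ioo_subset.1 h1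
  have hδ0 : (0 : ℝ) < δ := hδ
  have hsub : Icc δ l ⊆ Ioc 0 l := fun u hu => ⟨hδ0.trans_le hu.1, hu.2⟩
  obtain ⟨C, hC⟩ := isCompact_Icc.exists_bound_of_continuousOn (hcont.mono hsub)
  refine ⟨max (‖h₀‖ + 1) C, fun u hu => ?_⟩
  rcases lt_or_ge u δ with h | h
  · have h2 : ‖_‖ < _ := hδ' ⟨hu.1, h⟩
    exact h2.le.trans (le_max_left _ _)
  · exact (hC u ⟨h, hu.2⟩).trans (le_max_right _ _)

/-- Watson's lemma wants one exponential bound on all of (0, ∞), so the bound near infinity is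
combined with boundedness down to 0. The rate |c| + 1 keeps the exponential at least 1 on the
bounded part. -/
theorem ExpType.exists_bound {f : ℝ → ℂ} {c : ℝ} (hf : ExpType f c)
    (hcont : ContinuousOn f (Ioi 0)) {f₀ : ℂ} (hlim : Tendsto f (𝓝[>] 0) (𝓝 f₀)) :
    ∃ C, ∀ u > 0, ‖f u‖ ≤ C * Real.exp ((|c| + 1) * u) := by
  obtain ⟨C, hC⟩ := (hf 1 one_pos).bound
  obtain ⟨T, hT⟩ := eventually_atTop.1 hC
  obtain ⟨C', hC'⟩ := exists_bound_Ioc (l := T) (hcont.mono fun u hu => hu.1) hlim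
  refine ⟨max |C| |C'|, fun u hu => ?_⟩
  have hexp : 1 ≤ Real.exp ((|c| + 1) * u) := Real.one_le_exp (by positivity)
  rcases le_or_gt u T with h | h
  · refine (hC' u ⟨hu, h⟩).trans ((le_abs_self C').trans ((le_max_right |C| |C'|).trans ?_))
    exact le_mul_of_one_le_right ((abs_nonneg C).trans (le_max_left _ _)) hexp
  · have h1 := hT u h.le
    rw [Real.norm_of_nonneg (Real.exp_pos _).le] at h1
    refine h1.trans ?_
    gcongr
    · exact (le_abs_self C).trans (le_max_left _ _)
    · exact le_abs_self c

/-! ### The contour integral of `e^{iz} z^β` along a wedge -/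

/-- With the cut upwards the argument runs over (-3π/2, π/2), so that -5π/4 and π/4 are honest
arguments on the two sides of the cut. -/
theorem branchLog_I_exp {θ : ℝ} (h1 : -(3 * Real.pi / 2) < θ) (h2 : θ < Real.pi / 2) :
    branchLog Complex.I (Complex.exp (θ * Complex.I)) = θ * Complex.I := by
  have h : Complex.I * Complex.exp (θ * Complex.I)
      = Complex.exp (((Real.pi / 2 + θ : ℝ) : ℂ) * Complex.I) := by
    push_cast
    rw [add_mul, Complex.exp_add, Complex.exp_pi_div_two_mul_I]
  rw [branchLog, h, Complex.log_exp, Complex.log_I]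
  · push_cast
    ring
  · simp
    linarith
  · simp
    linarith

theorem branchPow_I_polar {θ u : ℝ} (h1 : -(3 * Real.pi / 2) < θ) (h2 : θ < Real.pi / 2)
    (hu : 0 < u) (β : ℂ) :
    branchPow Complex.I (u * Complex.exp (θ * Complex.I)) β
      = (u : ℂ) ^ β * Complex.exp (β * (θ * Complex.I)) := by
  rw [branchPow_ofReal_mul Complex.I_ne_zero (Complex.exp_ne_zero _) hu, branchPow,
    branchLog_I_exp h1 h2]

theorem I_mul_polar_mem_slitPlane {θ u : ℝ} (h1 : -(3 * Real.pi / 2) < θ) (h2 : θ < Real.pi / 2)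
    (hu : 0 < u) : Complex.I * (u * Complex.exp (θ * Complex.I)) ∈ Complex.slitPlane := by
  have h : Complex.I * (u * Complex.exp (θ * Complex.I))
      = u * Complex.exp (((Real.pi / 2 + θ : ℝ) : ℂ) * Complex.I) := by
    push_cast
    rw [add_mul, Complex.exp_add, Complex.exp_pi_div_two_mul_I]
    ring
  rw [h, Complex.mem_slitPlane_iff_arg]
  refine ⟨?_, mul_ne_zero (by exact_mod_cast hu.ne') (Complex.exp_ne_zero _)⟩
  rw [Complex.exp_mul_I, Complex.arg_mul_cos_add_sin_mul_I hu ⟨by linarith, by linarith⟩]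
  linarith

/-- The rotated exponent in the kernel `e^{iz} = e^{-μv}` for `z = v e^{iθ}`. -/
def rayExponent (θ : ℝ) : ℂ := -(Complex.I * Complex.exp (θ * Complex.I))

theorem rayExponent_re (θ : ℝ) : (rayExponent θ).re = Real.sin θ := by
  simp [rayExponent, Complex.exp_ofReal_mul_I_im]

/-- The contribution of a ray to the wedge integral. -/
def wedgeRay (θ σ : ℝ) (β : ℂ) : ℂ :=
  Complex.exp ((β + 1) * (θ * Complex.I))
    * ∫ v in Ioi σ, Complex.exp (-rayExponent θ * v) * (v : ℂ) ^ β

/-- The contribution of an arc to the wedge integral. -/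
def wedgeArc (σ θ₀ θ₁ : ℝ) (β : ℂ) : ℂ :=
  ∫ θ in θ₀..θ₁, Complex.exp (β * (θ * Complex.I))
    * (Complex.I * Complex.exp (θ * Complex.I)
      * Complex.exp (Complex.I * (σ * Complex.exp (θ * Complex.I))))

/-- The integral of `e^{iz} z^β` along the wedge with the directions `e^{-5πi/4}` and
`e^{πi/4}`. -/
def wedgeConst (β : ℂ) : ℂ :=
  wedgeRay (Real.pi / 4) 1 β - wedgeRay (-(5 * Real.pi / 4)) 1 β
    + wedgeArc 1 (-(5 * Real.pi / 4)) (Real.pi / 4) β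

theorem differentiable_wedgeArc (σ : ℝ) {θ₀ θ₁ : ℝ} (hθ : θ₀ ≤ θ₁) :
    Differentiable ℂ (wedgeArc σ θ₀ θ₁) := fun β => by
  have hc : Continuous fun θ : ℝ => (θ : ℂ) * Complex.I := by fun_prop
  have hw : Continuous fun θ : ℝ => Complex.I * Complex.exp (θ * Complex.I)
      * Complex.exp (Complex.I * (σ * Complex.exp (θ * Complex.I))) := by fun_prop
  have := hasDerivAt_integral_cexp_mul (μ := volume.restrict (Ioc θ₀ θ₁)) (X := β)
    hc.aestronglyMeasurable hw.aestronglyMeasurable one_pos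
    ((Continuous.integrableOn_Icc (by fun_prop)).mono_set Ioc_subset_Icc_self)
  refine (this.differentiableAt).congr_of_eventuallyEq (Eventually.of_forall fun β => ?_)
  rw [wedgeArc, intervalIntegral.integral_of_le hθ]

/-- For v > 1 the power is e^{β log v} with log v > 0, and the moment factor e^{|log v|} = v merely
raises the exponent by one. Away from v = 0 this stays integrable for every β, which is what makes
the wedge integral entire. -/
theorem differentiable_wedgeRay {θ : ℝ} (hθ : 0 < Real.sin θ) :
    Differentiable ℂ (wedgeRay θ 1) := fun β => by
  refine DifferentiableAt.mul (by fun_prop) ?_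
  have hμ : 0 < (rayExponent θ).re := by rwa [rayExponent_re]
  have hlog : ContinuousOn (fun v : ℝ => (Real.log v : ℂ)) (Ioi 1) := fun v hv => by
    have : v ≠ 0 := (zero_lt_one.trans hv).ne'
    exact (Complex.continuous_ofReal.continuousAt.comp
      (Real.continuousAt_log this)).continuousWithinAt
  have hcpow : ∀ (γ : ℂ), ∀ v ∈ Ioi (1 : ℝ), (v : ℂ) ^ γ = Complex.exp (γ * Real.log v) :=
    fun γ v hv => by
      have h0 : (0 : ℝ) < v := zero_lt_one.trans hv
      rw [Complex.cpow_def_of_ne_zero (by exact_mod_cast h0.ne'), Complex.ofReal_log h0.le,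
        mul_comm]
  have hint : IntegrableOn (fun v : ℝ => Real.exp (1 * ‖(Real.log v : ℂ)‖)
      * ‖Complex.exp (β * Real.log v) * Complex.exp (-rayExponent θ * v)‖) (Ioi 1) := by
    have h1 := (integrableOn_cexp_mul_cpow (β := β + 1) hμ zero_le_one (Or.inl one_pos)).norm
    refine h1.congr ?_
    filter_upwards [ae_restrict_mem measurableSet_Ioi] with v hv
    have h0 : (0 : ℝ) < v := zero_lt_one.trans hv
    rw [hcpow _ v hv, one_mul, Complex.norm_of_nonneg (Real.log_nonneg (le_of_lt hv)), add_mul,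
      Complex.exp_add, one_mul, norm_mul, norm_mul, norm_mul, ← Complex.ofReal_exp,
      Complex.norm_of_nonneg (Real.exp_pos _).le]
    ring
  have := hasDerivAt_integral_cexp_mul (μ := volume.restrict (Ioi 1)) (X := β)
    (hlog.aestronglyMeasurable measurableSet_Ioi)
    (Continuous.aestronglyMeasurable (f := fun v : ℝ => Complex.exp (-rayExponent θ * v))
      (by fun_prop)) one_pos hint
  refine (this.differentiableAt).congr_of_eventuallyEq (Eventually.of_forall fun β => ?_)
  refine setIntegral_congr_fun measurableSet_Ioi fun v hv => ?_
  rw [hcpow _ v hv]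
  ring

theorem sin_wedge_right : 0 < Real.sin (Real.pi / 4) := by
  rw [Real.sin_pi_div_four]
  positivity

theorem sin_wedge_left : 0 < Real.sin (-(5 * Real.pi / 4)) := by
  have : -(5 * Real.pi / 4) = -(Real.pi / 4 + Real.pi) := by ring
  rw [this, Real.sin_neg, Real.sin_add_pi, neg_neg]
  exact sin_wedge_right

theorem differentiable_wedgeConst : Differentiable ℂ wedgeConst :=
  ((differentiable_wedgeRay sin_wedge_right).sub (differentiable_wedgeRay sin_wedge_left)).add
    (differentiable_wedgeArc 1 (by linarith [Real.pi_pos]))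

/-- The fundamental theorem of calculus along the boundary of a wedge with apex `c`. -/
theorem wedge_deformation {F f : ℂ → ℂ} {U : Set ℂ} (hF : ∀ z ∈ U, HasDerivAt F (f z) z)
    (hf : ContinuousOn f U) {c : ℂ} {θ₀ θ₁ σ l : ℝ} (hσl : σ ≤ l)
    (h0 : ∀ u ∈ Icc σ l, c + u * Complex.exp (θ₀ * Complex.I) ∈ U)
    (h1 : ∀ u ∈ Icc σ l, c + u * Complex.exp (θ₁ * Complex.I) ∈ U)
    (hθ : θ₀ ≤ θ₁) (harc : ∀ θ ∈ Icc θ₀ θ₁, c + σ * Complex.exp (θ * Complex.I) ∈ U) :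
    F (c + l * Complex.exp (θ₁ * Complex.I)) - F (c + l * Complex.exp (θ₀ * Complex.I))
      = (∫ u in σ..l, Complex.exp (θ₁ * Complex.I) * f (c + u * Complex.exp (θ₁ * Complex.I)))
        - (∫ u in σ..l, Complex.exp (θ₀ * Complex.I) * f (c + u * Complex.exp (θ₀ * Complex.I)))
        + ∫ θ in θ₀..θ₁, σ * (Complex.I * Complex.exp (θ * Complex.I))
          * f (c + σ * Complex.exp (θ * Complex.I)) := by
  have hray : ∀ θ : ℝ, (∀ u ∈ Icc σ l, c + u * Complex.exp (θ * Complex.I) ∈ U) →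
      ∫ u in σ..l, Complex.exp (θ * Complex.I) * f (c + u * Complex.exp (θ * Complex.I))
        = F (c + l * Complex.exp (θ * Complex.I)) - F (c + σ * Complex.exp (θ * Complex.I)) :=
    fun θ h => by
      refine intervalIntegral.integral_eq_sub_of_hasDerivAt
        (f := fun u : ℝ => F (c + u * Complex.exp (θ * Complex.I))) (fun u hu => ?_) ?_
      · rw [uIcc_of_le hσl] at hu
        have h2 : HasDerivAt (fun u : ℝ => c + u * Complex.exp (θ * Complex.I))
            (Complex.exp (θ * Complex.I)) u := by
          simpa using ((hasDerivAt_id u).ofReal_comp.mul_const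
            (Complex.exp (θ * Complex.I))).const_add c
        exact ((hF _ (h u hu)).comp u h2).congr_deriv (mul_comm _ _)
      · refine ContinuousOn.intervalIntegrable ?_
        rw [uIcc_of_le hσl]
        have hγ : Continuous fun u : ℝ => c + u * Complex.exp (θ * Complex.I) := by fun_prop
        exact continuousOn_const.mul (hf.comp hγ.continuousOn h)
  have harc' : ∫ θ in θ₀..θ₁, σ * (Complex.I * Complex.exp (θ * Complex.I))
      * f (c + σ * Complex.exp (θ * Complex.I))
      = F (c + σ * Complex.exp (θ₁ * Complex.I)) - F (c + σ * Complex.exp (θ₀ * Complex.I)) := by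
    refine intervalIntegral.integral_eq_sub_of_hasDerivAt
      (f := fun θ : ℝ => F (c + σ * Complex.exp (θ * Complex.I))) (fun θ hθ' => ?_) ?_
    · rw [uIcc_of_le hθ] at hθ'
      have h2 : HasDerivAt (fun θ : ℝ => c + σ * Complex.exp (θ * Complex.I))
          (σ * (Complex.I * Complex.exp (θ * Complex.I))) θ := by
        have h3 := (((hasDerivAt_id θ).ofReal_comp.mul_const Complex.I).cexp.const_mul
          (σ : ℂ)).const_add c
        refine h3.congr_deriv ?_
        simp only [id, Complex.ofReal_one]
        ring
      exact ((hF _ (harc θ hθ')).comp θ h2).congr_deriv (mul_comm _ _)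
    · refine ContinuousOn.intervalIntegrable ?_
      rw [uIcc_of_le hθ]
      have hγ : Continuous fun θ : ℝ => c + σ * Complex.exp (θ * Complex.I) := by fun_prop
      have hγ' : Continuous fun θ : ℝ => σ * (Complex.I * Complex.exp (θ * Complex.I)) := by
        fun_prop
      exact hγ'.continuousOn.mul (hf.comp hγ.continuousOn harc)
  rw [hray θ₀ h0, hray θ₁ h1, harc']
  ring

/-- The function e^{iz}z^β has a primitive on the plane cut upwards. Two wedges with the same outer
corners and inner radii σ and 1 therefore have the same integral, and the common outer rays cancel.
-/
theorem wedgeConst_eq_shrink {β : ℂ} {σ : ℝ} (hσ : 0 < σ) (hσ1 : σ ≤ 1) :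
    wedgeConst β = wedgeRay (Real.pi / 4) σ β - wedgeRay (-(5 * Real.pi / 4)) σ β
      + (σ : ℂ) ^ (β + 1) * wedgeArc σ (-(5 * Real.pi / 4)) (Real.pi / 4) β := by
  have hpi := Real.pi_pos
  set U : Set ℂ := {z | Complex.I * z ∈ Complex.slitPlane} with hU
  have hUo : IsOpen U := Complex.isOpen_slitPlane.preimage (by fun_prop)
  have hstar : StarConvex ℝ (-Complex.I) U := by
    have h := Complex.starConvex_one_slitPlane
    intro z hz a b ha hb hab
    have := h hz ha hb hab
    simp only [hU, mem_ofPred_eq]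
    have e : Complex.I * (a • -Complex.I + b • z) = a • (1 : ℂ) + b • (Complex.I * z) := by
      simp only [Complex.real_smul]
      linear_combination (-(a : ℂ)) * Complex.I_sq
    rwa [e]
  set f : ℂ → ℂ := fun z => Complex.exp (Complex.I * z) * branchPow Complex.I z β with hf
  have hfd : DifferentiableOn ℂ f U := fun z hz => by
    have h1 : DifferentiableAt ℂ (fun z => Complex.exp (Complex.I * z)) z := by fun_prop
    exact (h1.mul (branchPow_hasDerivAt β hz).differentiableAt).differentiableWithinAt
  obtain ⟨F, hF⟩ := hstar.exists_primitive hUo hfd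
  have hmem : ∀ {θ u : ℝ}, -(5 * Real.pi / 4) ≤ θ → θ ≤ Real.pi / 4 → 0 < u →
      (0 : ℂ) + u * Complex.exp (θ * Complex.I) ∈ U := fun h1 h2 hu => by
    rw [zero_add]
    exact I_mul_polar_mem_slitPlane (by linarith) (by linarith) hu
  have hle : -(5 * Real.pi / 4) ≤ Real.pi / 4 := by linarith
  have hpow : ∀ {θ u : ℝ}, -(5 * Real.pi / 4) ≤ θ → θ ≤ Real.pi / 4 → 0 < u →
      f (0 + u * Complex.exp (θ * Complex.I)) = Complex.exp (-rayExponent θ * u)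
        * ((u : ℂ) ^ β * Complex.exp (β * (θ * Complex.I))) := fun {θ u} h1 h2 hu => by
    simp only [hf]
    rw [zero_add, branchPow_I_polar (by linarith) (by linarith) hu, rayExponent]
    congr 2
    ring
  have hdef : ∀ {σ : ℝ}, 0 < σ → σ ≤ 1 → _ := fun {σ} hσ hσ1 =>
    wedge_deformation (σ := σ) (l := 1) (c := 0) hF hfd.continuousOn hσ1
      (fun u hu => hmem le_rfl hle (hσ.trans_le hu.1))
      (fun u hu => hmem hle le_rfl (hσ.trans_le hu.1)) hle (fun θ hθ => hmem hθ.1 hθ.2 hσ)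
  have harc : ∀ {σ : ℝ}, 0 < σ →
      ∫ θ in (-(5 * Real.pi / 4))..(Real.pi / 4), σ * (Complex.I * Complex.exp (θ * Complex.I))
        * f (0 + σ * Complex.exp (θ * Complex.I))
      = (σ : ℂ) ^ (β + 1) * wedgeArc σ (-(5 * Real.pi / 4)) (Real.pi / 4) β := fun {σ} hσ => by
    rw [wedgeArc, ← intervalIntegral.integral_const_mul]
    refine intervalIntegral.integral_congr fun θ hθ => ?_
    rw [uIcc_of_le hle] at hθ
    simp only [hpow hθ.1 hθ.2 hσ, rayExponent]
    rw [Complex.cpow_add _ _ (by exact_mod_cast hσ.ne'), Complex.cpow_one]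
    have : -(-(Complex.I * Complex.exp (θ * Complex.I))) * (σ : ℂ)
        = Complex.I * (σ * Complex.exp (θ * Complex.I)) := by ring
    rw [this]
    ring
  have hray : ∀ {θ : ℝ}, -(5 * Real.pi / 4) ≤ θ → θ ≤ Real.pi / 4 → 0 < Real.sin θ →
      ∫ u in σ..1, Complex.exp (θ * Complex.I) * f (0 + u * Complex.exp (θ * Complex.I))
        = wedgeRay θ σ β - wedgeRay θ 1 β := fun {θ} h1 h2 hsin => by
    have hμ : 0 < (rayExponent θ).re := by rwa [rayExponent_re]
    rw [wedgeRay, wedgeRay, ← mul_sub, intervalIntegral.integral_Ioi_sub_Ioi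
      (integrableOn_cexp_mul_cpow hμ hσ.le (Or.inl hσ)) hσ1,
      ← intervalIntegral.integral_const_mul]
    refine intervalIntegral.integral_congr fun u hu => ?_
    rw [uIcc_of_le hσ1] at hu
    simp only [hpow h1 h2 (hσ.trans_le hu.1)]
    rw [add_mul, Complex.exp_add, one_mul]
    ring
  have e1 := hdef hσ hσ1
  -- With inner radius equal to the outer one the rays degenerate, and only the unit arc is left.
  have e2 := hdef one_pos le_rfl
  rw [harc hσ, hray hle le_rfl sin_wedge_right, hray le_rfl hle sin_wedge_left] at e1
  rw [harc one_pos, intervalIntegral.integral_same, intervalIntegral.integral_same,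
    Complex.ofReal_one, Complex.one_cpow] at e2
  rw [wedgeConst]
  simp only [Complex.ofReal_one] at e1
  linear_combination e1 - e2

/-- Both sides are holomorphic in μ on the right half plane and agree for real μ > 0 by Euler's
integral; points accumulating at 1 suffice for the identity theorem. Complex μ arises from tilted
rays. -/
theorem integral_cexp_neg_mul_cpow {β μ : ℂ} (hβ : -1 < β.re) (hμ : 0 < μ.re) :
    ∫ v in Ioi (0 : ℝ), Complex.exp (-μ * v) * (v : ℂ) ^ β
      = μ⁻¹ ^ (β + 1) * Complex.Gamma (β + 1) := by
  set U : Set ℂ := {μ | 0 < μ.re} with hU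
  have hUo : IsOpen U := isOpen_lt continuous_const Complex.continuous_re
  have hUc : IsPreconnected U := (convex_halfSpace_re_gt 0).isPreconnected
  have h1 : DifferentiableOn ℂ
      (fun μ : ℂ => ∫ v in Ioi (0 : ℝ), Complex.exp (-μ * v) * (v : ℂ) ^ β) U := fun μ hμ => by
    have hμ' : 0 < μ.re := hμ
    have hint : IntegrableOn (fun v : ℝ => Real.exp (μ.re / 2 * ‖(v : ℂ)‖)
        * ‖Complex.exp (-μ * v) * (v : ℂ) ^ β‖) (Ioi 0) := by
      have h2 : 0 < (μ / 2).re := by simpa using half_pos hμ'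
      refine (integrableOn_cexp_mul_cpow (β := β) h2 le_rfl (Or.inr hβ)).norm.congr ?_
      filter_upwards [ae_restrict_mem measurableSet_Ioi] with v hv
      have hv0 : (0 : ℝ) < v := hv
      rw [norm_mul, norm_mul, Complex.norm_exp, Complex.norm_exp, Complex.norm_of_nonneg hv0.le,
        ← mul_assoc, ← Real.exp_add]
      congr 2
      simp
      ring
    have h3 := hasDerivAt_integral_cexp_mul (μ := volume.restrict (Ioi 0)) (X := -μ)
      (Complex.continuous_ofReal.aestronglyMeasurable)
      (Measurable.aestronglyMeasurable (f := fun v : ℝ => (v : ℂ) ^ β) (by fun_prop))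
      (half_pos hμ') hint
    exact (h3.comp μ (hasDerivAt_neg μ)).differentiableAt.differentiableWithinAt
  have h2 : DifferentiableOn ℂ (fun μ : ℂ => μ⁻¹ ^ (β + 1) * Complex.Gamma (β + 1)) U :=
    fun μ hμ => by
      have hμ' : 0 < μ.re := hμ
      have h0 : μ ≠ 0 := fun h => by simp [h] at hμ'
      have h4 : 0 < (μ⁻¹).re := by
        rw [Complex.inv_re]
        exact div_pos hμ' (Complex.normSq_pos.2 h0)
      refine DifferentiableAt.differentiableWithinAt (DifferentiableAt.mul_const ?_ _)
      exact (differentiableAt_inv h0).cpow_const (Or.inl h4)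
  refine AnalyticOnNhd.eqOn_of_preconnected_of_frequently_eq (z₀ := 1)
    (h1.analyticOnNhd hUo) (h2.analyticOnNhd hUo) hUc (by simp [hU]) ?_ hμ
  have h5 : Tendsto (fun n : ℕ => ((1 + 1 / ((n : ℝ) + 1) : ℝ) : ℂ)) atTop (𝓝[≠] 1) := by
    refine tendsto_nhdsWithin_iff.2 ⟨?_, Eventually.of_forall fun n => ?_⟩
    · have h6 := (tendsto_one_div_add_atTop_nhds_zero_nat (𝕜 := ℝ)).const_add 1
      rw [add_zero] at h6
      exact_mod_cast (Complex.continuous_ofReal.tendsto 1).comp h6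
    · have : (0 : ℝ) < 1 / ((n : ℝ) + 1) := by positivity
      intro h
      have h7 : (1 + 1 / ((n : ℝ) + 1) : ℝ) = 1 :=
        Complex.ofReal_injective (h.trans Complex.ofReal_one.symm)
      linarith
  refine h5.frequently (Eventually.of_forall fun n => ?_).frequently
  have hr : (0 : ℝ) < 1 + 1 / ((n : ℝ) + 1) := by positivity
  have h8 := Complex.integral_cpow_mul_exp_neg_mul_Ioi (a := β + 1)
    (by simpa using by linarith) hr
  rw [inv_eq_one_div, ← h8]
  refine integral_congr_ae (Eventually.of_forall fun v => ?_)
  simp only [add_sub_cancel_right, neg_mul]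
  rw [mul_comm]

theorem wedgeRay_zero {θ φ : ℝ} (hθ : 0 < Real.sin θ) (hφ : φ ∈ Ioc (-Real.pi) Real.pi)
    (h : Complex.exp (φ * Complex.I) * rayExponent θ = 1) {β : ℂ} (hβ : -1 < β.re) :
    wedgeRay θ 0 β = Complex.exp ((β + 1) * ((θ + φ) * Complex.I)) * Complex.Gamma (β + 1) := by
  have hμ : 0 < (rayExponent θ).re := by rwa [rayExponent_re]
  have h2 : (rayExponent θ)⁻¹ = Complex.exp (φ * Complex.I) := by
    exact inv_eq_of_mul_eq_one_left h
  have h3 : Complex.log (Complex.exp (φ * Complex.I)) = φ * Complex.I :=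
    Complex.log_exp (by simpa using hφ.1) (by simpa using hφ.2)
  rw [wedgeRay, integral_cexp_neg_mul_cpow hβ hμ, h2,
    Complex.cpow_def_of_ne_zero (Complex.exp_ne_zero _), h3, ← mul_assoc, ← Complex.exp_add]
  congr 2
  ring

theorem tendsto_wedgeRay {θ : ℝ} (hθ : 0 < Real.sin θ) {β : ℂ} (hβ : -1 < β.re) :
    Tendsto (fun σ => wedgeRay θ σ β) (𝓝[>] 0) (𝓝 (wedgeRay θ 0 β)) := by
  have hμ : 0 < (rayExponent θ).re := by rwa [rayExponent_re]
  have := IntegrableOn.continuousWithinAt_Ici_primitive_Ioi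
    (integrableOn_cexp_mul_cpow (β := β) hμ le_rfl (Or.inr hβ))
  exact (this.tendsto.mono_left (nhdsWithin_mono _ Ioi_subset_Ici_self)).const_mul _

theorem tendsto_cpow_mul_wedgeArc {θ₀ θ₁ : ℝ} {β : ℂ} (hβ : -1 < β.re) :
    Tendsto (fun σ : ℝ => (σ : ℂ) ^ (β + 1) * wedgeArc σ θ₀ θ₁ β) (𝓝[>] 0) (𝓝 0) := by
  have h1 : Continuous fun σ : ℝ => wedgeArc σ θ₀ θ₁ β := by
    unfold wedgeArc
    refine intervalIntegral.continuous_parametric_intervalIntegral_of_continuous' ?_ _ _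
    fun_prop
  have h2 : Tendsto (fun σ : ℝ => (σ : ℂ) ^ (β + 1)) (𝓝[>] 0) (𝓝 0) := by
    rw [tendsto_zero_iff_norm_tendsto_zero]
    have h3 : ContinuousAt (fun σ : ℝ => σ ^ (β.re + 1)) 0 :=
      Real.continuousAt_rpow_const _ _ (Or.inr (by linarith))
    have h4 := h3.tendsto
    rw [Real.zero_rpow (by linarith)] at h4
    refine (h4.mono_left nhdsWithin_le_nhds).congr' ?_
    filter_upwards [self_mem_nhdsWithin] with σ hσ
    rw [Complex.norm_cpow_eq_rpow_re_of_pos hσ]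
    simp
  simpa using h2.mul ((h1.tendsto 0).mono_left nhdsWithin_le_nhds)

/-- As σ → 0 the arc disappears, because σ^{β+1} → 0, and the rays become Gamma integrals. Rotating
their exponents to 1 produces the total angles π/2 and -3π/2, the two edges of the cut. -/
theorem wedgeConst_eq_of_re {β : ℂ} (hβ : -1 < β.re) :
    wedgeConst β = (Complex.exp ((β + 1) * (Real.pi / 2 * Complex.I))
      - Complex.exp (-(β + 1) * (3 * Real.pi / 2 * Complex.I))) * Complex.Gamma (β + 1) := by
  have hpi := Real.pi_pos
  have h1 := ((tendsto_wedgeRay sin_wedge_right hβ).sub (tendsto_wedgeRay sin_wedge_left hβ)).add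
    (tendsto_cpow_mul_wedgeArc (θ₀ := -(5 * Real.pi / 4)) (θ₁ := Real.pi / 4) hβ)
  have h2 : ∀ᶠ σ in 𝓝[>] (0 : ℝ), wedgeConst β = wedgeRay (Real.pi / 4) σ β
      - wedgeRay (-(5 * Real.pi / 4)) σ β
      + (σ : ℂ) ^ (β + 1) * wedgeArc σ (-(5 * Real.pi / 4)) (Real.pi / 4) β := by
    filter_upwards [Ioo_mem_nhdsGT one_pos] with σ hσ
    exact wedgeConst_eq_shrink hσ.1 hσ.2.le
  have h3 := tendsto_nhds_unique (tendsto_const_nhds.congr' h2) h1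
  have e1 : Complex.exp (((Real.pi / 4 : ℝ) : ℂ) * Complex.I) * rayExponent (Real.pi / 4) = 1 := by
    rw [rayExponent, mul_neg, mul_left_comm, ← Complex.exp_add,
      show ((Real.pi / 4 : ℝ) : ℂ) * Complex.I + ((Real.pi / 4 : ℝ) : ℂ) * Complex.I
        = Real.pi / 2 * Complex.I by push_cast; ring, Complex.exp_pi_div_two_mul_I,
      Complex.I_mul_I, neg_neg]
  have e2 : Complex.exp (((-(Real.pi / 4) : ℝ) : ℂ) * Complex.I)
      * rayExponent (-(5 * Real.pi / 4)) = 1 := by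
    rw [rayExponent, mul_neg, mul_left_comm, ← Complex.exp_add,
      show ((-(Real.pi / 4) : ℝ) : ℂ) * Complex.I + ((-(5 * Real.pi / 4) : ℝ) : ℂ) * Complex.I
        = Real.pi / 2 * Complex.I - 2 * Real.pi * Complex.I by push_cast; ring,
      Complex.exp_sub, Complex.exp_pi_div_two_mul_I, Complex.exp_two_pi_mul_I, div_one,
      Complex.I_mul_I, neg_neg]
  rw [h3, add_zero, wedgeRay_zero sin_wedge_right ⟨by linarith, by linarith⟩ e1 hβ,
    wedgeRay_zero sin_wedge_left ⟨by linarith, by linarith⟩ e2 hβ, ← sub_mul]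
  congr 3 <;> push_cast <;> ring_nf

/-- The difference of the two exponentials is 2i e^{-(β+1)πi/2} sin(π(β+1)), and Euler's reflection
formula converts sin · Γ(β+1) into π/Γ(-β). Both sides are entire, so agreement for Re β > -1
extends to all β. -/
theorem wedgeConst_eq (β : ℂ) :
    wedgeConst β = 2 * Real.pi * Complex.I * Complex.exp (-(β + 1) * (Real.pi / 2 * Complex.I))
      * (Complex.Gamma (-β))⁻¹ := by
  have hG : Differentiable ℂ fun β : ℂ => 2 * Real.pi * Complex.I
      * Complex.exp (-(β + 1) * (Real.pi / 2 * Complex.I)) * (Complex.Gamma (-β))⁻¹ :=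
    Differentiable.mul (by fun_prop)
      (Complex.differentiable_one_div_Gamma.comp differentiable_neg)
  have h1 : ∀ β : ℂ, -1 < β.re → wedgeConst β = 2 * Real.pi * Complex.I
      * Complex.exp (-(β + 1) * (Real.pi / 2 * Complex.I)) * (Complex.Gamma (-β))⁻¹ :=
      fun β hβ => by
    have hsin : Complex.exp ((β + 1) * (Real.pi / 2 * Complex.I))
        - Complex.exp (-(β + 1) * (3 * Real.pi / 2 * Complex.I))
        = 2 * Complex.I * Complex.exp (-(β + 1) * (Real.pi / 2 * Complex.I))
          * Complex.sin (Real.pi * (β + 1)) := by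
      rw [Complex.sin]
      have e1 : Complex.exp ((β + 1) * (Real.pi / 2 * Complex.I))
          = Complex.exp (-(β + 1) * (Real.pi / 2 * Complex.I))
            * Complex.exp (Real.pi * (β + 1) * Complex.I) := by
        rw [← Complex.exp_add]
        ring_nf
      have e2 : Complex.exp (-(β + 1) * (3 * Real.pi / 2 * Complex.I))
          = Complex.exp (-(β + 1) * (Real.pi / 2 * Complex.I))
            * Complex.exp (-(Real.pi * (β + 1)) * Complex.I) := by
        rw [← Complex.exp_add]
        ring_nf
      rw [e1, e2]
      linear_combination (-(Complex.exp (-(β + 1) * (Real.pi / 2 * Complex.I))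
        * Complex.exp (-(Real.pi * (β + 1)) * Complex.I))
        + Complex.exp (-(β + 1) * (Real.pi / 2 * Complex.I))
        * Complex.exp (Real.pi * (β + 1) * Complex.I)) * Complex.I_sq
    have hrefl := Complex.Gamma_mul_Gamma_one_sub (β + 1)
    rw [show 1 - (β + 1) = -β by ring] at hrefl
    have hΓ : Complex.Gamma (β + 1) ≠ 0 :=
      Complex.Gamma_ne_zero_of_re_pos (by simpa using by linarith)
    rw [wedgeConst_eq_of_re hβ, hsin]
    -- At a zero of the sine -β is a pole of Γ. The reflection formula there reads 0 by the
    -- convention for division by zero and forces the assigned value Γ(-β) = 0, so both sides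
    -- vanish.
    by_cases h0 : Complex.sin (Real.pi * (β + 1)) = 0
    · rw [h0, div_zero] at hrefl
      rw [h0, (mul_eq_zero.1 hrefl).resolve_left hΓ]
      simp
    · have hΓ' : Complex.Gamma (-β) ≠ 0 := fun h => by
        rw [h, mul_zero, eq_comm, div_eq_zero_iff] at hrefl
        exact hrefl.elim (by exact_mod_cast Real.pi_ne_zero) h0
      rw [eq_div_iff h0] at hrefl
      rw [eq_mul_inv_iff_mul_eq₀ hΓ']
      linear_combination 2 * Complex.I
        * Complex.exp (-(β + 1) * (Real.pi / 2 * Complex.I)) * hrefl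
  have h2 := AnalyticOnNhd.eq_of_eventuallyEq (z₀ := 0)
    (Complex.analyticOnNhd_univ_iff_differentiable.2 differentiable_wedgeConst)
    (Complex.analyticOnNhd_univ_iff_differentiable.2 hG) (by
      have : {β : ℂ | -1 < β.re} ∈ 𝓝 (0 : ℂ) :=
        (isOpen_lt continuous_const Complex.continuous_re).mem_nhds (by simp)
      filter_upwards [this] with β hβ using h1 β hβ)
  exact congrFun h2 β

theorem norm_wedgeConst (β : ℂ) :
    ‖wedgeConst β‖ = 2 * Real.pi * Real.exp (Real.pi / 2 * β.im) / ‖Complex.Gamma (-β)‖ := by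
  have h : (-(β + 1) * ((Real.pi : ℂ) / 2 * Complex.I)).re = Real.pi / 2 * β.im := by
    rw [show (Real.pi : ℂ) / 2 = ((Real.pi / 2 : ℝ) : ℂ) by push_cast; rfl]
    simp [-Complex.ofReal_div]
    ring
  rw [wedgeConst_eq, norm_mul, norm_mul, norm_mul, norm_mul, Complex.norm_exp, h, norm_inv]
  simp [abs_of_pos Real.pi_pos, div_eq_mul_inv]

/-! ### Asymptotics of the transforms for large `x` -/

/-- The function `f` times an oscillating kernel centred at `p`. -/
def kernelMul (p : ℂ) (f : ℂ → ℂ) (y : ℝ) (r : ℂ) : ℂ :=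
  Complex.exp (Complex.I * (y * (r - p))) * f r

/-- Beyond ρ the integrand is at most a constant times e^{-ρy}e^{-t} once y ≥ Y + 1, and e^{-ρy}
beats every power of y. -/
theorem tendsto_cpow_mul_integral_tail {f : ℝ → ℂ} {ρ C Y : ℝ} (hρ : 0 < ρ)
    (hf : ∀ t > 0, ‖f t‖ ≤ C * Real.exp (Y * t)) (β : ℂ) :
    Tendsto (fun y : ℝ => (y : ℂ) ^ β * ∫ t in Ioi ρ, Complex.exp (-(y * t)) * f t) atTop
      (𝓝 0) := by
  set K : ℝ := ∫ t in Ioi ρ, Real.exp (-1 * t) with hK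
  have hint : IntegrableOn (fun t : ℝ => Real.exp (-1 * t)) (Ioi ρ) := by
    simpa using exp_neg_integrableOn_Ioi ρ one_pos
  have hC : 0 ≤ C := by
    by_contra hC
    have := mul_neg_of_neg_of_pos (not_le.1 hC) (Real.exp_pos (Y * 1))
    linarith [norm_nonneg (f 1), hf 1 one_pos]
  have h1 : Tendsto (fun y : ℝ => (y ^ β.re * Real.exp (-ρ * y))
      * (C * Real.exp ((Y + 1) * ρ) * K)) atTop (𝓝 0) := by
    simpa using (tendsto_rpow_mul_exp_neg_mul_atTop_nhds_zero β.re ρ hρ).mul_const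
      (C * Real.exp ((Y + 1) * ρ) * K)
  refine squeeze_zero_norm' ?_ h1
  filter_upwards [eventually_gt_atTop 0, eventually_ge_atTop (Y + 1)] with y hy hy'
  rw [norm_mul, Complex.norm_cpow_eq_rpow_re_of_pos hy, mul_assoc]
  refine mul_le_mul_of_nonneg_left ?_ (Real.rpow_nonneg hy.le _)
  have h2 : ∀ᵐ t : ℝ ∂volume.restrict (Ioi ρ), ‖Complex.exp (-(y * t)) * f t‖
      ≤ Real.exp (-ρ * y) * (C * Real.exp ((Y + 1) * ρ)) * Real.exp (-1 * t) := by
    filter_upwards [ae_restrict_mem measurableSet_Ioi] with t ht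
    have ht' : ρ < t := ht
    rw [norm_mul, Complex.norm_exp]
    have h3 : (-((y : ℂ) * t)).re = -(y * t) := by simp
    rw [h3]
    calc Real.exp (-(y * t)) * ‖f t‖ ≤ Real.exp (-(y * t)) * (C * Real.exp (Y * t)) := by
          gcongr
          exact hf t (hρ.trans ht')
      _ = C * Real.exp (-(y * t) + Y * t) := by rw [Real.exp_add]; ring
      _ ≤ C * Real.exp (-ρ * y + (Y + 1) * ρ + -1 * t) := by
          refine mul_le_mul_of_nonneg_left (Real.exp_le_exp.2 ?_) hC
          nlinarith [mul_nonneg (sub_nonneg.2 hy') (sub_nonneg.2 ht'.le)]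
      _ = _ := by rw [Real.exp_add, Real.exp_add]; ring
  refine (norm_integral_le_of_norm_le (hint.const_mul _) h2).trans (le_of_eq ?_)
  rw [integral_const_mul]
  ring

namespace TeukolskyParams

variable {P : TeukolskyParams}

/-- The frequency is i times a real number, so recentring the phase from r₋ to r₊ costs a factor of
modulus one. The norms then depend on x only through y = `P.rate x`. -/
theorem transformIntegrand_eq_kernelMul (c : ℂ) (R : ℂ → ℂ) (x : ℝ) :
    P.transformIntegrand c R x = fun r =>
      Complex.exp (((P.rate x * (P.rp - P.rm) : ℝ) : ℂ) * Complex.I)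
        * kernelMul P.rp (fun r => P.weight c r * R r) (P.rate x) r := by
  funext r
  have h : Complex.exp (P.freq x * (r - P.rm))
      = Complex.exp (((P.rate x * (P.rp - P.rm) : ℝ) : ℂ) * Complex.I)
        * Complex.exp (Complex.I * (P.rate x * (r - P.rp))) := by
    rw [← Complex.exp_add, freq_eq]
    congr 1
    push_cast
    ring
  rw [transformIntegrand_eq, kernelMul, h, mul_assoc]

theorem tendsto_rate (hM : |P.a| < P.M) (hω : 0 < P.ω) : Tendsto P.rate atTop atTop := by
  have h : P.rate = fun x => 2 * P.ω / (P.rp - P.rm) * (x - P.rm) := by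
    funext x
    rw [rate]
    ring
  rw [h]
  exact (tendsto_atTop_add_const_right _ _ tendsto_id).const_mul_atTop
    (div_pos (by linarith) (rp_sub_rm_pos hM))

theorem tendsto_sqrt_div (P : TeukolskyParams) :
    Tendsto (fun x : ℝ => √(x ^ 2 + P.a ^ 2) / (x - P.rm)) atTop (𝓝 1) := by
  have hw : Tendsto (fun x : ℝ => (x - P.rm)⁻¹) atTop (𝓝 0) :=
    tendsto_inv_atTop_zero.comp (tendsto_atTop_add_const_right _ _ tendsto_id)
  have h1 : Tendsto (fun x : ℝ => √((1 + P.rm * (x - P.rm)⁻¹) ^ 2 + (P.a * (x - P.rm)⁻¹) ^ 2))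
      atTop (𝓝 (√((1 + P.rm * 0) ^ 2 + (P.a * 0) ^ 2))) :=
    ((((hw.const_mul _).const_add 1).pow 2).add ((hw.const_mul _).pow 2)).sqrt
  rw [show √((1 + P.rm * 0) ^ 2 + (P.a * 0) ^ 2) = 1 by norm_num] at h1
  refine h1.congr' ?_
  filter_upwards [eventually_gt_atTop P.rm] with x hx
  have hx' : 0 < x - P.rm := sub_pos.2 hx
  rw [Real.sqrt_eq_iff_mul_self_eq (by positivity) (by positivity), div_mul_div_comm,
    Real.mul_self_sqrt (by positivity)]
  field_simp
  ring

/-- The oscillating factors of U have modulus one and the square root behaves like x - r₋. What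
remains is (x - r₋)^{1-s}|g|, and x - r₋ = y(r₊ - r₋)/(2ω) yields the constant. -/
theorem tendsto_norm_toU (hM : |P.a| < P.M) (hω : 0 < P.ω) {g : ℝ → ℂ} {g' : ℝ → ℂ}
    (hg : ∀ x > P.rp, ‖g x‖ = ‖g' (P.rate x)‖) {β N : ℂ} (hβ : β.re = -P.s)
    (hlim : Tendsto (fun y : ℝ => (y : ℂ) ^ (β + 1) * g' y) atTop (𝓝 N)) :
    Tendsto (fun x : ℝ => ‖P.toU g x‖) atTop
      (𝓝 (((P.rp - P.rm) / (2 * P.ω)) ^ (1 - P.s) * ‖N‖)) := by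
  have h1 := (P.tendsto_sqrt_div.mul_const (((P.rp - P.rm) / (2 * P.ω)) ^ (1 - P.s))).mul
    (hlim.norm.comp (tendsto_rate hM hω))
  rw [one_mul] at h1
  refine h1.congr' ?_
  filter_upwards [eventually_gt_atTop P.rp] with x hx
  have hd := rp_sub_rm_pos hM
  have hx1 : 0 < x - P.rm := by linarith
  have hx2 : 0 < x - P.rp := sub_pos.2 hx
  have hr : 0 < P.rate x := (by linarith : 0 < 2 * P.ω).trans (two_ω_lt_rate hM hω hx)
  have e1 : (β + 1).re = 1 - P.s := by
    rw [Complex.add_re, hβ, Complex.one_re]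
    ring
  have e2 : ((P.rp - P.rm) / (2 * P.ω)) ^ (1 - P.s) * P.rate x ^ (1 - P.s)
      = (x - P.rm) * (x - P.rm) ^ (-P.s) := by
    rw [← Real.mul_rpow (by positivity) hr.le, rate, sub_eq_add_neg 1, Real.rpow_add (by
      have : P.rp - P.rm ≠ 0 := hd.ne'
      positivity)]
    have : (P.rp - P.rm) / (2 * P.ω) * (2 * P.ω * (x - P.rm) / (P.rp - P.rm)) = x - P.rm := by
      field_simp
    rw [this, Real.rpow_one]
  have e3 : (-2 * Complex.I * P.M * P.ω).re = 0 := by simp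
  have e4 : (-Complex.I * P.ω * x).re = 0 := by simp
  rw [Function.comp, norm_mul, Complex.norm_cpow_eq_rpow_re_of_pos hr, e1, toU, norm_mul, norm_mul,
    norm_mul, norm_mul, Complex.norm_cpow_eq_rpow_re_of_pos hx1,
    Complex.norm_cpow_eq_rpow_re_of_pos hx2, e3, Complex.norm_exp, e4, hg x hx, Real.rpow_zero,
    Real.exp_zero, Complex.norm_of_nonneg (Real.sqrt_nonneg _), Complex.neg_re, Complex.ofReal_re]
  calc _ = √(x ^ 2 + P.a ^ 2) / (x - P.rm) * (((P.rp - P.rm) / (2 * P.ω)) ^ (1 - P.s)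
      * P.rate x ^ (1 - P.s)) * ‖g' (P.rate x)‖ := by ring
    _ = _ := by
      rw [e2]
      field_simp

/-- At the horizon the weighted solution behaves like a power. -/
theorem tendsto_weight_mul (hM : |P.a| < P.M) {c : ℂ} {R H : ℂ → ℂ} {f : ℂ}
    (hH : Tendsto H (𝓝[P.cutDomain c] (P.rp : ℂ)) (𝓝 f))
    (hR : ∀ᶠ r in 𝓝[P.cutDomain c] (P.rp : ℂ),
        R r = branchPow c (r - P.rp) (P.xi - P.s / 2) * H r) :
    Tendsto (fun r => branchPow c (r - P.rp) (-(2 * P.xi - P.s)) * (P.weight c r * R r))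
      (𝓝[P.cutDomain c] (P.rp : ℂ)) (𝓝 (P.regularWeight P.rp * f)) := by
  have h1 := ((continuousAt_regularWeight hM).tendsto.mono_left
    (nhdsWithin_le_nhds (s := P.cutDomain c))).mul hH
  refine h1.congr' ?_
  filter_upwards [hR] with r hr
  rw [hr, weight_mul_eq, ← mul_assoc, ← branchPow_add, neg_add_cancel, branchPow, zero_mul,
    Complex.exp_zero, one_mul]

theorem expType_weight_mul (hM : |P.a| < P.M) (hω : 0 < P.ω) {c : ℂ} (hc : ‖c‖ = 1) {R : ℂ → ℂ}
    (hR : P.IsRadialSolution c R) {z : ℂ}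
    (hz : ∀ t : ℝ, 0 < t → z + t * Complex.I ∈ P.cutDomain c) :
    ExpType (fun t => P.weight c (z + t * Complex.I) * R (z + t * Complex.I)) (P.ω + P.ω) :=
  (expType_weight hc z hz).mul (hR.expType_line hM hω hz).1

theorem continuousOn_branchPow_sub (c : ℂ) (β : ℂ) :
    ContinuousOn (fun r => branchPow c (r - P.rp) β) (P.cutDomain c) := fun r hr =>
  ((branchPow_hasDerivAt β hr.2).comp_sub_const r (P.rp : ℂ)).continuousAt.continuousWithinAt

/-- On r = r₊ + it the kernel is e^{-yt}, and (it)^β = i^β t^β. Watson's lemma with μ = 1 and σ = 0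
applies because Re β = -s > -1. -/
theorem tendsto_euler_kernel (hM : |P.a| < P.M) (hω : 0 < P.ω) (hs : P.s ≤ 0) {R : ℂ → ℂ}
    (hR : P.IsRadialSolution 1 R) {G₀ : ℂ}
    (hG : Tendsto (fun r => branchPow 1 (r - P.rp) (-(2 * P.xi - P.s)) * (P.weight 1 r * R r))
      (𝓝[P.cutDomain 1] (P.rp : ℂ)) (𝓝 G₀)) :
    Tendsto (fun y : ℝ => (y : ℂ) ^ (2 * P.xi - P.s + 1)
      * verticalIntegral (kernelMul P.rp (fun r => P.weight 1 r * R r) y) P.rp) atTop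
      (𝓝 (Complex.I * branchPow 1 Complex.I (2 * P.xi - P.s)
        * (G₀ * Complex.Gamma (2 * P.xi - P.s + 1)))) := by
  set β := 2 * P.xi - P.s with hβ
  set G : ℂ → ℂ := fun r => branchPow 1 (r - P.rp) (-β) * (P.weight 1 r * R r) with hGdef
  have hβre : -1 < β.re := by
    have : β.re = -P.s := by simp [hβ, xi_re]
    rw [this]
    linarith
  have hmem : ∀ t : ℝ, 0 < t → (P.rp : ℂ) + t * Complex.I ∈ P.cutDomain 1 := fun t ht =>
    vertical_rp_mem hM ht
  set g : ℝ → ℂ := fun t => G (P.rp + t * Complex.I) with hg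
  have hline : Continuous fun t : ℝ => (P.rp : ℂ) + t * Complex.I := by fun_prop
  have hcont : ContinuousOn g (Ioi 0) :=
    ((continuousOn_branchPow_sub 1 (-β)).mul (hR.continuousOn_weight_mul hM)).comp
      hline.continuousOn fun t ht => hmem t ht
  have hlim : Tendsto g (𝓝[>] 0) (𝓝 G₀) := hG.comp (tendsto_vertical_rp hM)
  have hexp : ExpType g (0 + (P.ω + P.ω)) := by
    have h := (ExpType.branchPow norm_one (P.rp - P.rp : ℂ) (-β)).mul
      (expType_weight_mul hM hω norm_one hR hmem)
    have e : g = fun t : ℝ => branchPow 1 (P.rp - P.rp + t * Complex.I) (-β)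
        * (P.weight 1 (P.rp + t * Complex.I) * R (P.rp + t * Complex.I)) := funext fun t => by
      simp only [hg, hGdef]
      congr 2
      ring
    rwa [e]
  obtain ⟨C, hC⟩ := hexp.exists_bound hcont hlim
  have hind : EqOn ((Ioi 0).indicator g) g (Ioi 0) := fun t ht => indicator_of_mem ht g
  have hW := watson_lemma (β := β) (μ := 1) (by simp) le_rfl (Or.inr hβre)
    (h := (Ioi 0).indicator g) (h₀ := G₀)
    ((aestronglyMeasurable_indicator_iff measurableSet_Ioi).2
      (hcont.aestronglyMeasurable measurableSet_Ioi))
    (fun u hu => by rw [hind hu]; exact hC u hu)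
    (hlim.congr' (eventually_mem_nhdsWithin.mono fun t ht => (hind ht).symm))
  rw [integral_cexp_neg_mul_cpow hβre (by simp), inv_one, Complex.one_cpow, one_mul] at hW
  refine (hW.const_mul (Complex.I * branchPow 1 Complex.I β)).congr fun y => ?_
  rw [verticalIntegral, zero_div, mul_left_comm, ← integral_const_mul]
  congr 1
  refine setIntegral_congr_fun measurableSet_Ioi fun t ht => ?_
  have e1 : branchPow 1 (t * Complex.I) β = (t : ℂ) ^ β * branchPow 1 Complex.I β :=
    branchPow_ofReal_mul one_ne_zero Complex.I_ne_zero ht β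
  have e2 : branchPow 1 (t * Complex.I) β * branchPow 1 (t * Complex.I) (-β) = 1 := by
    rw [← branchPow_add, add_neg_cancel, branchPow, zero_mul, Complex.exp_zero]
  have e3 : Complex.I * ((y : ℂ) * (t * Complex.I)) = -1 * (y * t) := by
    linear_combination (y * t : ℂ) * Complex.I_sq
  rw [hind ht]
  simp only [hg, hGdef, kernelMul, add_sub_cancel_left, e3]
  rw [e1] at e2
  linear_combination (Complex.I * Complex.exp (-1 * (y * t))
    * (P.weight 1 (P.rp + t * Complex.I) * R (P.rp + t * Complex.I))) * e2

/-- The centre r₊ - i lies opposite the upward cut: there i(r - r₊) = 1, about which the slit plane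
is star-shaped. -/
theorem starConvex_cutDomain (hM : |P.a| < P.M) :
    StarConvex ℝ ((P.rp : ℂ) - Complex.I) (P.cutDomain Complex.I) := by
  intro z hz a b ha hb hab
  have hre : (a • ((P.rp : ℂ) - Complex.I) + b • z).re = a * P.rp + b * z.re := by simp
  have hab' : (a : ℂ) + b = 1 := by exact_mod_cast hab
  have hI : Complex.I * (a • ((P.rp : ℂ) - Complex.I) + b • z - P.rp)
      = a • (1 : ℂ) + b • (Complex.I * (z - P.rp)) := by
    simp only [Complex.real_smul]
    linear_combination (-(a : ℂ)) * Complex.I_sq + Complex.I * P.rp * hab'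
  refine ⟨?_, ?_⟩
  · rw [hre]
    have h1 := rm_lt_rp hM
    have h2 := hz.1
    have : a * P.rm + b * P.rm = P.rm := by rw [← add_mul, hab, one_mul]
    rcases eq_or_lt_of_le ha with h | h
    · subst h
      have : b = 1 := by linarith
      subst this
      linarith
    · nlinarith
  · rw [hI]
    exact Complex.starConvex_one_slitPlane hz.2 ha hb hab

theorem polar_mem_cutDomain {θ u : ℝ} (h1 : -(3 * Real.pi / 2) < θ) (h2 : θ < Real.pi / 2)
    (hu : 0 < u) (hre : -(u * Real.cos θ) < P.rp - P.rm) :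
    (P.rp : ℂ) + u * Complex.exp (θ * Complex.I) ∈ P.cutDomain Complex.I := by
  refine ⟨?_, ?_⟩
  · have : ((P.rp : ℂ) + u * Complex.exp (θ * Complex.I)).re = P.rp + u * Real.cos θ := by
      simp [Complex.exp_ofReal_mul_I_re]
    linarith
  · rw [add_sub_cancel_left]
    exact I_mul_polar_mem_slitPlane h1 h2 hu

theorem kernelMul_polar {f : ℂ → ℂ} {θ u : ℝ} (h1 : -(3 * Real.pi / 2) < θ)
    (h2 : θ < Real.pi / 2) (hu : 0 < u) (β : ℂ) (y : ℝ) :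
    kernelMul P.rp f y (P.rp + u * Complex.exp (θ * Complex.I))
      = Complex.exp (Complex.I * (y * (u * Complex.exp (θ * Complex.I))))
        * ((u : ℂ) ^ β * Complex.exp (β * (θ * Complex.I))
        * (branchPow Complex.I (P.rp + u * Complex.exp (θ * Complex.I) - P.rp) (-β)
          * f (P.rp + u * Complex.exp (θ * Complex.I)))) := by
  have h : branchPow Complex.I (u * Complex.exp (θ * Complex.I)) β
      * branchPow Complex.I (u * Complex.exp (θ * Complex.I)) (-β) = 1 := by
    rw [← branchPow_add, add_neg_cancel, branchPow, zero_mul, Complex.exp_zero]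
  rw [← branchPow_I_polar h1 h2 hu, kernelMul, add_sub_cancel_left]
  linear_combination (-(Complex.exp (Complex.I * (y * (u * Complex.exp (θ * Complex.I))))
    * f (P.rp + u * Complex.exp (θ * Complex.I)))) * h

theorem tendsto_polar (hM : |P.a| < P.M) {θ : ℝ} (h1 : -(3 * Real.pi / 2) < θ)
    (h2 : θ < Real.pi / 2) :
    Tendsto (fun u : ℝ => (P.rp : ℂ) + u * Complex.exp (θ * Complex.I)) (𝓝[>] 0)
      (𝓝[P.cutDomain Complex.I] (P.rp : ℂ)) := by
  refine tendsto_nhdsWithin_iff.2 ⟨?_, ?_⟩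
  · have : Continuous fun u : ℝ => (P.rp : ℂ) + u * Complex.exp (θ * Complex.I) := by fun_prop
    simpa using (this.tendsto 0).mono_left nhdsWithin_le_nhds
  · filter_upwards [Ioo_mem_nhdsGT (rp_sub_rm_pos hM)] with u hu
    refine polar_mem_cutDomain h1 h2 hu.1 ?_
    nlinarith [Real.neg_one_le_cos θ, hu.1, hu.2]

/-- Watson's lemma with σ = 1 applied to the integrand truncated at l. The positive sine is the
decay rate along the tilted ray. -/
theorem tendsto_ray (hM : |P.a| < P.M) {f : ℂ → ℂ} {β G₀ : ℂ}
    (hf : ContinuousOn f (P.cutDomain Complex.I))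
    (hG : Tendsto (fun r => branchPow Complex.I (r - P.rp) (-β) * f r)
      (𝓝[P.cutDomain Complex.I] (P.rp : ℂ)) (𝓝 G₀)) {θ l : ℝ} (h1 : -(3 * Real.pi / 2) < θ)
    (h2 : θ < Real.pi / 2) (hsin : 0 < Real.sin θ) (hl : 0 < l)
    (hmem : ∀ u ∈ Ioc 0 l, (P.rp : ℂ) + u * Complex.exp (θ * Complex.I) ∈ P.cutDomain Complex.I) :
    Tendsto (fun y : ℝ => (y : ℂ) ^ (β + 1) * ∫ u in (1 / y)..l, Complex.exp (θ * Complex.I)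
      * kernelMul P.rp f y (P.rp + u * Complex.exp (θ * Complex.I))) atTop
      (𝓝 (G₀ * wedgeRay θ 1 β)) := by
  set g : ℝ → ℂ := fun u => branchPow Complex.I (P.rp + u * Complex.exp (θ * Complex.I) - P.rp) (-β)
    * f (P.rp + u * Complex.exp (θ * Complex.I)) with hg
  have hμ : 0 < (rayExponent θ).re := by rwa [rayExponent_re]
  have hline : Continuous fun u : ℝ => (P.rp : ℂ) + u * Complex.exp (θ * Complex.I) := by fun_prop
  have hcont : ContinuousOn g (Ioc 0 l) :=
    ((continuousOn_branchPow_sub Complex.I (-β)).mul hf).comp hline.continuousOn hmem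
  have hlim : Tendsto g (𝓝[>] 0) (𝓝 G₀) := hG.comp (tendsto_polar hM h1 h2)
  obtain ⟨C, hC⟩ := exists_bound_Ioc hcont hlim
  have hC0 : 0 ≤ C := (norm_nonneg _).trans (hC l ⟨hl, le_rfl⟩)
  have hind : ∀ u ∈ Ioc 0 l, (Ioc 0 l).indicator g u = g u := fun u hu => indicator_of_mem hu g
  have hW := watson_lemma (β := β) hμ zero_le_one (Or.inl one_pos) (h := (Ioc 0 l).indicator g)
    (h₀ := G₀) (C := C) (Y := 0) ((aestronglyMeasurable_indicator_iff measurableSet_Ioc).2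
      (hcont.aestronglyMeasurable measurableSet_Ioc))
    (fun u _ => by
      rw [zero_mul, Real.exp_zero, mul_one]
      by_cases hu : u ∈ Ioc 0 l
      · rw [hind u hu]
        exact hC u hu
      · rwa [indicator_of_notMem hu, norm_zero])
    (hlim.congr' (by
      filter_upwards [Ioc_mem_nhdsGT hl] with u hu using (hind u hu).symm))
  have hW' := hW.const_mul (Complex.exp ((β + 1) * (θ * Complex.I)))
  rw [wedgeRay, mul_left_comm]
  refine hW'.congr' ?_
  filter_upwards [eventually_gt_atTop 0, eventually_ge_atTop (1 / l)] with y hy hyl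
  have hyl' : 1 / y ≤ l := by
    rw [div_le_iff₀ hl] at hyl
    rw [div_le_iff₀ hy]
    linarith
  have h0 : 0 < 1 / y := by positivity
  rw [mul_left_comm, ← integral_const_mul, intervalIntegral.integral_of_le hyl',
    ← integral_indicator measurableSet_Ioi, ← integral_indicator measurableSet_Ioc]
  congr 2
  funext u
  by_cases hu : u ∈ Ioc (1 / y) l
  · have hu0 : u ∈ Ioc 0 l := ⟨h0.trans hu.1, hu.2⟩
    rw [indicator_of_mem hu, indicator_of_mem (show u ∈ Ioi (1 / y) from hu.1), hind u hu0,
      kernelMul_polar h1 h2 hu0.1 β]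
    have e : -rayExponent θ * (y * u) = Complex.I * (y * (u * Complex.exp (θ * Complex.I))) := by
      rw [rayExponent]
      ring
    rw [e, add_mul, one_mul, Complex.exp_add]
    ring
  · rw [indicator_of_notMem hu]
    by_cases hu' : u ∈ Ioi (1 / y)
    · have : u ∉ Ioc 0 l := fun h => hu ⟨hu', h.2⟩
      rw [indicator_of_mem hu', indicator_of_notMem this]
      ring
    · rw [indicator_of_notMem hu']

/-- On the arc of radius 1/y the powers of y cancel exactly and the kernel no longer depends on y;
only G varies, and it tends to G₀ while staying bounded uniformly in the angle. -/
theorem tendsto_arc (hM : |P.a| < P.M) {f : ℂ → ℂ} {β G₀ : ℂ}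
    (hf : ContinuousOn f (P.cutDomain Complex.I))
    (hG : Tendsto (fun r => branchPow Complex.I (r - P.rp) (-β) * f r)
      (𝓝[P.cutDomain Complex.I] (P.rp : ℂ)) (𝓝 G₀)) {θ₀ θ₁ : ℝ} (h1 : -(3 * Real.pi / 2) < θ₀)
    (h2 : θ₁ < Real.pi / 2) (hθ : θ₀ ≤ θ₁) :
    Tendsto (fun y : ℝ => (y : ℂ) ^ (β + 1) * ∫ θ in θ₀..θ₁,
      ((1 / y : ℝ) : ℂ) * (Complex.I * Complex.exp (θ * Complex.I))
      * kernelMul P.rp f y (P.rp + ((1 / y : ℝ) : ℂ) * Complex.exp (θ * Complex.I))) atTop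
      (𝓝 (G₀ * wedgeArc 1 θ₀ θ₁ β)) := by
  set G : ℂ → ℂ := fun r => branchPow Complex.I (r - P.rp) (-β) * f r with hGdef
  set w : ℝ → ℂ := fun θ => Complex.exp (β * (θ * Complex.I))
    * (Complex.I * Complex.exp (θ * Complex.I)
      * Complex.exp (Complex.I * (((1 : ℝ) : ℂ) * Complex.exp (θ * Complex.I)))) with hw
  have hwc : Continuous w := by fun_prop
  have hmemθ : ∀ θ ∈ uIoc θ₀ θ₁, -(3 * Real.pi / 2) < θ ∧ θ < Real.pi / 2 := fun θ h => by
    rw [uIoc_of_le hθ] at h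
    exact ⟨h1.trans h.1, h.2.trans_lt h2⟩
  have hmem : ∀ᶠ y : ℝ in atTop, 0 < y ∧ ∀ θ ∈ Icc θ₀ θ₁,
      (P.rp : ℂ) + ((1 / y : ℝ) : ℂ) * Complex.exp (θ * Complex.I) ∈ P.cutDomain Complex.I := by
    have hd := rp_sub_rm_pos hM
    filter_upwards [eventually_gt_atTop 0, eventually_gt_atTop (1 / (P.rp - P.rm))] with y hy hy'
    refine ⟨hy, fun θ h => polar_mem_cutDomain (h1.trans_le h.1) (h.2.trans_lt h2) (by positivity)
      ?_⟩
    have : 1 / y < P.rp - P.rm := by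
      rw [div_lt_iff₀ hd] at hy'
      rw [div_lt_iff₀ hy]
      linarith
    have h0 : 0 < 1 / y := by positivity
    nlinarith [Real.neg_one_le_cos θ]
  have hb : ∀ᶠ y : ℝ in atTop, ∀ θ ∈ Icc θ₀ θ₁,
      ‖G (P.rp + ((1 / y : ℝ) : ℂ) * Complex.exp (θ * Complex.I))‖ ≤ ‖G₀‖ + 1 := by
    have h3 : ∀ᶠ r in 𝓝[P.cutDomain Complex.I] (P.rp : ℂ), ‖G r‖ < ‖G₀‖ + 1 :=
      hG.norm.eventually (gt_mem_nhds (lt_add_one _))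
    obtain ⟨δ, hδ, hδ'⟩ := Metric.mem_nhdsWithin_iff.1 h3
    filter_upwards [hmem, eventually_gt_atTop (1 / δ)] with y hy hy' θ h
    have h4 : 1 / y < δ := by
      rw [div_lt_iff₀ hδ] at hy'
      rw [div_lt_iff₀ hy.1]
      linarith
    have h5 : (P.rp : ℂ) + ((1 / y : ℝ) : ℂ) * Complex.exp (θ * Complex.I)
        ∈ Metric.ball (P.rp : ℂ) δ := by
      rw [mem_ball_iff_norm, add_sub_cancel_left, norm_mul, Complex.norm_exp_ofReal_mul_I, mul_one,
        Complex.norm_of_nonneg (one_div_pos.2 hy.1).le]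
      exact h4
    exact le_of_lt (hδ' ⟨h5, hy.2 θ h⟩)
  have key : Tendsto (fun y : ℝ => ∫ θ in θ₀..θ₁, w θ
      * G (P.rp + ((1 / y : ℝ) : ℂ) * Complex.exp (θ * Complex.I))) atTop
      (𝓝 (∫ θ in θ₀..θ₁, w θ * G₀)) := by
    refine intervalIntegral.tendsto_integral_filter_of_dominated_convergence
      (fun θ => ‖w θ‖ * (‖G₀‖ + 1)) ?_ ?_ ?_ ?_
    · filter_upwards [hmem] with y hy
      have hline : Continuous fun θ : ℝ =>
        (P.rp : ℂ) + ((1 / y : ℝ) : ℂ) * Complex.exp (θ * Complex.I) := by fun_prop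
      refine (ContinuousOn.aestronglyMeasurable ?_ measurableSet_uIoc)
      refine hwc.continuousOn.mul (((continuousOn_branchPow_sub Complex.I (-β)).mul hf).comp
        hline.continuousOn fun θ h => hy.2 θ ?_)
      rw [uIoc_of_le hθ] at h
      exact Ioc_subset_Icc_self h
    · filter_upwards [hb] with y hy
      refine Eventually.of_forall fun θ h => ?_
      rw [uIoc_of_le hθ] at h
      rw [norm_mul]
      exact mul_le_mul_of_nonneg_left (hy θ (Ioc_subset_Icc_self h)) (norm_nonneg _)
    · exact (hwc.norm.mul continuous_const).intervalIntegrable _ _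
    · refine Eventually.of_forall fun θ h => Tendsto.const_mul _ ?_
      have h6 : Tendsto (fun y : ℝ => 1 / y) atTop (𝓝[>] 0) := by
        simp only [one_div]
        exact tendsto_inv_atTop_nhdsGT_zero
      exact hG.comp ((tendsto_polar hM (hmemθ θ h).1 (hmemθ θ h).2).comp h6)
  rw [intervalIntegral.integral_mul_const, mul_comm] at key
  refine key.congr' ?_
  filter_upwards [eventually_gt_atTop 0] with y hy
  have hy0 : (y : ℂ) ≠ 0 := by exact_mod_cast hy.ne'
  rw [← intervalIntegral.integral_const_mul]
  refine intervalIntegral.integral_congr_ae (Eventually.of_forall fun θ h => ?_)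
  rw [kernelMul_polar (hmemθ θ h).1 (hmemθ θ h).2 (one_div_pos.2 hy) β]
  have e1 : (y : ℂ) * (((1 / y : ℝ) : ℂ) * Complex.exp (θ * Complex.I))
      = ((1 : ℝ) : ℂ) * Complex.exp (θ * Complex.I) := by
    push_cast
    field_simp
  have e2 : (y : ℂ) ^ (β + 1) * (((1 / y : ℝ) : ℂ) * ((1 / y : ℝ) : ℂ) ^ β) = 1 := by
    have e3 : (y : ℂ) ^ β * ((1 / y : ℝ) : ℂ) ^ β = 1 := by
      rw [← Complex.mul_cpow_ofReal_nonneg hy.le (one_div_pos.2 hy).le, ← Complex.ofReal_mul,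
        mul_one_div_cancel hy.ne', Complex.ofReal_one, Complex.one_cpow]
    have e4 : (y : ℂ) * ((1 / y : ℝ) : ℂ) = 1 := by
      rw [← Complex.ofReal_mul, mul_one_div_cancel hy.ne', Complex.ofReal_one]
    rw [Complex.cpow_add _ _ hy0, Complex.cpow_one]
    linear_combination (y * ((1 / y : ℝ) : ℂ)) * e3 + e4
  rw [e1]
  simp only [hw, hGdef]
  linear_combination (-(Complex.exp (β * (θ * Complex.I)) * (Complex.I * Complex.exp (θ * Complex.I)
      * Complex.exp (Complex.I * (((1 : ℝ) : ℂ) * Complex.exp (θ * Complex.I))))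
    * (branchPow Complex.I (P.rp + ((1 / y : ℝ) : ℂ) * Complex.exp (θ * Complex.I) - P.rp) (-β)
      * f (P.rp + ((1 / y : ℝ) : ℂ) * Complex.exp (θ * Complex.I))))) * e2

end TeukolskyParams

/-! ### Deformation of the Hankel contour into a wedge -/

theorem wedge_corner_right (ρ : ℝ) :
    ((√2 * ρ : ℝ) : ℂ) * Complex.exp (((Real.pi / 4 : ℝ) : ℂ) * Complex.I)
      = ρ + ρ * Complex.I := by
  have h : √2 * √2 = (2 : ℝ) := Real.mul_self_sqrt zero_le_two
  apply Complex.ext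
  · rw [Complex.re_ofReal_mul, Complex.exp_ofReal_mul_I_re, Real.cos_pi_div_four]
    simp
    linear_combination ρ / 2 * h
  · rw [Complex.im_ofReal_mul, Complex.exp_ofReal_mul_I_im, Real.sin_pi_div_four]
    simp
    linear_combination ρ / 2 * h

theorem wedge_corner_left (ρ : ℝ) :
    ((√2 * ρ : ℝ) : ℂ) * Complex.exp (((-(5 * Real.pi / 4) : ℝ) : ℂ) * Complex.I)
      = -ρ + ρ * Complex.I := by
  have h : √2 * √2 = (2 : ℝ) := Real.mul_self_sqrt zero_le_two
  have e : -(5 * Real.pi / 4) = -(Real.pi / 4 + Real.pi) := by ring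
  apply Complex.ext
  · rw [Complex.re_ofReal_mul, Complex.exp_ofReal_mul_I_re, e, Real.cos_neg, Real.cos_add_pi,
      Real.cos_pi_div_four]
    simp
    linear_combination ρ / 2 * h
  · rw [Complex.im_ofReal_mul, Complex.exp_ofReal_mul_I_im, e, Real.sin_neg, Real.sin_add_pi,
      Real.sin_pi_div_four]
    simp
    linear_combination ρ / 2 * h

namespace TeukolskyParams

variable {P : TeukolskyParams}

/-- Only the part of a leg below height ρ is deformed, and it is recorded by values of a primitive.
The part above stays as an integral and is treated as a negligible tail. -/
theorem verticalIntegral_eq_add {F φ : ℂ → ℂ} {U : Set ℂ} (hF : ∀ z ∈ U, HasDerivAt F (φ z) z)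
    (hφ : ContinuousOn φ U) {z : ℂ} (hz : ∀ t : ℝ, z + t * Complex.I ∈ U) {ρ : ℝ} (hρ : 0 ≤ ρ)
    (hint : VerticalIntegrable φ z) :
    verticalIntegral φ z = F (z + ρ * Complex.I) - F z
      + ∫ t in Ioi ρ, Complex.I * φ (z + t * Complex.I) := by
  have h1 : ∫ t in (0 : ℝ)..ρ, Complex.I * φ (z + t * Complex.I)
      = F (z + ρ * Complex.I) - F (z + (0 : ℝ) * Complex.I) := by
    refine intervalIntegral.integral_eq_sub_of_hasDerivAt
      (f := fun t : ℝ => F (z + t * Complex.I)) (fun t _ => ?_) ?_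
    · have h2 : HasDerivAt (fun t : ℝ => z + t * Complex.I) Complex.I t := by
        simpa using ((hasDerivAt_id t).ofReal_comp.mul_const Complex.I).const_add z
      exact ((hF _ (hz t)).comp t h2).congr_deriv (mul_comm _ _)
    · refine Continuous.intervalIntegrable (continuous_const.mul ?_) _ _
      have hline : Continuous fun t : ℝ => z + t * Complex.I := by fun_prop
      exact hφ.comp_continuous hline hz
  have h3 := intervalIntegral.integral_Ioi_sub_Ioi (hint.const_mul Complex.I) hρ
  rw [h1, Complex.ofReal_zero, zero_mul, add_zero] at h3
  rw [verticalIntegral]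
  linear_combination h3

theorem semicircleIntegral_eq_sub {F φ : ℂ → ℂ}
    (hF : ∀ z ∈ P.cutDomain Complex.I, HasDerivAt F (φ z) z)
    (hφ : ContinuousOn φ (P.cutDomain Complex.I)) {ρ : ℝ} (hρ : 0 < ρ) (hρ' : ρ < P.rp - P.rm) :
    P.semicircleIntegral φ ρ = F (P.rp + ρ) - F (P.rp - ρ) := by
  have hle : -Real.pi ≤ 0 := by linarith [Real.pi_pos]
  have e1 : circleMap (P.rp : ℂ) ρ (-Real.pi) = P.rp - ρ := by
    rw [circleMap]
    push_cast
    rw [neg_mul, Complex.exp_neg, Complex.exp_pi_mul_I]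
    ring
  have e2 : circleMap (P.rp : ℂ) ρ 0 = P.rp + ρ := by simp [circleMap]
  rw [semicircleIntegral, ← e1, ← e2]
  refine intervalIntegral.integral_eq_sub_of_hasDerivAt
    (f := fun θ : ℝ => F (circleMap (P.rp : ℂ) ρ θ)) (fun θ hθ => ?_) ?_
  · rw [uIcc_of_le hle] at hθ
    exact ((hF _ (circleMap_mem_cutDomain hρ hρ' hθ)).comp θ
      (differentiable_circleMap _ _ θ).hasDerivAt).congr_deriv (mul_comm _ _)
  · refine ContinuousOn.intervalIntegrable ?_
    rw [uIcc_of_le hle]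
    have hd : deriv (circleMap (P.rp : ℂ) ρ) = fun θ => circleMap 0 ρ θ * Complex.I :=
      funext fun θ => deriv_circleMap _ _ _
    have hd' : Continuous (deriv (circleMap (P.rp : ℂ) ρ)) := by
      rw [hd]
      fun_prop
    exact hd'.continuousOn.mul (hφ.comp (continuous_circleMap _ _).continuousOn
      fun θ hθ => circleMap_mem_cutDomain hρ hρ' hθ)

theorem kernelMul_vertical (f : ℂ → ℂ) (δ y t : ℝ) :
    kernelMul P.rp f y (P.rp + δ + t * Complex.I)
      = Complex.exp (((y * δ : ℝ) : ℂ) * Complex.I)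
        * (Complex.exp (-(y * t)) * f (P.rp + δ + t * Complex.I)) := by
  have h : Complex.exp (Complex.I * (y * (P.rp + δ + t * Complex.I - P.rp)))
      = Complex.exp (((y * δ : ℝ) : ℂ) * Complex.I) * Complex.exp (-(y * t)) := by
    rw [← Complex.exp_add]
    congr 1
    push_cast
    linear_combination (y * t : ℂ) * Complex.I_sq
  rw [kernelMul, h, mul_assoc]

theorem verticalIntegrable_kernelMul {f : ℂ → ℂ} {δ C Y : ℝ}
    (hcont : Continuous fun t : ℝ => f (P.rp + δ + t * Complex.I))
    (hf : ∀ t : ℝ, 0 < t → ‖f (P.rp + δ + t * Complex.I)‖ ≤ C * Real.exp (Y * t)) {y : ℝ}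
    (hy : Y < y) : VerticalIntegrable (kernelMul P.rp f y) (P.rp + δ) := by
  have h1 := (exp_neg_integrableOn_Ioi 0 (sub_pos.2 hy)).const_mul C
  unfold VerticalIntegrable
  simp only [kernelMul_vertical]
  refine Integrable.mono' h1 (Continuous.aestronglyMeasurable
    (continuous_const.mul (Continuous.mul (by fun_prop) hcont))) ?_
  filter_upwards [ae_restrict_mem measurableSet_Ioi] with t ht
  have h2 : (-((y : ℂ) * t)).re = -(y * t) := by simp
  rw [norm_mul, norm_mul, Complex.norm_exp_ofReal_mul_I, one_mul, Complex.norm_exp, h2]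
  calc Real.exp (-(y * t)) * ‖f (P.rp + δ + t * Complex.I)‖
      ≤ Real.exp (-(y * t)) * (C * Real.exp (Y * t)) := by
        gcongr
        exact hf t ht
    _ = C * Real.exp (-(y * t) + Y * t) := by rw [Real.exp_add]; ring
    _ = _ := by ring_nf

theorem tendsto_vertical_tail {f : ℂ → ℂ} {δ ρ C Y : ℝ} (hρ : 0 < ρ)
    (hf : ∀ t : ℝ, 0 < t → ‖f (P.rp + δ + t * Complex.I)‖ ≤ C * Real.exp (Y * t)) (β : ℂ) :
    Tendsto (fun y : ℝ => (y : ℂ) ^ β * ∫ t in Ioi ρ,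
      Complex.I * kernelMul P.rp f y (P.rp + δ + t * Complex.I)) atTop (𝓝 0) := by
  have h := tendsto_cpow_mul_integral_tail (f := fun t : ℝ => f (P.rp + δ + t * Complex.I)) hρ hf β
  refine squeeze_zero_norm (fun y => le_of_eq ?_) (tendsto_zero_iff_norm_tendsto_zero.1 h)
  simp only [kernelMul_vertical]
  rw [integral_const_mul, integral_const_mul, norm_mul, norm_mul, norm_mul, norm_mul,
    Complex.norm_I, Complex.norm_exp_ofReal_mul_I, one_mul, one_mul]

theorem exists_bound_vertical (hM : |P.a| < P.M) (hω : 0 < P.ω) {R : ℂ → ℂ}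
    (hR : P.IsRadialSolution Complex.I R) {δ : ℝ} (hδ : P.rm < P.rp + δ) (hδ0 : δ ≠ 0) :
    ∃ C Y : ℝ, ∀ t : ℝ, 0 < t → ‖P.weight Complex.I (P.rp + δ + t * Complex.I)
      * R (P.rp + δ + t * Complex.I)‖ ≤ C * Real.exp (Y * t) := by
  have hline : Continuous fun t : ℝ => (P.rp + δ : ℂ) + t * Complex.I := by fun_prop
  have hcont := (hR.continuousOn_weight_mul hM).comp_continuous hline (vertical_rp_add_mem hδ hδ0)
  obtain ⟨C, hC⟩ := (expType_weight_mul hM hω Complex.norm_I hR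
    fun t _ => vertical_rp_add_mem hδ hδ0 t).exists_bound hcont.continuousOn
    ((hcont.tendsto 0).mono_left nhdsWithin_le_nhds)
  exact ⟨C, _, hC⟩

theorem differentiableOn_weight_mul (hM : |P.a| < P.M) {c : ℂ} {R : ℂ → ℂ}
    (hR : P.IsRadialSolution c R) :
    DifferentiableOn ℂ (fun r => P.weight c r * R r) (P.cutDomain c) := fun _ hr =>
  ((weight_hasDerivAt hM hr).differentiableAt.mul
    (hR.1.differentiableAt ((isOpen_cutDomain c).mem_nhds hr))).differentiableWithinAt

/-- Vertical legs cannot be rotated onto the cut, so the wedge is tilted: its rays end at r₊ ± ρ +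
iρ, on the legs themselves. Wedge and lower part of the Hankel contour share these endpoints, hence
have equal integrals, and the tails above height ρ vanish in the limit. -/
theorem tendsto_hankel_kernel (hM : |P.a| < P.M) (hω : 0 < P.ω) {R : ℂ → ℂ}
    (hR : P.IsRadialSolution Complex.I R) {ρ : ℝ} (hρ : 0 < ρ) (hρ' : ρ < P.rp - P.rm) {β G₀ : ℂ}
    (hG : Tendsto (fun r => branchPow Complex.I (r - P.rp) (-β) * (P.weight Complex.I r * R r))
      (𝓝[P.cutDomain Complex.I] (P.rp : ℂ)) (𝓝 G₀)) :
    Tendsto (fun y : ℝ => (y : ℂ) ^ (β + 1) *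
      (-verticalIntegral (kernelMul P.rp (fun r => P.weight Complex.I r * R r) y) (P.rp - ρ)
        + P.semicircleIntegral (kernelMul P.rp (fun r => P.weight Complex.I r * R r) y) ρ
        + verticalIntegral (kernelMul P.rp (fun r => P.weight Complex.I r * R r) y) (P.rp + ρ)))
      atTop (𝓝 (G₀ * wedgeConst β)) := by
  have hpi := Real.pi_pos
  set f : ℂ → ℂ := fun r => P.weight Complex.I r * R r with hf
  have hfd : DifferentiableOn ℂ f (P.cutDomain Complex.I) := differentiableOn_weight_mul hM hR
  have hneg : (P.rp : ℂ) + ((-ρ : ℝ) : ℂ) = P.rp - ρ := by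
    push_cast
    ring
  have m₁ := vertical_rp_add_mem (P := P) (δ := ρ) (by linarith) hρ.ne'
  have m₀ := vertical_rp_add_mem (P := P) (δ := -ρ) (by linarith) (by linarith)
  obtain ⟨C₁, Y₁, b₁⟩ := exists_bound_vertical hM hω hR (δ := ρ) (by linarith) hρ.ne'
  obtain ⟨C₀, Y₀, b₀⟩ := exists_bound_vertical hM hω hR (δ := -ρ) (by linarith) (by linarith)
  have hc₁ := hfd.continuousOn.comp_continuous (by fun_prop) m₁
  have hc₀ := hfd.continuousOn.comp_continuous (by fun_prop) m₀
  have hl : 0 < √2 * ρ := by positivity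
  have hs2 : √2 * (√2 / 2) = (1 : ℝ) := by
    have : √2 * √2 = (2 : ℝ) := Real.mul_self_sqrt zero_le_two
    linear_combination this / 2
  have hmem₁ : ∀ u ∈ Ioc 0 (√2 * ρ),
      (P.rp : ℂ) + u * Complex.exp (((Real.pi / 4 : ℝ) : ℂ) * Complex.I)
        ∈ P.cutDomain Complex.I := fun u hu => by
    refine polar_mem_cutDomain (by linarith) (by linarith) hu.1 ?_
    rw [Real.cos_pi_div_four]
    have h0 : 0 < u * (√2 / 2) := mul_pos hu.1 (by positivity)
    linarith
  have hmem₀ : ∀ u ∈ Ioc 0 (√2 * ρ),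
      (P.rp : ℂ) + u * Complex.exp (((-(5 * Real.pi / 4) : ℝ) : ℂ) * Complex.I)
        ∈ P.cutDomain Complex.I := fun u hu => by
    refine polar_mem_cutDomain (by linarith) (by linarith) hu.1 ?_
    have e : -(5 * Real.pi / 4) = -(Real.pi / 4 + Real.pi) := by ring
    rw [e, Real.cos_neg, Real.cos_add_pi, Real.cos_pi_div_four]
    have h0 : 0 ≤ √2 / 2 := by positivity
    have h1 := mul_le_mul_of_nonneg_right hu.2 h0
    have h2 : √2 * ρ * (√2 / 2) = ρ := by linear_combination ρ * hs2
    linarith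
  have t₁ := tendsto_ray hM hfd.continuousOn hG (by linarith) (by linarith) sin_wedge_right hl hmem₁
  have t₀ := tendsto_ray hM hfd.continuousOn hG (by linarith) (by linarith) sin_wedge_left hl hmem₀
  have ta := tendsto_arc hM hfd.continuousOn hG (θ₀ := -(5 * Real.pi / 4)) (θ₁ := Real.pi / 4)
    (by linarith) (by linarith) (by linarith)
  have v₁ := tendsto_vertical_tail (P := P) (f := f) hρ b₁ (β + 1)
  have v₀ := tendsto_vertical_tail (P := P) (f := f) hρ b₀ (β + 1)
  have key := ((t₁.sub t₀).add ta).add (v₁.sub v₀)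
  rw [sub_zero, add_zero, ← mul_sub, ← mul_add, ← wedgeConst] at key
  refine key.congr' ?_
  filter_upwards [eventually_gt_atTop 0, eventually_gt_atTop Y₁, eventually_gt_atTop Y₀,
    eventually_ge_atTop (1 / (√2 * ρ)), eventually_gt_atTop (1 / (P.rp - P.rm))]
    with y hy hy₁ hy₀ hyl hyd
  have hkd : DifferentiableOn ℂ (kernelMul P.rp f y) (P.cutDomain Complex.I) := fun r hr => by
    have h1 : DifferentiableAt ℂ (fun r : ℂ => Complex.exp (Complex.I * (y * (r - P.rp)))) r := by
      fun_prop
    exact h1.differentiableWithinAt.mul (hfd r hr)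
  obtain ⟨F, hF⟩ := (starConvex_cutDomain hM).exists_primitive (isOpen_cutDomain _) hkd
  have hσ : 0 < 1 / y := one_div_pos.2 hy
  have hσl : 1 / y ≤ √2 * ρ := by
    rw [div_le_iff₀ hl] at hyl
    rw [div_le_iff₀ hy]
    linarith
  have hσd : 1 / y < P.rp - P.rm := by
    rw [div_lt_iff₀ (rp_sub_rm_pos hM)] at hyd
    rw [div_lt_iff₀ hy]
    linarith
  -- The inner radius 1/y is the natural scale of the kernel, and the outer radius √2ρ puts the
  -- corners on the vertical legs.
  have hW := wedge_deformation (c := P.rp) hF hkd.continuousOn hσl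
    (fun u hu => hmem₀ u ⟨hσ.trans_le hu.1, hu.2⟩) (fun u hu => hmem₁ u ⟨hσ.trans_le hu.1, hu.2⟩)
    (by linarith) (fun θ hθ => polar_mem_cutDomain (by linarith [hθ.1]) (by linarith [hθ.2]) hσ
      (by nlinarith [Real.neg_one_le_cos θ]))
  rw [wedge_corner_right, wedge_corner_left] at hW
  have s₁ := verticalIntegral_eq_add hF hkd.continuousOn m₁ hρ.le
    (verticalIntegrable_kernelMul hc₁ b₁ hy₁)
  have s₀ := verticalIntegral_eq_add hF hkd.continuousOn m₀ hρ.le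
    (verticalIntegrable_kernelMul hc₀ b₀ hy₀)
  have sa := semicircleIntegral_eq_sub hF hkd.continuousOn hρ hρ'
  rw [hneg] at s₀
  rw [s₁, s₀, sa]
  have e₁ : (P.rp : ℂ) + (ρ + ρ * Complex.I) = P.rp + ρ + ρ * Complex.I := by ring
  have e₀ : (P.rp : ℂ) + (-ρ + ρ * Complex.I) = P.rp - ρ + ρ * Complex.I := by ring
  rw [e₁, e₀] at hW
  simp only [hneg]
  linear_combination (-((y : ℂ) ^ (β + 1))) * hW

/-! ### Evaluation of the two constants -/

theorem two_xi_sub_re : (2 * P.xi - P.s).re = -P.s := by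
  simp [xi_re]

theorem two_xi_sub_im : (2 * P.xi - P.s).im = 2 * P.xi.im := by
  simp

/-- One factor (r₊ - r₋)^{-s/2} comes from the weight at r₊; the other compensates the factor (r₊ -
r₋)^{s/2} in the horizon limit of Δ^{s/2}|R|. -/
theorem rpow_neg_half_mul (hM : |P.a| < P.M) (f : ℂ) :
    ‖P.regularWeight P.rp * f‖
      = (P.rp - P.rm) ^ (-P.s) * ((P.rp - P.rm) ^ (P.s / 2) * ‖f‖) := by
  rw [norm_mul, norm_regularWeight hM, ← mul_assoc, ← Real.rpow_add (rp_sub_rm_pos hM)]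
  congr 2
  ring

theorem verticalIntegral_const_mul (b : ℂ) (φ : ℂ → ℂ) (z : ℂ) :
    verticalIntegral (fun r => b * φ r) z = b * verticalIntegral φ z := by
  simp only [verticalIntegral, mul_left_comm Complex.I]
  rw [integral_const_mul]

theorem semicircleIntegral_const_mul (b : ℂ) (φ : ℂ → ℂ) (ρ : ℝ) :
    P.semicircleIntegral (fun r => b * φ r) ρ = b * P.semicircleIntegral φ ρ := by
  simp only [semicircleIntegral, mul_left_comm _ b]
  rw [intervalIntegral.integral_const_mul]

theorem tendsto_norm_euler (hM : |P.a| < P.M) (hω : 0 < P.ω) (hs : P.s ≤ 0) {R : ℂ → ℂ}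
    (hR : P.IsRadialSolution 1 R) (hR' : P.IngoingAtHorizon 1 R) :
    ∃ L : ℝ, Tendsto (fun r : ℝ => P.DeltaReal r ^ (P.s / 2) * ‖R r‖) (𝓝[>] P.rp) (𝓝 L) ∧
      Tendsto (fun x : ℝ => ‖P.toU (P.eulerTransform R) x‖) atTop (𝓝 (P.eulerConst * L)) := by
  obtain ⟨f, H, hH, hRH⟩ := hR'.exists_tendsto norm_one
  refine ⟨_, tendsto_horizon_norm hM Complex.one_mem_slitPlane hH hRH, ?_⟩
  have h1 := tendsto_euler_kernel hM hω hs hR (tendsto_weight_mul hM hH hRH)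
  have h2 := tendsto_norm_toU hM hω (g := P.eulerTransform R) (fun x _ => by
    rw [eulerTransform, transformIntegrand_eq_kernelMul, verticalIntegral_const_mul, norm_mul,
      Complex.norm_exp_ofReal_mul_I, one_mul]) two_xi_sub_re h1
  convert h2 using 2
  -- The modulus of i^β is e^{-(π/2) Im β}, and Im β = 2 Im ξ.
  have e : ‖branchPow 1 Complex.I (2 * P.xi - P.s)‖ = Real.exp (-Real.pi * P.xi.im) := by
    have : ((2 * P.xi - P.s) * (Real.pi / 2 * Complex.I)).re = -Real.pi * P.xi.im := by
      rw [show (Real.pi : ℂ) / 2 = ((Real.pi / 2 : ℝ) : ℂ) by push_cast; rfl, ← mul_assoc,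
        Complex.mul_I_re, Complex.im_mul_ofReal, two_xi_sub_im]
      ring
    rw [branchPow, branchLog, one_mul, Complex.log_one, sub_zero, Complex.log_I, Complex.norm_exp,
      this]
  rw [norm_mul, norm_mul, norm_mul, Complex.norm_I, e, rpow_neg_half_mul hM, eulerConst]
  ring

theorem tendsto_norm_hankel (hM : |P.a| < P.M) (hω : 0 < P.ω) {R : ℂ → ℂ}
    (hR : P.IsRadialSolution Complex.I R) (hR' : P.IngoingAtHorizon Complex.I R) {ρ : ℝ}
    (hρ : 0 < ρ) (hρ' : ρ < P.rp - P.rm) :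
    ∃ L : ℝ, Tendsto (fun r : ℝ => P.DeltaReal r ^ (P.s / 2) * ‖R r‖) (𝓝[>] P.rp) (𝓝 L) ∧
      Tendsto (fun x : ℝ => ‖P.toU (P.hankelTransform ρ R) x‖) atTop
        (𝓝 (P.hankelConst * L)) := by
  obtain ⟨f, H, hH, hRH⟩ := hR'.exists_tendsto Complex.norm_I
  refine ⟨_, tendsto_horizon_norm hM (Or.inr (by simp)) hH hRH, ?_⟩
  have h1 := tendsto_hankel_kernel hM hω hR hρ hρ' (tendsto_weight_mul hM hH hRH)
  have h2 := tendsto_norm_toU hM hω (g := P.hankelTransform ρ R) (fun x _ => by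
    rw [hankelTransform, transformIntegrand_eq_kernelMul, verticalIntegral_const_mul,
      verticalIntegral_const_mul, semicircleIntegral_const_mul, ← mul_neg, ← mul_add, ← mul_add,
      norm_mul, Complex.norm_exp_ofReal_mul_I, one_mul]) two_xi_sub_re h1
  convert h2 using 2
  have e1 : -(2 * P.xi - P.s) = P.s - 2 * P.xi := by ring
  have e2 : Real.pi / 2 * (2 * P.xi.im) = Real.pi * P.xi.im := by ring
  rw [norm_mul, norm_wedgeConst, rpow_neg_half_mul hM, hankelConst, e1, two_xi_sub_im, e2]
  ring

end TeukolskyParams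

end

theorem mainTheorem3 (P : TeukolskyParams)
    (hM : |P.a| < P.M) (hω : 0 < P.ω) :
    -- the potential of the transformed equation is real
    (∀ x > P.rp, (P.Vtilde x).im = 0) ∧
    -- the ray from `r₊` to `r₊ + i∞`, for `s ≤ 0`
    (P.s ≤ 0 → ∀ R : ℂ → ℂ, P.IsRadialSolution 1 R → P.IngoingAtHorizon 1 R →
      (∀ x > P.rp, TeukolskyParams.VerticalIntegrable (P.transformIntegrand 1 R x) P.rp) ∧
      P.SolvesTransformed (P.toU (P.eulerTransform R)) ∧
      ∃ L : ℝ,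
        Tendsto (fun r : ℝ => P.DeltaReal r ^ (P.s / 2) * ‖R r‖) (𝓝[>] P.rp) (𝓝 L) ∧
        Tendsto (fun x : ℝ => ‖P.toU (P.eulerTransform R) x‖) atTop (𝓝 (P.eulerConst * L))) ∧
    -- the rotated Hankel contour, for arbitrary `s`
    (∀ R : ℂ → ℂ, P.IsRadialSolution Complex.I R → P.IngoingAtHorizon Complex.I R →
      ∀ ρ : ℝ, 0 < ρ → ρ < P.rp - P.rm →
        (∀ x > P.rp,
          TeukolskyParams.VerticalIntegrable (P.transformIntegrand Complex.I R x) (P.rp - ρ) ∧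
          TeukolskyParams.VerticalIntegrable (P.transformIntegrand Complex.I R x) (P.rp + ρ)) ∧
        P.SolvesTransformed (P.toU (P.hankelTransform ρ R)) ∧
        ∃ L : ℝ,
          Tendsto (fun r : ℝ => P.DeltaReal r ^ (P.s / 2) * ‖R r‖) (𝓝[>] P.rp) (𝓝 L) ∧
          Tendsto (fun x : ℝ => ‖P.toU (P.hankelTransform ρ R) x‖) atTop
            (𝓝 (P.hankelConst * L))) := by
  refine ⟨fun x _ => P.Vtilde_im hM, fun hs R hR hR' => ?_, fun R hR hR' ρ hρ hρ' => ?_⟩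
  · obtain ⟨h1, h2⟩ := TeukolskyParams.euler_solves hM hω hs hR hR'
    exact ⟨h1, h2, TeukolskyParams.tendsto_norm_euler hM hω hs hR hR'⟩
  · obtain ⟨h1, h2⟩ := TeukolskyParams.hankel_solves hM hω hR hρ hρ'
    exact ⟨h1, h2, TeukolskyParams.tendsto_norm_hankel hM hω hR hR' hρ hρ'⟩
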